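/- **Theorem (classical gradient estimation from comparisons).** There is a universal constant $C>0$ such that the following holds. Let $n\ge 2$, $L>0$, $\gamma>0$, $\varepsilon\in(0,1/\sqrt2)$, let $f:\mathbb R^n\to\mathbb R$ be differentiable and $L$-smooth, i.e. $\|\nabla f(y)-\nabla f(z)\|\le L\|y-z\|$ for all $y,z$, and let $O$ be a comparison oracle for $f$: a function $O:\mathbb R^n\times\mathbb R^n\to\{1,-1\}$ such that $O(y,z)=1$ implies $f(y)\ge f(z)$ and $O(y,z)=-1$ implies $f(y)\le f(z)$ (ties are answered arbitrarily). Let $x\in\mathbb R^n$ with $\|\nabla f(x)\|\ge\gamma$. Then, with probability at least $2/3$ over its random choice of $U$, the algorithm below terminates after at most $C\,n\log(1/\varepsilon)$ queries to $O$ and outputs a unit vector $h$ with $$\Big\|\frac{\nabla f(x)}{\|\nabla f(x)\|}-h\Big\|\le\varepsilon .$$ *Directional preference.* For a unit vector $v$ and $\Delta>0$, the test $\mathrm{DP}(v,\Delta)$ makes the single query $O(x+\tfrac{2\Delta}{L}v,\,x)$; it reports "$\ge-\Delta$" if the answer is $1$ and "$\le\Delta$" if the answer is $-1$. *Algorithm.*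 Put $\Delta_1=\gamma/n$ and $\Delta_2=\varepsilon\gamma/(400\sqrt n)$. 1. Draw $U$ from the Haar probability measure on the orthogonal group of $\mathbb R^n$ and put $v_i=Ue_i$. For $i=1,\dots,n$, replace $v_i$ by $-v_i$ if $\mathrm{DP}(v_i,\Delta_1)$ reports "$\le\Delta_1$". Put $u=\frac1{\sqrt n}\sum_{i=1}^n v_i$. 2. Take an orthonormal basis $u_1=u,u_2,\dots,u_n$, given by an arbitrary fixed rule from $u$. For $i=2,\dots,n$, replace $u_i$ by $-u_i$ if $\mathrm{DP}(u_i,\Delta_1)$ reports "$\le\Delta_1$". Write $w_i(\beta)=\beta u_1-u_i$ and $\hat w_i(\beta)=w_i(\beta)/\|w_i(\beta)\|$. 3. For $i=2,\dots,n$: - start with $\ell_i=1$; call $\mathrm{DP}(\hat w_i(\ell_i/\sqrt n),\Delta_2)$ and replace $\ell_i$ by $2\ell_i$ if it reports "$\le\Delta_2$"; repeat this until it reports "$\ge-\Delta_2$"; - start with $\alpha_{i,1}=-\ell_i/\sqrt n$, $\alpha_{i,2}=\ell_i/\sqrt n$; put $\alpha_i=(\alpha_{i,1}+\alpha_{i,2})/2$,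 call $\mathrm{DP}(\hat w_i(\alpha_i),\Delta_2)$, and set $\alpha_{i,1}=\alpha_i$ if it reports "$\le\Delta_2$" and $\alpha_{i,2}=\alpha_i$ otherwise; repeat this until $\alpha_{i,2}-\alpha_{i,1}<\varepsilon/(4\sqrt n)$. 4. Output $h=\big(\sum_{i=1}^n\alpha_iu_i\big)/\sqrt{\sum_{i=1}^n\alpha_i^2}$, where $\alpha_1=1$ and, for $i\ge2$, $\alpha_i$ is its last value in step 3. -/

import Mathlib

open MeasureTheory
open scoped ENNReal

noncomputable section

namespace GradComparison

/-- `ℝⁿ` with the Euclidean norm. -/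
abbrev E (n : ℕ) : Type := EuclideanSpace ℝ (Fin n)

/-- `f : ℝⁿ → ℝ` is differentiable and its gradient is `L`-Lipschitz. -/
def IsLSmooth {n : ℕ} (L : ℝ) (f : E n → ℝ) : Prop :=
  Differentiable ℝ f ∧ ∀ x y : E n, ‖gradient f x - gradient f y‖ ≤ L * ‖x - y‖

/-- `O` is a comparison oracle for `f`, with values in `ℤˣ = {1, -1}`: the answer `1` to the query
`(x, y)` means `f x ≥ f y`, the answer `-1` means `f x ≤ f y`; on ties either answer is allowed. -/
def IsComparisonOracle {n : ℕ} (f : E n → ℝ) (O : E n → E n → ℤˣ) : Prop :=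
  ∀ x y : E n, (O x y = 1 → f x ≥ f y) ∧ (O x y = -1 → f x ≤ f y)

/-! ### Procedures with access to a comparison oracle -/

/-- A procedure that may query an oracle `V → V → ℤˣ` and returns an element of `α`. Run on an
oracle, it is either undefined (it does not terminate) or it yields its result together with the
number of queries that it made. -/
def QueryM (V α : Type) : Type := (V → V → ℤˣ) → Part (α × ℕ)

/-- `return` makes no query; in a sequential composition the numbers of queries are added, and
the composition terminates if both parts do. -/
instance (V : Type) : Monad (QueryM V) where
  pure a := fun _ => Part.some (a, 0)
  bind p k := fun O => (p O).bind fun r => (k r.1 O).map fun s => (s.1, r.2 + s.2)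

/-- A single query to the oracle. -/
def query {V : Type} (y z : V) : QueryM V ℤˣ := fun O => Part.some (O y z, 1)

/-- The loop "repeat `body` until its flag is `true`", started in the state `s`. It is undefined
if the flag never becomes `true`. -/
def repeatUntil {V σ : Type} (body : σ → QueryM V (σ × Bool)) (s : σ) : QueryM V σ := fun O =>
  PFun.fix
    (fun p : σ × ℕ => (body p.1 O).map fun r =>
      if r.1.2 = true then Sum.inl (r.1.1, p.2 + r.2) else Sum.inr (r.1.1, p.2 + r.2))
    (s, 0)

/-- The loop "for each index `i`, in increasing order, do `p i`", which collects the results. -/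
def forEach {V α : Type} : {n : ℕ} → (Fin n → QueryM V α) → QueryM V (Fin n → α)
  | 0, _ => pure Fin.elim0
  | _ + 1, p => do
      let a ← p 0
      let s ← forEach fun i => p i.succ
      pure (Fin.cons a s)

/-! ### The Haar probability measure on the orthogonal group -/

/-- The orthogonal group of `ℝⁿ`, as a group of matrices. -/
abbrev OrthGroup (n : ℕ) : Type := Matrix.orthogonalGroup (Fin n) ℝ

instance (n : ℕ) : MeasurableSpace (OrthGroup n) := borel _

instance (n : ℕ) : BorelSpace (OrthGroup n) := ⟨rfl⟩

instance (n : ℕ) : CompactSpace (OrthGroup n) := by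
  have hcl : IsClosed ((Matrix.orthogonalGroup (Fin n) ℝ : Set (Matrix (Fin n) (Fin n) ℝ))) :=
    isClosed_unitary
  have hK : IsCompact (Set.pi Set.univ fun _ : Fin n =>
      Set.pi Set.univ fun _ : Fin n => Metric.closedBall (0 : ℝ) 1) :=
    isCompact_univ_pi fun _ => isCompact_univ_pi fun _ => isCompact_closedBall 0 1
  refine isCompact_iff_compactSpace.mp (hK.of_isClosed_subset hcl ?_)
  intro A hA i _ j _
  simpa using entry_norm_bound_of_unitary hA i j

/-- The Haar measure on the orthogonal group, normalised to total mass `1`. -/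
def haarOrth (n : ℕ) : Measure (OrthGroup n) := Measure.haarMeasure ⊤

instance (n : ℕ) : IsProbabilityMeasure (haarOrth n) :=
  ⟨by simpa [haarOrth] using
    Measure.haarMeasure_self (K₀ := (⊤ : TopologicalSpace.PositiveCompacts (OrthGroup n)))⟩

/-- The `i`-th vector `U eᵢ` of the frame given by `U`, that is, the `i`-th column of `U`. -/
def orthColumn {n : ℕ} (U : OrthGroup n) (i : Fin n) : E n :=
  WithLp.toLp 2 ((U : Matrix (Fin n) (Fin n) ℝ).col i)

/-! ### The algorithms -/

/-- The two possible reports of a directional preference test at `x` in direction `v` with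
precision `Δ`: "`⟨∇f(x), v⟩ ≥ -Δ`" and "`⟨∇f(x), v⟩ ≤ Δ`". -/
inductive Preference : Type
  | geNeg
  | le

/-- Directional preference: one query at `(x + (2Δ/L) v, x)`. -/
def dp {n : ℕ} (L : ℝ) (x v : E n) (Δ : ℝ) : QueryM (E n) Preference := do
  let a ← query (x + (2 * Δ / L) • v) x
  pure (if a = 1 then Preference.geNeg else Preference.le)

/-- The sign by which `v` is multiplied after a directional preference test: `v` is replaced by
`-v` if the test reports "`≤ Δ`". -/
def signTest {n : ℕ} (L : ℝ) (x v : E n) (Δ : ℝ) : QueryM (E n) ℝ := do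
  match ← dp L x v Δ with
  | Preference.geNeg => pure 1
  | Preference.le => pure (-1)

/-- Gradient estimation with constant precision, for the frame drawn as `U`. -/
def constantEstimation {n : ℕ} (L γ : ℝ) (x : E n) (U : OrthGroup n) : QueryM (E n) (E n) := do
  let s ← forEach fun i : Fin n => signTest L x (orthColumn U i) (γ / n)
  pure ((1 / √(n : ℝ)) • ∑ i, s i • orthColumn U i)

/-- The unit vector `w(β) / ‖w(β)‖`, where `w(β) = β e₁ - eᵢ`. -/
def searchDir {n : ℕ} (e₁ eᵢ : E n) (β : ℝ) : E n :=
  ‖β • e₁ - eᵢ‖⁻¹ • (β • e₁ - eᵢ)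

/-- The doubling search: starting from `ℓ = 1`, double `ℓ` as long as the test at
`β = ℓ / √n` reports "`≤ Δ`". -/
def boundSearch {n : ℕ} (L Δ : ℝ) (x e₁ eᵢ : E n) : QueryM (E n) ℝ :=
  repeatUntil
    (fun ℓ : ℝ => do
      match ← dp L x (searchDir e₁ eᵢ (ℓ / √(n : ℝ))) Δ with
      | Preference.le => pure (2 * ℓ, false)
      | Preference.geNeg => pure (ℓ, true))
    1

/-- The binary search on `[-ℓ / √n, ℓ / √n]`, run until the interval is shorter than
`ε / (4 √n)`. The state is `(α₁, α₂, α)`: the ends of the interval, and the midpoint that was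
tested last, which is returned. -/
def binarySearch {n : ℕ} (L ε Δ : ℝ) (x e₁ eᵢ : E n) (ℓ : ℝ) : QueryM (E n) ℝ := do
  let s ← repeatUntil
    (fun s : ℝ × ℝ × ℝ => do
      let m := (s.1 + s.2.1) / 2
      let s' ← (do
        match ← dp L x (searchDir e₁ eᵢ m) Δ with
        | Preference.le => pure (m, s.2.1, m)
        | Preference.geNeg => pure (s.1, m, m))
      pure (s', decide (s'.2.1 - s'.1 < ε / (4 * √(n : ℝ)))))
    (-ℓ / √(n : ℝ), ℓ / √(n : ℝ), 0)
  pure s.2.2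

/-- Classical gradient estimation with given precision `ε`, for the frame drawn as `U`. The
index `0 : Fin n` plays the role of the first coordinate. `frame` performs the change of basis:
`frame u` is an orthonormal basis with first vector `u`, for each unit vector `u`. -/
def classicalEstimation {n : ℕ} (frame : E n → OrthonormalBasis (Fin n) ℝ (E n))
    (L γ ε : ℝ) (x : E n) (U : OrthGroup n) : QueryM (E n) (E n) := do
  let Δ₁ : ℝ := γ / n
  let Δ₂ : ℝ := ε * γ / (400 * √(n : ℝ))
  let u ← constantEstimation L γ x U
  let t ← forEach fun i : Fin n =>
    if i.val = 0 then pure 1 else signTest L x (frame u i) Δ₁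
  let e : Fin n → E n := fun i => t i • frame u i
  let α ← forEach fun i : Fin n =>
    if i.val = 0 then pure 1 else do
      let ℓ ← boundSearch L Δ₂ x u (e i)
      binarySearch L ε Δ₂ x u (e i) ℓ
  pure ((1 / √(∑ i, α i ^ 2)) • ∑ i, α i • e i)

end GradComparison

end

/-! Only the direction g = ∇f(x)/‖∇f(x)‖ matters. By smoothness, one comparison at distance 2Δ/L
determines the sign of a directional derivative up to an error Δ (`exists_mem_dp`). Let a_i = ⟨g, U
e_i⟩. The sign tests in the frame U can err only where |a_i| ≤ 1/n, so b = ⟨g, u⟩ is at least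
`signedSum a` / √n. For n ≥ 3, `GoodFrame` asks that this signed sum be at least 1 and at least
√n/24, that is, b ≥ 1/√n and b ≥ 1/24. For n = 2 the bounds that the searches need hold for every
frame.

In the second basis, step 3 searches for the ratios ⟨g, u_i⟩/b. The bound b ≥ 1/√n makes them at
least -1/√n, so that the lower end of each search interval is valid from the start. The bound b ≥
1/24 keeps the tolerance of the tests, divided by b, of order ε/√n, and it bounds the sum of the
squared ratios by 576. A ratio a is found up to O(ε/√n + ε|a|/√n) with O(1 + √n|a| + log(1/ε))
queries. The squared errors, scaled by b, add up to at most ε²/4, and normalising at most doubles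
the distance to g. As √n|a| ≤ (1 + n a²)/2, the queries add up to O(n log(1/ε)); here log(1/ε) is
bounded below because ε < 1/√2.

It remains to see that a Haar frame is bad with probability at most 1/3. The coordinates of g in
such a frame are distributed as a normalised Gaussian vector (`lintegral_frameCoord`), and two of
them have density (n-2)/(2π) · (1-|a|²)^((n-4)/2) on the unit disc. A bad frame has many small
coordinates. A nonnegative weight on pairs of coordinates, with total at least 1 on every bad frame,
therefore reduces the bound to an integral over the disc (`haarOrth_le_of_offDiag`). For n ≥ 576 at
least half of the coordinates are below 1/(3√n). For 5 ≤ n < 576 the coordinates below 1/n are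
counted, and for n = 5, 6, 7 their sizes are used as well. For n = 4 the law of the two remaining
coordinates enters, and for n = 3 an explicit planar region. -/

namespace GradComparison

/-! ### Runs of procedures with oracle access -/

section Runs

variable {V α β σ : Type} {O : V → V → ℤˣ}

theorem mem_pure (a : α) : (a, 0) ∈ (pure a : QueryM V α) O := Part.mem_some _

theorem mem_bind {p : QueryM V α} {k : α → QueryM V β} {a : α} {b : β} {q r : ℕ}
    (hp : (a, q) ∈ p O) (hk : (b, r) ∈ k a O) : (b, q + r) ∈ (p >>= k) O :=
  Part.mem_bind_iff.2 ⟨(a, q), hp, (Part.mem_map_iff _).2 ⟨(b, r), hk, rfl⟩⟩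

theorem mem_bind_pure {p : QueryM V α} {k : α → β} {a : α} {q : ℕ}
    (hp : (a, q) ∈ p O) : (k a, q) ∈ (p >>= fun x => pure (k x)) O :=
  mem_bind (r := 0) hp (mem_pure _)

theorem mem_query (y z : V) : (O y z, 1) ∈ query y z O := Part.mem_some _

theorem mem_forEach {n : ℕ} {p : Fin n → QueryM V α} {a : Fin n → α} {q : Fin n → ℕ}
    (h : ∀ i, (a i, q i) ∈ p i O) : (a, ∑ i, q i) ∈ forEach p O := by
  induction n with
  | zero =>
    rw [Subsingleton.elim a Fin.elim0, Fin.sum_univ_zero]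
    exact mem_pure (O := O) (Fin.elim0 : Fin 0 → α)
  | succ n ih =>
    rw [Fin.sum_univ_succ, ← Fin.cons_self_tail a]
    exact mem_bind (h 0) (mem_bind (r := 0) (ih (a := Fin.tail a) fun i => h i.succ)
      (mem_pure _))

/-- Termination and partial correctness of a loop whose body makes one query, from an invariant
indexed by the remaining number of iterations. -/
theorem exists_mem_repeatUntil {body : σ → QueryM V (σ × Bool)} {Inv : ℕ → σ → Prop}
    {Post : σ → Prop}
    (h : ∀ N s, Inv N s → ∃ s' b, ((s', b), 1) ∈ body s O ∧
      (b = true → 1 ≤ N ∧ Post s') ∧ (b = false → ∃ M, M < N ∧ Inv M s'))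
    {N : ℕ} {s : σ} (hs : Inv N s) :
    ∃ s' q, (s', q) ∈ repeatUntil body s O ∧ q ≤ N ∧ Post s' := by
  -- The query counter is part of the state of the loop, so the induction needs an arbitrary initial
  -- count c.
  suffices H : ∀ N s c, Inv N s → ∃ s' q, (s', q) ∈ PFun.fix
      (fun p : σ × ℕ => (body p.1 O).map fun r =>
        if r.1.2 = true then Sum.inl (r.1.1, p.2 + r.2) else Sum.inr (r.1.1, p.2 + r.2))
      (s, c) ∧ q ≤ c + N ∧ Post s' by
    obtain ⟨s', q, h1, h2, h3⟩ := H N s 0 hs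
    exact ⟨s', q, h1, by omega, h3⟩
  intro N
  induction N using Nat.strong_induction_on with
  | _ N ih =>
    intro s c hs
    obtain ⟨s', b, hb, ht, hf⟩ := h N s hs
    cases b with
    | true =>
      obtain ⟨hN, hP⟩ := ht rfl
      exact ⟨s', c + 1, PFun.fix_stop ((Part.mem_map_iff _).2 ⟨_, hb, by simp⟩),
        by omega, hP⟩
    | false =>
      obtain ⟨M, hM, hI⟩ := hf rfl
      obtain ⟨s'', q, h1, h2, h3⟩ := ih M hM s' (c + 1) hI
      refine ⟨s'', q, ?_, by omega, h3⟩
      exact PFun.mem_fix_iff.2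
        (Or.inr ⟨(s', c + 1), (Part.mem_map_iff _).2 ⟨_, hb, by simp⟩, h1⟩)

end Runs

/-! ### The directional preference test -/

variable {n : ℕ} {L : ℝ} {f : E n → ℝ}

theorem IsLSmooth.comp_neg (hf : IsLSmooth L f) : IsLSmooth L fun x => -f x := by
  have hg : ∀ x, gradient (fun x => -f x) x = -gradient f x := by
    intro x
    simp only [gradient]
    rw [fderiv_fun_neg, map_neg]
  refine ⟨hf.1.neg, fun x y => ?_⟩
  rw [hg, hg, ← neg_sub_neg, neg_neg, neg_neg, norm_sub_rev]
  simpa [norm_sub_rev] using hf.2 x y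

/-- By Cauchy-Schwarz and the Lipschitz bound on the gradient, t ↦ f(x + tv) - Lt²/2 - t⟨∇f(x), v⟩
has nonpositive derivative for t ≥ 0. -/
theorem IsLSmooth.le_of_unit (hf : IsLSmooth L f) (x v : E n) (hv : ‖v‖ = 1) {t : ℝ}
    (ht : 0 ≤ t) : f (x + t • v) ≤ f x + t * inner ℝ (gradient f x) v + L * t ^ 2 / 2 := by
  have hd : ∀ s : ℝ, HasDerivAt (fun s : ℝ => f (x + s • v) - L * s ^ 2 / 2
      - s * inner ℝ (gradient f x) v)
      (inner ℝ (gradient f (x + s • v)) v - L * s - inner ℝ (gradient f x) v) s := by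
    intro s
    have h1 : HasDerivAt (fun s : ℝ => x + s • v) v s := by
      simpa using ((hasDerivAt_id s).smul_const v).const_add x
    have h2 := (hf.1 (x + s • v)).hasGradientAt.hasFDerivAt.comp_hasDerivAt s h1
    have h3 : HasDerivAt (fun s : ℝ => L * s ^ 2 / 2) (L * s) s := by
      have := ((hasDerivAt_pow 2 s).const_mul L).div_const 2
      refine this.congr_deriv ?_
      push_cast
      ring
    have h4 : HasDerivAt (fun s : ℝ => s * inner ℝ (gradient f x) v)
        (inner ℝ (gradient f x) v) s := by
      simpa using (hasDerivAt_id s).mul_const (inner ℝ (gradient f x) v)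
    refine ((h2.sub h3).sub h4).congr_deriv ?_
    rw [InnerProductSpace.toDual_apply_apply]
  have hanti : AntitoneOn (fun s : ℝ => f (x + s • v) - L * s ^ 2 / 2
      - s * inner ℝ (gradient f x) v) (Set.Ici 0) := by
    refine antitoneOn_of_deriv_nonpos (convex_Ici 0)
      (fun s _ => (hd s).continuousAt.continuousWithinAt)
      (fun s _ => (hd s).differentiableAt.differentiableWithinAt) ?_
    intro s hs
    rw [interior_Ici] at hs
    rw [(hd s).deriv]
    have h1 : inner ℝ (gradient f (x + s • v) - gradient f x) v ≤ L * s := by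
      refine (real_inner_le_norm _ _).trans ?_
      rw [hv, mul_one]
      refine (hf.2 _ _).trans (le_of_eq ?_)
      rw [add_sub_cancel_left, norm_smul, hv, mul_one, Real.norm_of_nonneg hs.le]
    rw [inner_sub_left] at h1
    linarith
  have := hanti (Set.mem_Ici.2 le_rfl) (Set.mem_Ici.2 ht) ht
  simp only [zero_smul, add_zero] at this
  linarith

theorem IsLSmooth.ge_of_unit (hf : IsLSmooth L f) (x v : E n) (hv : ‖v‖ = 1) {t : ℝ}
    (ht : 0 ≤ t) : f x + t * inner ℝ (gradient f x) v - L * t ^ 2 / 2 ≤ f (x + t • v) := by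
  have h := hf.comp_neg.le_of_unit x v hv ht
  have hg : gradient (fun x => -f x) x = -gradient f x := by
    simp only [gradient]
    rw [fderiv_fun_neg, map_neg]
  rw [hg, inner_neg_left] at h
  linarith

/-- What a report of the directional preference test says about the directional derivative. -/
def Preference.Holds (Δ c : ℝ) : Preference → Prop
  | .geNeg => -Δ ≤ c
  | .le => c ≤ Δ

/-- The step t = 2Δ/L makes the second-order error Lt²/2 equal to tΔ, so the sign of f(x + tv) -
f(x) decides the directional derivative up to Δ. Both answers yield weak inequalities, so ties do no
harm. -/
theorem exists_mem_dp (hL : 0 < L) (hf : IsLSmooth L f) {O : E n → E n → ℤˣ}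
    (hO : IsComparisonOracle f O) (x v : E n) (hv : ‖v‖ = 1) {Δ : ℝ} (hΔ : 0 < Δ) :
    ∃ r : Preference, (r, 1) ∈ dp L x v Δ O ∧ r.Holds Δ (inner ℝ (gradient f x) v) := by
  set t := 2 * Δ / L with ht
  have ht0 : 0 < t := by positivity
  have hLt : L * t ^ 2 / 2 = t * Δ := by rw [ht]; field_simp
  refine ⟨_, mem_bind_pure (k := fun a : ℤˣ =>
    if a = 1 then Preference.geNeg else Preference.le) (mem_query _ _), ?_⟩
  obtain ⟨h1, h2⟩ := hO (x + t • v) x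
  split_ifs with h
  · have h3 := hf.le_of_unit x v hv ht0.le
    have h4 := h1 h
    rw [hLt] at h3
    change -Δ ≤ _
    by_contra hc
    nlinarith [mul_pos ht0 (sub_pos.2 (not_le.1 hc))]
  · have h3 := hf.ge_of_unit x v hv ht0.le
    have h4 := h2 ((Int.units_eq_one_or _).resolve_left h)
    rw [hLt] at h3
    change _ ≤ Δ
    by_contra hc
    nlinarith [mul_pos ht0 (sub_pos.2 (not_le.1 hc))]

theorem exists_mem_signTest (hL : 0 < L) (hf : IsLSmooth L f) {O : E n → E n → ℤˣ}
    (hO : IsComparisonOracle f O) (x v : E n) (hv : ‖v‖ = 1) {Δ : ℝ} (hΔ : 0 < Δ) :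
    ∃ s : ℝ, (s, 1) ∈ signTest L x v Δ O ∧ (s = 1 ∨ s = -1) ∧
      -Δ ≤ s * inner ℝ (gradient f x) v := by
  obtain ⟨r, hr, h⟩ := exists_mem_dp hL hf hO x v hv hΔ
  cases r with
  | geNeg => exact ⟨1, mem_bind (r := 0) hr (mem_pure _), Or.inl rfl, by rw [one_mul]; exact h⟩
  | le =>
    refine ⟨-1, mem_bind (r := 0) hr (mem_pure _), Or.inr rfl, ?_⟩
    change _ ≤ Δ at h
    linarith

/-! ### The searches for one coordinate ratio -/

theorem norm_smul_sub_of_orthonormal {u e : E n} (hu : ‖u‖ = 1) (he : ‖e‖ = 1)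
    (hue : inner ℝ u e = 0) (β : ℝ) : ‖β • u - e‖ = √(1 + β ^ 2) := by
  rw [eq_comm, Real.sqrt_eq_iff_mul_self_eq (by positivity) (norm_nonneg _), ← sq,
    norm_sub_sq_real, norm_smul, inner_smul_left, hue, hu, he, Real.norm_eq_abs]
  simp
  ring

/-- The lower end `β` of the search interval for `a` is certified up to the tolerance `μ`. -/
def CertLower (a μ β : ℝ) : Prop := β ≤ a + μ * √(1 + β ^ 2)

/-- The upper end `β` of the search interval for `a` is certified up to the tolerance `μ`. -/
def CertUpper (a μ β : ℝ) : Prop := a ≤ β + μ * √(1 + β ^ 2)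

/-- The data of the search for the coordinate ratio `a = ⟨∇f(x), e⟩ / ⟨∇f(x), u⟩`: every test is
answered, with a report that certifies an end of the search interval. -/
def Answers (L Δ : ℝ) (x u e : E n) (O : E n → E n → ℤˣ) (a μ : ℝ) : Prop :=
  ∀ β : ℝ, ∃ r : Preference, (r, 1) ∈ dp L x (searchDir u e β) Δ O ∧
    (r = .le → CertLower a μ β) ∧ (r = .geNeg → CertUpper a μ β)

/-- The derivative along ŵ(β) is (βb - c)/√(1 + β²), with b and c the derivatives along u and e.
Comparing it with ±Δ and dividing by b compares β with c/b up to (Δ/b)√(1 + β²). -/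
theorem answers_of_inner (hL : 0 < L) (hf : IsLSmooth L f) {O : E n → E n → ℤˣ}
    (hO : IsComparisonOracle f O) {x u e : E n} (hu : ‖u‖ = 1) (he : ‖e‖ = 1)
    (hue : inner ℝ u e = 0) {Δ μ : ℝ} (hΔ : 0 < Δ) (hb : 0 < inner ℝ (gradient f x) u)
    (hμ : Δ / inner ℝ (gradient f x) u ≤ μ) :
    Answers L Δ x u e O (inner ℝ (gradient f x) e / inner ℝ (gradient f x) u) μ := by
  intro β
  have hw := norm_smul_sub_of_orthonormal hu he hue β
  have hw0 : 0 < √(1 + β ^ 2) := by positivity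
  have hunit : ‖searchDir u e β‖ = 1 := by
    rw [searchDir, norm_smul, norm_inv, norm_norm, hw, inv_mul_cancel₀ hw0.ne']
  obtain ⟨r, hr, h⟩ := exists_mem_dp hL hf hO x (searchDir u e β) hunit hΔ
  set b := inner ℝ (gradient f x) u with hbdef
  set c := inner ℝ (gradient f x) e with hcdef
  have hin : inner ℝ (gradient f x) (searchDir u e β) = (β * b - c) / √(1 + β ^ 2) := by
    rw [searchDir, inner_smul_right, inner_sub_right, inner_smul_right, hw, inv_mul_eq_div]
  rw [hin] at h
  have hΔμ : Δ ≤ μ * b := by rwa [div_le_iff₀ hb] at hμ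
  refine ⟨r, hr, ?_, ?_⟩
  · rintro rfl
    have h' : (β * b - c) / √(1 + β ^ 2) ≤ Δ := h
    rw [div_le_iff₀ hw0] at h'
    have : (β - μ * √(1 + β ^ 2)) * b ≤ c := by nlinarith
    have := (le_div_iff₀ hb).2 this
    rw [CertLower]
    linarith
  · rintro rfl
    have h' : -Δ ≤ (β * b - c) / √(1 + β ^ 2) := h
    rw [le_div_iff₀ hw0] at h'
    have : c ≤ (β + μ * √(1 + β ^ 2)) * b := by nlinarith
    exact (div_le_iff₀ hb).2 this

theorem sqrt_one_add_sq_le {β : ℝ} (hβ : 0 ≤ β) : √(1 + β ^ 2) ≤ 1 + β :=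
  Real.sqrt_le_iff.2 ⟨by positivity, by nlinarith⟩

/-- While the test reports `le`, ℓ/√n lies below a up to the tolerance, so ℓ cannot grow far beyond
√n|a|. -/
theorem exists_mem_boundSearch {O : E n → E n → ℤˣ} {x u e : E n} {Δ a μ : ℝ}
    (hn : 2 ≤ n) (hA : Answers L Δ x u e O a μ) (hμ0 : 0 ≤ μ) (hμ : μ * √(n : ℝ) ≤ 1 / 20) :
    ∃ ℓ q, (ℓ, q) ∈ boundSearch L Δ x u e O ∧ 1 ≤ ℓ ∧ ℓ ≤ 1 + 3 * √(n : ℝ) * |a| ∧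
      (q : ℝ) ≤ 2 + 3 * √(n : ℝ) * |a| ∧ CertUpper a μ (ℓ / √(n : ℝ)) := by
  set r := √(n : ℝ) with hr
  have hr1 : 1 ≤ r := Real.one_le_sqrt.2 (by exact_mod_cast (by omega : 1 ≤ n))
  set B := 1 + 3 * r * |a| with hB
  have ha0 : 0 ≤ r * |a| := by positivity
  obtain ⟨ℓ, q, h1, h2, h3⟩ := exists_mem_repeatUntil (O := O)
    (body := fun ℓ : ℝ => (do
      match ← dp L x (searchDir u e (ℓ / r)) Δ with
      | Preference.le => pure (2 * ℓ, false)
      | Preference.geNeg => pure (ℓ, true) : QueryM (E n) (ℝ × Bool)))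
    -- Doubling ℓ ≥ 1 adds at least 1, so B - ℓ + 1 bounds the remaining iterations. This linear
    -- count is affordable because the √n|a| add up to O(n) over all coordinates.
    (Inv := fun N ℓ => 1 ≤ ℓ ∧ ℓ ≤ B ∧ B - ℓ + 1 ≤ N)
    (Post := fun ℓ => 1 ≤ ℓ ∧ ℓ ≤ B ∧ CertUpper a μ (ℓ / r)) (N := ⌈B⌉₊) (s := 1)
    (by
      rintro N ℓ ⟨hℓ1, hℓB, hN⟩
      have hN1 : 1 ≤ N := by
        have : (1 : ℝ) ≤ N := by linarith
        exact_mod_cast this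
      obtain ⟨p, hp, hlo, hhi⟩ := hA (ℓ / r)
      cases p with
      | geNeg =>
        exact ⟨ℓ, true, mem_bind (r := 0) hp (mem_pure _),
          fun _ => ⟨hN1, hℓ1, hℓB, hhi rfl⟩, by simp⟩
      | le =>
        refine ⟨2 * ℓ, false, mem_bind (r := 0) hp (mem_pure _), by simp,
          fun _ => ⟨N - 1, by omega, by linarith, ?_, ?_⟩⟩
        · have h := hlo rfl
          rw [CertLower] at h
          have hβ : 0 ≤ ℓ / r := by positivity
          have hs := mul_le_mul_of_nonneg_left (sqrt_one_add_sq_le hβ) hμ0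
          have h4 : ℓ / r * r ≤ (a + μ * (1 + ℓ / r)) * r :=
            mul_le_mul_of_nonneg_right (h.trans (by linarith)) (by linarith)
          have h5 : ℓ / r * r = ℓ := by field_simp
          have h6 : a * r ≤ r * |a| := by
            rw [mul_comm]
            exact mul_le_mul_of_nonneg_left (le_abs_self a) (by linarith)
          have h7 : (a + μ * (1 + ℓ / r)) * r = a * r + μ * r + μ * (ℓ / r * r) := by ring
          rw [h7, h5] at h4
          have h8 : μ ≤ 1 / 20 := le_trans (by nlinarith) hμ
          -- The report gives ℓ ≤ √n|a| + (1 + ℓ)/20, hence 2ℓ ≤ (40√n|a| + 2)/19 ≤ B.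
          nlinarith [mul_nonneg (sub_nonneg.2 h8) (by linarith : (0 : ℝ) ≤ ℓ)]
        · rw [Nat.cast_sub hN1]
          push_cast
          linarith)
    ⟨le_rfl, by linarith, by linarith [Nat.le_ceil B]⟩
  refine ⟨ℓ, q, h1, h3.1, h3.2.1, ?_, h3.2.2⟩
  have h4 := (Nat.ceil_lt_add_one (by linarith : 0 ≤ B)).le
  have h5 : (q : ℝ) ≤ ⌈B⌉₊ := by exact_mod_cast h2
  linarith

/-- Both ends stay certified, so a lies in the final interval up to the tolerance. The returned
midpoint has just become one of the ends, so it misses a by at most the final width plus the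
tolerance. -/
theorem exists_mem_binarySearch {O : E n → E n → ℤˣ} {x u e : E n} {Δ a μ ε ℓ : ℝ}
    (hn : 2 ≤ n) (hA : Answers L Δ x u e O a μ) (hμ0 : 0 ≤ μ) (hε : 0 < ε) (hε1 : ε < 1)
    (hℓ : 1 ≤ ℓ) (hlo : CertLower a μ (-ℓ / √(n : ℝ))) (hhi : CertUpper a μ (ℓ / √(n : ℝ))) :
    ∃ α q, (α, q) ∈ binarySearch L ε Δ x u e ℓ O ∧ (q : ℝ) ≤ 4 + 2 * ℓ + 2 * Real.log (1 / ε) ∧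
      |α - a| ≤ ε / (4 * √(n : ℝ)) + μ * √(1 + ℓ ^ 2 / n) := by
  set r := √(n : ℝ) with hr
  have hn0 : (0 : ℝ) < n := by exact_mod_cast (by omega : 0 < n)
  have hr0 : 0 < r := Real.sqrt_pos.2 hn0
  have hrn : r ^ 2 = n := Real.sq_sqrt hn0.le
  set δ := ε / (4 * r) with hδ
  have hδ0 : 0 < δ := by positivity
  have hx : 1 ≤ 8 * ℓ / ε := by
    rw [le_div_iff₀ hε]
    linarith
  -- The initial width 2ℓ/√n is (8ℓ/ε)δ, so 2^N ≤ 8ℓ/ε < 2^(N+1) makes N + 1 halvings enough.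
  obtain ⟨N, hN1, hN2⟩ := exists_nat_pow_near hx (by norm_num : (1 : ℝ) < 2)
  obtain ⟨s, q, h1, h2, h3⟩ := exists_mem_repeatUntil (O := O)
    (body := fun s : ℝ × ℝ × ℝ => (do
      let m := (s.1 + s.2.1) / 2
      let s' ← (do
        match ← dp L x (searchDir u e m) Δ with
        | Preference.le => pure (m, s.2.1, m)
        | Preference.geNeg => pure (s.1, m, m))
      pure (s', decide (s'.2.1 - s'.1 < δ)) : QueryM (E n) ((ℝ × ℝ × ℝ) × Bool)))
    -- The body runs before its flag is read, hence 1 ≤ N. Nothing is required of the third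
    -- component: every iteration overwrites it, and the initial 0 is a dummy.
    (Inv := fun N s => 1 ≤ N ∧ s.2.1 - s.1 < 2 ^ N * δ ∧ s.1 ≤ s.2.1 ∧ -ℓ / r ≤ s.1 ∧
      s.2.1 ≤ ℓ / r ∧ CertLower a μ s.1 ∧ CertUpper a μ s.2.1)
    (Post := fun s => s.2.1 - s.1 < δ ∧ s.1 ≤ s.2.1 ∧ -ℓ / r ≤ s.1 ∧
      s.2.1 ≤ ℓ / r ∧ CertLower a μ s.1 ∧ CertUpper a μ s.2.1 ∧
      (s.2.2 = s.1 ∨ s.2.2 = s.2.1)) (N := N + 1) (s := (-ℓ / r, ℓ / r, 0))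
    (by
      rintro N ⟨p, q, t⟩ ⟨hN, hw, hpq, hp, hq, hlo, hhi⟩
      dsimp only at hw hpq hp hq hlo hhi ⊢
      have hM : (2 : ℝ) ^ N = 2 * 2 ^ (N - 1) := by
        conv_lhs => rw [← Nat.sub_add_cancel hN, pow_succ]
        ring
      rw [hM] at hw
      have hcont : ∀ w : ℝ, w < 2 ^ (N - 1) * δ → ¬ w < δ → 1 ≤ N - 1 := by
        intro w h1 h2
        by_contra h3
        have : N - 1 = 0 := by omega
        rw [this] at h1
        simp at h1
        exact h2 h1
      obtain ⟨r, hr, hl, hh⟩ := hA ((p + q) / 2)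
      cases r with
      | le =>
        refine ⟨((p + q) / 2, q, (p + q) / 2), _, mem_bind (r := 0)
          (mem_bind (r := 0) hr (mem_pure _)) (mem_pure _), fun h => ?_, fun h => ?_⟩
        · rw [decide_eq_true_iff] at h
          exact ⟨hN, h, by linarith, by linarith, hq, hl rfl, hhi, Or.inl rfl⟩
        · rw [decide_eq_false_iff_not] at h
          have hw' : q - (p + q) / 2 < 2 ^ (N - 1) * δ := by linarith
          exact ⟨N - 1, by omega, hcont _ hw' h, hw', by linarith, by linarith, hq, hl rfl, hhi⟩
      | geNeg =>
        refine ⟨(p, (p + q) / 2, (p + q) / 2), _, mem_bind (r := 0)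
          (mem_bind (r := 0) hr (mem_pure _)) (mem_pure _), fun h => ?_, fun h => ?_⟩
        · rw [decide_eq_true_iff] at h
          exact ⟨hN, h, by linarith, hp, by linarith, hlo, hh rfl, Or.inr rfl⟩
        · rw [decide_eq_false_iff_not] at h
          have hw' : (p + q) / 2 - p < 2 ^ (N - 1) * δ := by linarith
          exact ⟨N - 1, by omega, hcont _ hw' h, hw', by linarith, hp, by linarith, hlo, hh rfl⟩)
    (by
      refine ⟨by omega, ?_, ?_, le_rfl, le_rfl, hlo, hhi⟩
      · rw [div_lt_iff₀ hε] at hN2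
        have : ℓ / r - -ℓ / r = 8 * ℓ / (4 * r) := by field_simp; ring
        rw [this, hδ, ← mul_div_assoc, div_lt_div_iff_of_pos_right (by positivity)]
        exact hN2
      · rw [neg_div]
        have : 0 ≤ ℓ / r := by positivity
        linarith)
  obtain ⟨hw, hpq, hp, hq, hlo', hhi', hs⟩ := h3
  refine ⟨s.2.2, q, mem_bind (r := 0) h1 (mem_pure _), ?_, ?_⟩
  · have hq' : (q : ℝ) ≤ N + 1 := by exact_mod_cast h2
    have hlogN : (N : ℝ) * Real.log 2 ≤ Real.log (8 * ℓ / ε) := by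
      rw [← Real.log_pow]
      exact Real.log_le_log (by positivity) hN1
    have hlog : Real.log (8 * ℓ / ε) = 3 * Real.log 2 + Real.log ℓ + Real.log (1 / ε) := by
      rw [show (8 : ℝ) * ℓ / ε = 2 ^ 3 * ℓ * (1 / ε) by ring, Real.log_mul, Real.log_mul,
        Real.log_pow]
      · norm_num
      all_goals positivity
    -- The bound log ℓ ≤ ℓ - 1 costs only a term linear in ℓ, and log 2 > 1/2 then gives the factor
    -- 2.
    have hℓ' := Real.log_le_sub_one_of_pos (by linarith : 0 < ℓ)
    have h2' := Real.log_two_gt_d9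
    have hN0 : (0 : ℝ) ≤ N := by positivity
    have hε' : 0 ≤ Real.log (1 / ε) := Real.log_nonneg (by rw [le_div_iff₀ hε]; linarith)
    have h4 : ((N : ℝ) - 3) * Real.log 2 ≤ ℓ - 1 + Real.log (1 / ε) := by linarith
    by_cases h5 : (N : ℝ) ≤ 3
    · linarith
    · nlinarith
  · have hbd : ∀ β, -ℓ / r ≤ β → β ≤ ℓ / r → μ * √(1 + β ^ 2) ≤ μ * √(1 + ℓ ^ 2 / n) := by
      intro β h1 h2
      refine mul_le_mul_of_nonneg_left (Real.sqrt_le_sqrt ?_) hμ0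
      have : β ^ 2 ≤ (ℓ / r) ^ 2 := sq_le_sq' (by rwa [neg_div] at h1) h2
      rw [div_pow, hrn] at this
      linarith
    have h4 := hbd s.1 hp (hpq.trans hq)
    have h5 := hbd s.2.1 (hp.trans hpq) hq
    rw [CertLower] at hlo'
    rw [CertUpper] at hhi'
    rw [abs_le]
    rcases hs with h | h <;> rw [h] <;> constructor <;> linarith

/-- The hypothesis `ha` certifies the lower end -ℓ/√n for every ℓ ≥ 1. The upper end is certified by
the test that stops the doubling. -/
theorem exists_mem_search {O : E n → E n → ℤˣ} {x u e : E n} {Δ a μ ε : ℝ}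
    (hn : 2 ≤ n) (hA : Answers L Δ x u e O a μ) (hμ0 : 0 ≤ μ) (hμ : μ * √(n : ℝ) ≤ 1 / 20)
    (hε : 0 < ε) (hε1 : ε < 1) (ha : -1 / √(n : ℝ) ≤ a) :
    ∃ α q, (α, q) ∈ (do
        let ℓ ← boundSearch L Δ x u e
        binarySearch L ε Δ x u e ℓ : QueryM (E n) ℝ) O ∧
      (q : ℝ) ≤ 8 + 9 * √(n : ℝ) * |a| + 2 * Real.log (1 / ε) ∧
      |α - a| ≤ ε / (4 * √(n : ℝ)) + μ * √(1 + (1 + 3 * √(n : ℝ) * |a|) ^ 2 / n) := by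
  obtain ⟨ℓ, q, h1, h2, h3, h4, h5⟩ := exists_mem_boundSearch hn hA hμ0 hμ
  have hr : 0 < √(n : ℝ) := Real.sqrt_pos.2 (by exact_mod_cast (by omega : 0 < n))
  have hlo : CertLower a μ (-ℓ / √(n : ℝ)) := by
    have h6 : -ℓ / √(n : ℝ) ≤ -1 / √(n : ℝ) :=
      div_le_div_of_nonneg_right (by linarith) hr.le
    have : 0 ≤ μ * √(1 + (-ℓ / √(n : ℝ)) ^ 2) := by positivity
    rw [CertLower]
    linarith
  obtain ⟨α, q', h6, h7, h8⟩ := exists_mem_binarySearch hn hA hμ0 hε hε1 h2 hlo h5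
  refine ⟨α, q + q', mem_bind h1 h6, by push_cast; linarith, h8.trans ?_⟩
  gcongr

/-! ### Signed sums and the error of the assembled vector -/

/-- A lower bound for `∑ i, sᵢ aᵢ`, where `sᵢ = ±1` may be the wrong sign only if `|aᵢ| ≤ 1 / n`. -/
noncomputable def signedSum {n : ℕ} (a : Fin n → ℝ) : ℝ :=
  ∑ i, if |a i| ≤ 1 / n then -|a i| else |a i|

theorem norm_sum_smul_orthonormalBasis (F : OrthonormalBasis (Fin n) ℝ (E n)) (c : Fin n → ℝ) :
    ‖∑ i, c i • F i‖ = √(∑ i, c i ^ 2) := by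
  have := F.sum_repr_symm (WithLp.toLp 2 c)
  simp only at this
  rw [this, LinearIsometryEquiv.norm_map, EuclideanSpace.norm_eq]
  simp

/-- If A is the combination with coefficients α_i, then bA is within ε/2 of g. Normalising moves bA
by |‖bA‖ - 1|, which is again at most ε/2. -/
theorem norm_sub_normalized_le (F : OrthonormalBasis (Fin n) ℝ (E n)) {g : E n} (hg : ‖g‖ = 1)
    {t α : Fin n → ℝ} (ht : ∀ i, t i = 1 ∨ t i = -1) (hα : 0 < ∑ i, α i ^ 2) {b ε : ℝ}
    (hb : 0 < b) (hε : 0 ≤ ε)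
    (h : ∑ i, (b * α i - t i * inner ℝ g (F i)) ^ 2 ≤ ε ^ 2 / 4) :
    ‖(1 / √(∑ i, α i ^ 2)) • ∑ i, α i • (t i • F i)‖ = 1 ∧
      ‖g - (1 / √(∑ i, α i ^ 2)) • ∑ i, α i • (t i • F i)‖ ≤ ε := by
  have ht2 : ∀ i, t i ^ 2 = 1 := fun i => by rcases ht i with h | h <;> rw [h] <;> norm_num
  set N := √(∑ i, α i ^ 2) with hN
  have hN0 : 0 < N := Real.sqrt_pos.2 hα
  set A := ∑ i, α i • (t i • F i) with hA
  have hAn : ‖A‖ = N := by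
    rw [hA, hN]
    simp_rw [smul_smul]
    rw [norm_sum_smul_orthonormalBasis]
    simp_rw [mul_pow, ht2, mul_one]
  have hunit : ‖(1 / N) • A‖ = 1 := by
    rw [norm_smul, hAn, Real.norm_of_nonneg (by positivity)]
    field_simp
  refine ⟨hunit, ?_⟩
  have hd : ‖b • A - g‖ ≤ ε / 2 := by
    have hgs : g = ∑ i, inner ℝ g (F i) • F i := by
      conv_lhs => rw [← F.sum_repr' g]
      simp_rw [real_inner_comm]
    have : b • A - g = ∑ i, (t i * (b * α i - t i * inner ℝ g (F i))) • F i := by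
      conv_lhs => rw [hgs]
      rw [hA, Finset.smul_sum, ← Finset.sum_sub_distrib]
      refine Finset.sum_congr rfl fun i _ => ?_
      rw [smul_smul, smul_smul, ← sub_smul]
      congr 1
      linear_combination (inner ℝ g (F i)) * ht2 i
    rw [this, norm_sum_smul_orthonormalBasis, Real.sqrt_le_left (by linarith)]
    simp_rw [mul_pow, ht2, one_mul]
    linarith
  have h2 : ‖b • A - (1 / N) • A‖ = |‖b • A‖ - ‖g‖| := by
    rw [← sub_smul, norm_smul, norm_smul, hAn, hg, Real.norm_eq_abs, Real.norm_of_nonneg hb.le,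
      ← abs_of_pos hN0, ← abs_mul, abs_of_pos hN0]
    congr 1
    field_simp
  calc ‖g - (1 / N) • A‖ ≤ ‖g - b • A‖ + ‖b • A - (1 / N) • A‖ := norm_sub_le_norm_sub_add_norm_sub ..
    _ ≤ ε / 2 + ε / 2 := by
        rw [h2]
        exact add_le_add (by rwa [norm_sub_rev]) ((abs_norm_sub_norm_le _ _).trans hd)
    _ = ε := by ring

/-- The part of the tolerance that grows with |a_i| is harmless because b ≥ 1/24 bounds the sum of
the a_i² by 576. -/
theorem sum_sq_error_le (hn : 2 ≤ n) {α a : Fin n → ℝ} {b ε μ : ℝ} (hb : 1 / 24 ≤ b)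
    (hb1 : b ≤ 1) (hε : 0 < ε) (hμ : μ * b = ε / (400 * √(n : ℝ)))
    (ha : ∑ i, (b * a i) ^ 2 ≤ 1)
    (h : ∀ i, |α i - a i| ≤
      ε / (4 * √(n : ℝ)) + μ * √(1 + (1 + 3 * √(n : ℝ) * |a i|) ^ 2 / n)) :
    ∑ i, (b * α i - b * a i) ^ 2 ≤ ε ^ 2 / 4 := by
  set r := √(n : ℝ) with hr
  have hn2 : (2 : ℝ) ≤ n := by exact_mod_cast hn
  have hr0 : 0 < r := Real.sqrt_pos.2 (by linarith)
  have hrn : r ^ 2 = n := Real.sq_sqrt (by linarith)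
  have hb0 : 0 < b := by linarith
  have key : ∀ i, (b * α i - b * a i) ^ 2 ≤
      ε ^ 2 / n * (1 / 8 + 1 / 40000) + 9 * ε ^ 2 / (40000 * n) * a i ^ 2 := by
    intro i
    set w := √(1 + (1 + 3 * r * |a i|) ^ 2 / n) with hw
    have hw2 : w ^ 2 ≤ 2 + 18 * a i ^ 2 := by
      rw [hw, Real.sq_sqrt (by positivity)]
      have h1 : (1 + 3 * r * |a i|) ^ 2 ≤ 2 + 18 * (r ^ 2 * |a i| ^ 2) := by
        nlinarith [sq_nonneg (1 - 3 * r * |a i|)]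
      rw [hrn, sq_abs] at h1
      have h2 : (1 + 3 * r * |a i|) ^ 2 / n ≤ (2 + 18 * (n * a i ^ 2)) / n := by gcongr
      have h3 : (2 + 18 * (n * a i ^ 2)) / n = 2 / n + 18 * a i ^ 2 := by field_simp
      have h4 : (2 : ℝ) / n ≤ 1 := by rw [div_le_one (by linarith)]; exact hn2
      linarith
    have h1 : |b * α i - b * a i| ≤ ε / (4 * r) + ε / (400 * r) * w := by
      rw [← mul_sub, abs_mul, abs_of_pos hb0]
      calc b * |α i - a i| ≤ b * (ε / (4 * r) + μ * w) :=
            mul_le_mul_of_nonneg_left (h i) hb0.le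
        _ = b * (ε / (4 * r)) + ε / (400 * r) * w := by rw [← hμ]; ring
        _ ≤ _ := by
            have : 0 ≤ ε / (4 * r) := by positivity
            nlinarith
    have h2 : (b * α i - b * a i) ^ 2 ≤ (ε / (4 * r) + ε / (400 * r) * w) ^ 2 := by
      rw [← sq_abs]
      exact pow_le_pow_left₀ (abs_nonneg _) h1 2
    have h3 : (ε / (4 * r) + ε / (400 * r) * w) ^ 2 = ε ^ 2 / n * (1 / 4 + w / 400) ^ 2 := by
      rw [← hrn]
      field_simp
    -- (p + q)² ≤ 2p² + 2q² separates the width of the final interval from the tolerance of the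
    -- tests.
    have h4 : (1 / 4 + w / 400) ^ 2 ≤ 1 / 8 + (2 + 18 * a i ^ 2) / 80000 := by
      nlinarith [sq_nonneg (1 / 4 - w / 400)]
    calc _ ≤ ε ^ 2 / n * (1 / 8 + (2 + 18 * a i ^ 2) / 80000) := by
          rw [h3] at h2
          exact h2.trans (mul_le_mul_of_nonneg_left h4 (by positivity))
      _ = _ := by field_simp; ring
  have ha' : ∑ i, a i ^ 2 ≤ 576 := by
    have h1 : b ^ 2 * ∑ i, a i ^ 2 ≤ 1 := by
      rw [Finset.mul_sum]
      simpa only [mul_pow] using ha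
    have h2 : 1 / 576 ≤ b ^ 2 := by nlinarith
    have h3 : 0 ≤ ∑ i, a i ^ 2 := Finset.sum_nonneg fun i _ => sq_nonneg _
    nlinarith
  calc _ ≤ ∑ i : Fin n, (ε ^ 2 / n * (1 / 8 + 1 / 40000) + 9 * ε ^ 2 / (40000 * n) * a i ^ 2) :=
        Finset.sum_le_sum fun i _ => key i
    _ = ε ^ 2 * (1 / 8 + 1 / 40000) + 9 * ε ^ 2 / (40000 * n) * ∑ i, a i ^ 2 := by
        rw [Finset.sum_add_distrib, ← Finset.mul_sum (f := fun i => a i ^ 2), Finset.sum_const,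
          Finset.card_univ, Fintype.card_fin, nsmul_eq_mul]
        field_simp
    _ ≤ ε ^ 2 * (1 / 8 + 1 / 40000) + 9 * ε ^ 2 / (40000 * 2) * 576 := by gcongr
    -- The constants are 0.125025 + 0.0648 < 0.25.
    _ ≤ ε ^ 2 / 4 := by nlinarith [sq_nonneg ε]

/-! ### Correctness and query count on a good frame -/

theorem orthonormal_orthColumn (U : OrthGroup n) : Orthonormal ℝ (orthColumn U) := by
  rw [orthonormal_iff_ite]
  intro i j
  have h := congr_fun₂ ((Matrix.mem_orthogonalGroup_iff' (Fin n) ℝ).1 U.2) i j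
  rw [Matrix.mul_apply, Matrix.one_apply] at h
  rw [← h, orthColumn, orthColumn, PiLp.inner_apply]
  refine Finset.sum_congr rfl fun k _ => ?_
  simp [mul_comm]

/-- The orthonormal basis formed by the columns of an orthogonal matrix. -/
noncomputable def orthBasis (U : OrthGroup n) : OrthonormalBasis (Fin n) ℝ (E n) :=
  OrthonormalBasis.mk (orthonormal_orthColumn U) (by
    rw [(orthonormal_orthColumn U).linearIndependent.span_eq_top_of_card_eq_finrank' (by simp)])

theorem orthBasis_apply (U : OrthGroup n) (i : Fin n) : orthBasis U i = orthColumn U i := by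
  simp [orthBasis]

theorem exists_mem_constantEstimation (hn : 2 ≤ n) (hL : 0 < L) (hf : IsLSmooth L f)
    {O : E n → E n → ℤˣ} (hO : IsComparisonOracle f O) {x : E n} {γ : ℝ} (hγ : 0 < γ)
    (hx : γ ≤ ‖gradient f x‖) (U : OrthGroup n) :
    ∃ (s : Fin n → ℝ) (u : E n), (u, n) ∈ constantEstimation L γ x U O ∧ ‖u‖ = 1 ∧
      (∀ i, s i = 1 ∨ s i = -1) ∧
      (∀ i, -(1 / n : ℝ) ≤ s i * inner ℝ (‖gradient f x‖⁻¹ • gradient f x) (orthColumn U i)) ∧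
      inner ℝ (‖gradient f x‖⁻¹ • gradient f x) u =
        1 / √(n : ℝ) * ∑ i, s i * inner ℝ (‖gradient f x‖⁻¹ • gradient f x) (orthColumn U i) := by
  have hn0 : (0 : ℝ) < n := by exact_mod_cast (by omega : 0 < n)
  have hG : 0 < ‖gradient f x‖ := hγ.trans_le hx
  choose s hs hs1 hs2 using fun i : Fin n =>
    exists_mem_signTest hL hf hO x (orthColumn U i) ((orthonormal_orthColumn U).1 i)
      (by positivity : 0 < γ / n)
  have hs' : ∀ i, s i ^ 2 = 1 := fun i => by rcases hs1 i with h | h <;> rw [h] <;> norm_num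
  refine ⟨s, (1 / √(n : ℝ)) • ∑ i, s i • orthColumn U i, ?_, ?_, hs1, fun i => ?_, ?_⟩
  · have := mem_bind_pure (k := fun s : Fin n → ℝ =>
      (1 / √(n : ℝ)) • ∑ i, s i • orthColumn U i) (mem_forEach hs)
    simp only [Finset.sum_const, Finset.card_univ, Fintype.card_fin, smul_eq_mul, mul_one] at this
    exact this
  · have : ∑ i, s i • orthColumn U i = ∑ i, s i • orthBasis U i := by simp_rw [orthBasis_apply]
    rw [this, norm_smul, norm_sum_smul_orthonormalBasis, Real.norm_of_nonneg (by positivity)]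
    simp_rw [hs']
    simp only [Finset.sum_const, Finset.card_univ, Fintype.card_fin, mul_one, nsmul_eq_mul]
    exact one_div_mul_cancel (Real.sqrt_ne_zero'.2 hn0)
  · rw [inner_smul_left]
    simp only [conj_trivial]
    have h1 := hs2 i
    have h2 : γ / n ≤ ‖gradient f x‖ * (1 / n) := by
      rw [mul_one_div]
      gcongr
    have h3 : s i * (‖gradient f x‖⁻¹ * inner ℝ (gradient f x) (orthColumn U i)) =
        (s i * inner ℝ (gradient f x) (orthColumn U i)) / ‖gradient f x‖ := by
      field_simp
    rw [h3, le_div_iff₀ hG]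
    linarith
  · rw [inner_smul_right, inner_sum]
    simp_rw [inner_smul_right]

/-- A sign that passed its test can be wrong only when |a_i| ≤ 1/n, and then the term is still at
least -|a_i|. -/
theorem signedSum_le {a s : Fin n → ℝ} (hs : ∀ i, s i = 1 ∨ s i = -1)
    (h : ∀ i, -(1 / n : ℝ) ≤ s i * a i) : signedSum a ≤ ∑ i, s i * a i := by
  refine Finset.sum_le_sum fun i _ => ?_
  have h1 : |s i * a i| = |a i| := by
    rcases hs i with h | h <;> simp [h]
  split_ifs with h2
  · rw [← h1]
    exact neg_abs_le _
  · rw [← h1] at h2 ⊢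
    rcases abs_cases (s i * a i) with h3 | h3
    · exact h3.1.le
    · exact absurd (by linarith [h i]) h2

theorem exists_mem_refinement (hn : 2 ≤ n) (hL : 0 < L) (hf : IsLSmooth L f)
    {O : E n → E n → ℤˣ} (hO : IsComparisonOracle f O) {x : E n} {γ ε : ℝ} (hγ : 0 < γ)
    (hx : γ ≤ ‖gradient f x‖) (hε : 0 < ε) (hε1 : ε < 3 / 4)
    {g : E n} (hg : g = ‖gradient f x‖⁻¹ • gradient f x) {u e : E n} (hu : ‖u‖ = 1)
    (he : ‖e‖ = 1) (hue : inner ℝ u e = 0) (hb : 1 / 24 ≤ inner ℝ g u)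
    (hbe : -(inner ℝ g u) ≤ √(n : ℝ) * inner ℝ g e) :
    ∃ α q, (α, q) ∈ (do
        let ℓ ← boundSearch L (ε * γ / (400 * √(n : ℝ))) x u e
        binarySearch L ε (ε * γ / (400 * √(n : ℝ))) x u e ℓ : QueryM (E n) ℝ) O ∧
      (q : ℝ) ≤ 8 + 9 * √(n : ℝ) * |inner ℝ g e / inner ℝ g u| + 2 * Real.log (1 / ε) ∧
      |α - inner ℝ g e / inner ℝ g u| ≤ ε / (4 * √(n : ℝ)) +
        ε / (400 * √(n : ℝ)) / inner ℝ g u *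
          √(1 + (1 + 3 * √(n : ℝ) * |inner ℝ g e / inner ℝ g u|) ^ 2 / n) := by
  have hr : 0 < √(n : ℝ) := Real.sqrt_pos.2 (by exact_mod_cast (by omega : 0 < n))
  have hG : 0 < ‖gradient f x‖ := hγ.trans_le hx
  have hb0 : 0 < inner ℝ g u := by linarith
  have hin : ∀ v, inner ℝ (gradient f x) v = ‖gradient f x‖ * inner ℝ g v := by
    intro v
    rw [hg, inner_smul_left]
    simp only [conj_trivial]
    field_simp
  have hA := answers_of_inner (Δ := ε * γ / (400 * √(n : ℝ)))
    (μ := ε / (400 * √(n : ℝ)) / inner ℝ g u) hL hf hO hu he hue (by positivity)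
    (by rw [hin]; positivity) (by
      rw [hin, div_le_div_iff₀ (by positivity) hb0]
      have : ε * γ / (400 * √(n : ℝ)) = ε / (400 * √(n : ℝ)) * γ := by ring
      rw [this, mul_assoc]
      gcongr)
  have hratio : inner ℝ (gradient f x) e / inner ℝ (gradient f x) u
      = inner ℝ g e / inner ℝ g u := by
    rw [hin, hin, mul_div_mul_left _ _ hG.ne']
  rw [hratio] at hA
  refine exists_mem_search hn hA (by positivity) ?_ hε (by linarith) ?_
  -- Here μ√n = ε/(400b) ≤ 24ε/400, which is at most 1/20 since ε < 3/4.
  · rw [div_div, div_mul_eq_mul_div, div_le_div_iff₀ (by positivity) (by norm_num)]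
    have h1 := mul_le_mul_of_nonneg_left hb hr.le
    have h2 := mul_le_mul_of_nonneg_left hε1.le hr.le
    linarith
  · rw [div_le_div_iff₀ hr hb0]
    linarith

/-- By AM-GM, 9√n|a_i| ≤ 5 + 5n a_i², and the a_i² sum to at most 576. So the queries number at most
n(2895 + 2 log(1/ε)), and log(1/ε) ≥ log √2 > 1/3 absorbs the constant term. -/
theorem nat_cast_le_queries (hn : 2 ≤ n) {a : Fin n → ℝ} {b ε : ℝ} (hb : 1 / 24 ≤ b)
    (ha : ∑ i, (b * a i) ^ 2 ≤ 1) (hε : 0 < ε) (hε1 : ε < 1 / √2) {q : Fin n → ℕ}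
    (hq : ∀ i, (q i : ℝ) ≤ 8 + 9 * √(n : ℝ) * |a i| + 2 * Real.log (1 / ε))
    {t : Fin n → ℕ} (ht : ∀ i, t i ≤ 1) :
    ((n + (∑ i, t i + ∑ i, q i) : ℕ) : ℝ) ≤ 9000 * (n * Real.log (1 / ε)) := by
  have hn0 : (0 : ℝ) < n := by exact_mod_cast (by omega : 0 < n)
  have hrn : √(n : ℝ) ^ 2 = n := Real.sq_sqrt hn0.le
  have hlog : 1 / 3 ≤ Real.log (1 / ε) := by
    have h2 : (0 : ℝ) < √2 := by positivity
    have h1 : √2 ≤ 1 / ε := by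
      rw [le_div_iff₀ hε]
      rw [lt_div_iff₀ h2] at hε1
      linarith
    have h3 := Real.log_le_log h2 h1
    rw [Real.log_sqrt (by norm_num)] at h3
    linarith [Real.log_two_gt_d9]
  have h1 : ((∑ i, t i : ℕ) : ℝ) ≤ n := by
    have : ∑ i, t i ≤ ∑ _i : Fin n, 1 := Finset.sum_le_sum fun i _ => ht i
    simpa using (Nat.cast_le (α := ℝ)).2 this
  have ha' : ∑ i, a i ^ 2 ≤ 576 := by
    have h1 : b ^ 2 * ∑ i, a i ^ 2 ≤ 1 := by
      rw [Finset.mul_sum]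
      simpa only [mul_pow] using ha
    have h2 : 1 / 576 ≤ b ^ 2 := by nlinarith
    have h3 : 0 ≤ ∑ i, a i ^ 2 := Finset.sum_nonneg fun i _ => sq_nonneg _
    nlinarith
  have h2 : ((∑ i, q i : ℕ) : ℝ) ≤ n * (8 + 5 + 2 * Real.log (1 / ε)) + 5 * (n * 576) := by
    push_cast
    calc ∑ i, (q i : ℝ) ≤ ∑ i : Fin n, ((8 + 5 + 2 * Real.log (1 / ε)) + 5 * (n * a i ^ 2)) := by
          refine Finset.sum_le_sum fun i _ => (hq i).trans ?_
          nlinarith [sq_nonneg (1 - √(n : ℝ) * |a i|), sq_abs (a i)]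
      _ = n * (8 + 5 + 2 * Real.log (1 / ε)) + 5 * (n * ∑ i, a i ^ 2) := by
          rw [Finset.sum_add_distrib, Finset.mul_sum (f := fun i => a i ^ 2), Finset.mul_sum]
          simp
          ring
      _ ≤ _ := by gcongr
  push_cast at h1 h2 ⊢
  nlinarith

/-- The condition on the coordinates `aᵢ = ⟨∇f(x) / ‖∇f(x)‖, U eᵢ⟩` under which the algorithm is
correct. -/
def GoodFrame {n : ℕ} (a : Fin n → ℝ) : Prop :=
  n = 2 ∨ (1 ≤ signedSum a ∧ √(n : ℝ) / 24 ≤ signedSum a)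

set_option maxHeartbeats 1000000 in
-- All randomness is confined to `hU`. From it come b ≥ 1/24 and √n⟨g, e_i⟩ ≥ -b for the signed
-- basis vectors e_i; the rest is deterministic.
theorem exists_mem_classicalEstimation (hn : 2 ≤ n) (hL : 0 < L) (hf : IsLSmooth L f)
    {O : E n → E n → ℤˣ} (hO : IsComparisonOracle f O) {x : E n} {γ ε : ℝ} (hγ : 0 < γ)
    (hx : γ ≤ ‖gradient f x‖) (hε : 0 < ε) (hε1 : ε < 1 / √2)
    {frame : E n → OrthonormalBasis (Fin n) ℝ (E n)}
    (hframe : ∀ u : E n, ‖u‖ = 1 → ∀ i : Fin n, i.val = 0 → frame u i = u) (U : OrthGroup n)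
    (hU : GoodFrame fun i => inner ℝ (‖gradient f x‖⁻¹ • gradient f x) (orthColumn U i)) :
    ∃ (v : E n) (q : ℕ), (v, q) ∈ classicalEstimation frame L γ ε x U O ∧
      (q : ℝ) ≤ 9000 * (n * Real.log (1 / ε)) ∧ ‖v‖ = 1 ∧
      ‖‖gradient f x‖⁻¹ • gradient f x - v‖ ≤ ε := by
  have hn0 : (0 : ℝ) < n := by exact_mod_cast (by omega : 0 < n)
  have hr : 0 < √(n : ℝ) := Real.sqrt_pos.2 hn0
  have hrn : √(n : ℝ) ^ 2 = n := Real.sq_sqrt hn0.le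
  have hG : 0 < ‖gradient f x‖ := hγ.trans_le hx
  have hεlt : ε < 3 / 4 := hε1.trans_le (by
    rw [div_le_div_iff₀ (by positivity) (by norm_num)]
    have : 4 / 3 ≤ √(2 : ℝ) := Real.le_sqrt_of_sq_le (by norm_num)
    linarith)
  obtain ⟨s, u, hu, hun, hs1, hs2, hs3⟩ := exists_mem_constantEstimation hn hL hf hO hγ hx U
  set g := ‖gradient f x‖⁻¹ • gradient f x with hg
  have hg1 : ‖g‖ = 1 := by
    rw [hg, norm_smul, norm_inv, norm_norm, inv_mul_cancel₀ hG.ne']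
  set F := frame u with hF
  have hF0 : ∀ i : Fin n, i.val = 0 → F i = u := hframe u hun
  set i₀ : Fin n := ⟨0, by omega⟩ with hi₀
  set b := inner ℝ g u with hb
  have hin : ∀ v, inner ℝ (gradient f x) v = ‖gradient f x‖ * inner ℝ g v := by
    intro v
    rw [hg, inner_smul_left]
    simp only [conj_trivial]
    field_simp
  have htest : ∀ i : Fin n, ∃ (t : ℝ) (q : ℕ),
      (t, q) ∈ (if i.val = 0 then pure 1 else signTest L x (F i) (γ / n) : QueryM (E n) ℝ) O ∧
      (t = 1 ∨ t = -1) ∧ q ≤ 1 ∧ (i.val = 0 → t = 1) ∧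
      (i.val ≠ 0 → -(1 / n : ℝ) ≤ t * inner ℝ g (F i)) := by
    intro i
    by_cases hi : i.val = 0
    · refine ⟨1, 0, ?_, Or.inl rfl, by norm_num, fun _ => rfl, fun h => absurd hi h⟩
      rw [if_pos hi]
      exact mem_pure _
    · obtain ⟨t, h1, h2, h3⟩ := exists_mem_signTest hL hf hO x (F i) (F.orthonormal.1 i)
        (by positivity : 0 < γ / n)
      refine ⟨t, 1, by rwa [if_neg hi], h2, le_rfl, fun h => absurd h hi, fun _ => ?_⟩
      rw [hin] at h3
      have h4 : γ / n ≤ ‖gradient f x‖ * (1 / n) := by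
        rw [mul_one_div]
        gcongr
      by_contra h5
      nlinarith [mul_pos hG (sub_pos.2 (not_le.1 h5))]
  choose t qt ht ht1 hqt ht0 htn using htest
  have ht2 : ∀ i, t i ^ 2 = 1 := fun i => by rcases ht1 i with h | h <;> rw [h] <;> norm_num
  have hsumF : ∑ i, (t i * inner ℝ g (F i)) ^ 2 = 1 := by
    simp_rw [mul_pow, ht2, one_mul]
    have := F.sum_sq_inner_left g
    rwa [hg1, one_pow] at this
  have hbF : t i₀ * inner ℝ g (F i₀) = b := by
    rw [ht0 i₀ rfl, one_mul, hF0 i₀ rfl]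
  have hb1 : b ≤ 1 := by
    have := real_inner_le_norm g u
    rwa [hg1, hun, one_mul] at this
  obtain ⟨hb24, hlow⟩ : 1 / 24 ≤ b ∧
      ∀ i : Fin n, i.val ≠ 0 → -b ≤ √(n : ℝ) * (t i * inner ℝ g (F i)) := by
    rcases hU with h2 | ⟨hY1, hY2⟩
    · subst h2
      have hsum : ∑ i, (s i * inner ℝ g (orthColumn U i)) ^ 2 = 1 := by
        have h3 : ∀ i, s i ^ 2 = 1 := fun i => by rcases hs1 i with h | h <;> rw [h] <;> norm_num
        simp_rw [mul_pow, h3, one_mul, ← orthBasis_apply]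
        have := (orthBasis U).sum_sq_inner_left g
        rwa [hg1, one_pow] at this
      rw [Fin.sum_univ_two] at hsum hs3
      have h0 := hs2 0
      have h1 := hs2 1
      push_cast at h0 h1 hs3
      -- On the unit circle with both coordinates at least -1/2, the sum is least at (-1/2, √3/2),
      -- where it equals (√3 - 1)/2 > 9/25.
      have h3 : 9 / 25 ≤ s 0 * inner ℝ g (orthColumn U 0) + s 1 * inner ℝ g (orthColumn U 1) := by
        set c := s 0 * inner ℝ g (orthColumn U 0)
        set d := s 1 * inner ℝ g (orthColumn U 1)
        by_contra h
        push Not at h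
        by_cases hc : 0 ≤ c
        · by_cases hd : 0 ≤ d
          · nlinarith
          · nlinarith
        · nlinarith
      have hs2' : √(2 : ℝ) ^ 2 = 2 := Real.sq_sqrt (by norm_num)
      have hs2l : √(2 : ℝ) ≤ 3 / 2 := Real.sqrt_le_iff.2 ⟨by norm_num, by norm_num⟩
      have hs2g : 7 / 5 ≤ √(2 : ℝ) := Real.le_sqrt_of_sq_le (by norm_num)
      have hb4 : 1 / 24 ≤ b := by
        rw [hs3, one_div_mul_eq_div, le_div_iff₀ (by positivity)]
        linarith
      refine ⟨hb4, fun i hi => ?_⟩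
      have hi1 : i = 1 := by omega
      subst hi1
      have h4 := htn 1 hi
      push_cast at h4 ⊢
      rw [Fin.sum_univ_two] at hsumF
      have h5 : t 0 * inner ℝ g (F 0) = b := hbF
      rw [h5] at hsumF
      set c := t 1 * inner ℝ g (F 1)
      by_cases hc : 0 ≤ c
      · have : 0 ≤ √2 * c := by positivity
        linarith
      -- From -1/2 ≤ c < 0 and b² + c² = 1 follows b ≥ √3/2 > 17/20, which exceeds √2/2 ≥ -√2 c.
      · have h6 : 17 / 20 ≤ b := by nlinarith
        nlinarith
    · have h3 := signedSum_le hs1 hs2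
      have h4 : 1 / √(n : ℝ) * signedSum (fun i => inner ℝ g (orthColumn U i)) ≤ b := by
        rw [hs3]
        gcongr
      refine ⟨le_trans ?_ h4, fun i hi => ?_⟩
      · rw [one_div_mul_eq_div, le_div_iff₀ hr]
        linarith
      · have h5 := htn i hi
        -- The bound 1 on the signed sum serves here: a coordinate that passed its sign test is at
        -- least -1/n, and √n times this is -1/√n ≥ -b.
        have h6 : 1 / √(n : ℝ) ≤ b := le_trans (by
          conv_lhs => rw [← mul_one (1 / √(n : ℝ))]
          gcongr) h4
        have h7 : √(n : ℝ) * -(1 / n : ℝ) = -(1 / √(n : ℝ)) := by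
          rw [← hrn]
          field_simp
          rw [Real.sqrt_sq hr.le]
        have h8 := mul_le_mul_of_nonneg_left h5 hr.le
        rw [h7] at h8
        linarith
  have hb0 : 0 < b := by linarith
  have hsearch : ∀ i : Fin n, ∃ (α : ℝ) (q : ℕ),
      (α, q) ∈ (if i.val = 0 then pure 1 else do
        let ℓ ← boundSearch L (ε * γ / (400 * √(n : ℝ))) x u (t i • F i)
        binarySearch L ε (ε * γ / (400 * √(n : ℝ))) x u (t i • F i) ℓ : QueryM (E n) ℝ) O ∧
      (q : ℝ) ≤ 8 + 9 * √(n : ℝ) * |t i * inner ℝ g (F i) / b| + 2 * Real.log (1 / ε) ∧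
      |α - t i * inner ℝ g (F i) / b| ≤ ε / (4 * √(n : ℝ)) +
        ε / (400 * √(n : ℝ)) / b *
          √(1 + (1 + 3 * √(n : ℝ) * |t i * inner ℝ g (F i) / b|) ^ 2 / n) ∧
      (i.val = 0 → α = 1) := by
    intro i
    by_cases hi : i.val = 0
    -- The first ratio is b/b = 1, so the prescribed value 1 is exact and costs no query.
    · have hi' : i = i₀ := Fin.ext hi
      subst hi'
      refine ⟨1, 0, ?_, ?_, ?_, fun _ => rfl⟩
      · rw [if_pos rfl]
        exact mem_pure _
      · have : 0 ≤ Real.log (1 / ε) := Real.log_nonneg (by rw [le_div_iff₀ hε]; linarith)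
        push_cast
        positivity
      · rw [hbF, div_self hb0.ne', sub_self, abs_zero]
        positivity
    · have hne : i₀ ≠ i := fun h => hi (by rw [← h])
      have hort : inner ℝ u (t i • F i) = 0 := by
        rw [inner_smul_right, ← hF0 i₀ rfl, F.orthonormal.2 hne, mul_zero]
      have hnorm : ‖t i • F i‖ = 1 := by
        rw [norm_smul, F.orthonormal.1 i, mul_one, Real.norm_eq_abs]
        rcases ht1 i with h | h <;> simp [h]
      have hbi := hlow i hi
      rw [← inner_smul_right] at hbi
      obtain ⟨α, q, h1, h2, h3⟩ := exists_mem_refinement hn hL hf hO hγ hx hε hεlt hg hun hnorm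
        hort hb24 hbi
      rw [inner_smul_right] at h2 h3
      refine ⟨α, q, ?_, h2, h3, fun h => absurd h hi⟩
      rw [if_neg hi]
      exact h1
  choose α qα hα hqα herr hα0 using hsearch
  have hasum : ∑ i, (b * (t i * inner ℝ g (F i) / b)) ^ 2 ≤ 1 := by
    simp_rw [mul_div_cancel₀ _ hb0.ne']
    exact hsumF.le
  have hsq := sum_sq_error_le hn hb24 hb1 hε (div_mul_cancel₀ _ hb0.ne') hasum herr
  simp_rw [mul_div_cancel₀ _ hb0.ne'] at hsq
  have hαpos : 0 < ∑ i, α i ^ 2 := by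
    refine Finset.sum_pos' (fun i _ => sq_nonneg _) ⟨i₀, Finset.mem_univ _, ?_⟩
    rw [hα0 i₀ rfl]
    norm_num
  obtain ⟨hv1, hv2⟩ := norm_sub_normalized_le F hg1 ht1 hαpos hb0 hε.le hsq
  refine ⟨_, n + (∑ i, qt i + ∑ i, qα i), ?_, nat_cast_le_queries hn hb24 hasum hε hε1 hqα hqt,
    hv1, hv2⟩
  exact mem_bind hu (mem_bind (mem_forEach ht) (mem_bind (r := 0) (mem_forEach hα) (mem_pure _)))

/-! ### Coordinates in a Haar-distributed frame as a normalised Gaussian vector -/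

open ProbabilityTheory

/-- The coordinates of `g` in the frame given by `U`. -/
noncomputable def frameCoord (U : OrthGroup n) (g : E n) : Fin n → ℝ :=
  fun i => inner ℝ g (orthColumn U i)

instance (n : ℕ) : (haarOrth n).IsMulLeftInvariant := by
  unfold haarOrth
  infer_instance

theorem frameCoord_eq_sum (U : OrthGroup n) (g : E n) (i : Fin n) :
    frameCoord U g i = ∑ k, g k * (U : Matrix (Fin n) (Fin n) ℝ) k i := by
  rw [frameCoord, PiLp.inner_apply]
  refine Finset.sum_congr rfl fun k _ => ?_
  simp [orthColumn, mul_comm]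

theorem measurable_frameCoord : Measurable fun p : OrthGroup n × E n => frameCoord p.1 p.2 := by
  refine measurable_pi_lambda _ fun i => ?_
  simp_rw [frameCoord_eq_sum]
  refine Finset.measurable_sum _ fun k _ => Measurable.mul ?_ ?_
  · exact (by fun_prop : Measurable fun x : E n => x k).comp measurable_snd
  · have : Continuous fun U : OrthGroup n => (U : Matrix (Fin n) (Fin n) ℝ) k i :=
      (continuous_subtype_val : Continuous fun U : OrthGroup n =>
        (U : Matrix (Fin n) (Fin n) ℝ)).matrix_elem k i
    exact this.measurable.comp measurable_fst

/-- Every linear isometry of `ℝⁿ` is given by an orthogonal matrix. -/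
theorem exists_orthColumn_mul (ρ : E n ≃ₗᵢ[ℝ] E n) :
    ∃ R : OrthGroup n, ∀ U i, orthColumn (R * U) i = ρ (orthColumn U i) := by
  set e := EuclideanSpace.basisFun (Fin n) ℝ with he
  refine ⟨⟨e.toBasis.toMatrix (e.map ρ), e.toMatrix_orthonormalBasis_mem_orthogonal (e.map ρ)⟩,
    fun U i => ?_⟩
  have h : orthColumn U i = ∑ k, (U : Matrix (Fin n) (Fin n) ℝ) k i • e k := by
    ext j
    simp [orthColumn, he, Matrix.col, Pi.single_apply]
  rw [h, map_sum]
  ext j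
  simp [orthColumn, Matrix.col, Matrix.mul_apply, Module.Basis.toMatrix_apply, he]

/-- The reflection in the hyperplane orthogonal to h - g carries h to g. Left multiplication of U by
its matrix preserves Haar measure and changes no inner product. -/
theorem lintegral_frameCoord_congr {F : (Fin n → ℝ) → ℝ≥0∞} {g h : E n} (hgh : ‖g‖ = ‖h‖) :
    ∫⁻ U, F (frameCoord U g) ∂haarOrth n = ∫⁻ U, F (frameCoord U h) ∂haarOrth n := by
  set ρ : E n ≃ₗᵢ[ℝ] E n := (ℝ ∙ (h - g))ᗮ.reflection with hρ
  have hρh : ρ h = g := Submodule.reflection_sub hgh.symm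
  obtain ⟨R, hR⟩ := exists_orthColumn_mul ρ
  rw [← lintegral_mul_left_eq_self _ R]
  refine lintegral_congr fun U => ?_
  congr 1
  ext i
  rw [frameCoord, frameCoord, hR, ← hρh, LinearIsometryEquiv.inner_map_map]

/-- The Gaussian measure on `ℝⁿ`, as a product measure. -/
noncomputable abbrev gaussPi (n : ℕ) : Measure (Fin n → ℝ) :=
  Measure.pi fun _ => gaussianReal 0 1

/-- The Euclidean norm on `Fin n → ℝ`. -/
noncomputable def eucl (x : Fin n → ℝ) : ℝ := √(∑ i, x i ^ 2)

theorem eucl_frameCoord (U : OrthGroup n) (g : E n) : eucl (frameCoord U g) = ‖g‖ := by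
  have h := (orthBasis U).sum_sq_inner_left g
  simp_rw [orthBasis_apply] at h
  rw [eucl]
  simp_rw [frameCoord]
  rw [h, Real.sqrt_sq (norm_nonneg _)]

theorem measurable_eucl : Measurable (eucl : (Fin n → ℝ) → ℝ) := by
  unfold eucl
  fun_prop

theorem measurable_normalize : Measurable fun x : Fin n → ℝ => (eucl x)⁻¹ • x :=
  measurable_eucl.inv.smul measurable_id

theorem lintegral_frameCoord_stdGaussian (U : OrthGroup n) {F : (Fin n → ℝ) → ℝ≥0∞}
    (hF : Measurable F) :
    ∫⁻ x, F (frameCoord U x) ∂stdGaussian (E n) = ∫⁻ x, F x ∂gaussPi n := by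
  have h1 : ∀ x : E n, frameCoord U x = WithLp.ofLp ((orthBasis U).repr x) := by
    intro x
    ext i
    rw [frameCoord, (orthBasis U).repr_apply_apply, orthBasis_apply, real_inner_comm]
  simp_rw [h1]
  have hF' : Measurable fun y : E n => F (WithLp.ofLp y) := hF.comp (by fun_prop)
  rw [← lintegral_map hF' (orthBasis U).repr.continuous.measurable, stdGaussian_map,
    ← map_pi_eq_stdGaussian, lintegral_map hF' (by fun_prop)]

theorem ae_ne_zero_stdGaussian (hn : 0 < n) : ∀ᵐ x ∂stdGaussian (E n), x ≠ 0 := by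
  have := nullSingletonClass_gaussianReal (μ := 0) (v := 1) one_ne_zero
  rw [← map_pi_eq_stdGaussian]
  refine (ae_map_iff (by fun_prop) (measurableSet_singleton (0 : E n)).compl).2 ?_
  have h := Measure.pi_hyperplane (fun _ : Fin n => gaussianReal 0 1) (⟨0, hn⟩ : Fin n) 0
  refine measure_mono_null (fun x hx => ?_) h
  have hx' : (WithLp.toLp 2 x : E n) = 0 := by
    by_contra hne
    exact hx hne
  rw [WithLp.toLp_eq_zero] at hx'
  change x _ = 0
  rw [hx', Pi.zero_apply]

/-- The coordinates of a fixed unit vector in a Haar-distributed frame are distributed as a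
normalised Gaussian vector. -/
theorem lintegral_frameCoord (hn : 0 < n) {F : (Fin n → ℝ) → ℝ≥0∞} (hF : Measurable F) {g : E n}
    (hg : ‖g‖ = 1) :
    ∫⁻ U, F (frameCoord U g) ∂haarOrth n = ∫⁻ x, F ((eucl x)⁻¹ • x) ∂gaussPi n := by
  have hm : Measurable fun p : E n × OrthGroup n => F (frameCoord p.2 (‖p.1‖⁻¹ • p.1)) := by
    refine hF.comp (measurable_frameCoord.comp (measurable_snd.prodMk ?_))
    exact (measurable_fst.norm.inv.smul measurable_fst)
  -- The integral is the same for every unit vector, so g may be replaced by the direction of an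
  -- independent Gaussian vector. After exchanging the integrals U is fixed, and an orthonormal
  -- change of basis preserves the Gaussian law.
  calc ∫⁻ U, F (frameCoord U g) ∂haarOrth n
      = ∫⁻ _ : E n, ∫⁻ U, F (frameCoord U g) ∂haarOrth n ∂stdGaussian (E n) := by simp
    _ = ∫⁻ x : E n, ∫⁻ U, F (frameCoord U (‖x‖⁻¹ • x)) ∂haarOrth n ∂stdGaussian (E n) := by
        refine lintegral_congr_ae ?_
        filter_upwards [ae_ne_zero_stdGaussian hn] with x hx
        refine lintegral_frameCoord_congr ?_
        rw [hg, norm_smul, norm_inv, norm_norm, inv_mul_cancel₀ (norm_ne_zero_iff.2 hx)]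
    _ = ∫⁻ U, ∫⁻ x : E n, F (frameCoord U (‖x‖⁻¹ • x)) ∂stdGaussian (E n) ∂haarOrth n :=
        lintegral_lintegral_swap hm.aemeasurable
    _ = ∫⁻ _ : OrthGroup n, ∫⁻ x, F ((eucl x)⁻¹ • x) ∂gaussPi n ∂haarOrth n := by
        refine lintegral_congr fun U => ?_
        refine Eq.trans (lintegral_congr fun x => ?_)
          (lintegral_frameCoord_stdGaussian U (hF.comp measurable_normalize))
        rw [eucl_frameCoord]
        congr 1
        ext i
        simp [frameCoord, inner_smul_left]
    _ = ∫⁻ x, F ((eucl x)⁻¹ • x) ∂gaussPi n := by simp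

/-! ### The law of a pair of coordinates of a random unit vector -/

theorem eucl_sq {n : ℕ} (x : Fin n → ℝ) : eucl x ^ 2 = ∑ i, x i ^ 2 :=
  Real.sq_sqrt (Finset.sum_nonneg fun _ _ => sq_nonneg _)

/-- Tilting by exp(-cz²/2) turns the standard density into a multiple of the one with variance 1/(1
+ c), so the tilted integrals below reduce to total mass and variance. -/
theorem gaussianPDFReal_mul_exp {c : ℝ} (hc : 0 ≤ c) (z : ℝ) :
    gaussianPDFReal 0 1 z * Real.exp (-c * z ^ 2 / 2) =
      (1 / √(1 + c)) * gaussianPDFReal 0 (Real.toNNReal (1 / (1 + c))) z := by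
  have h : 0 < 1 + c := by linarith
  have hv : ((Real.toNNReal (1 / (1 + c)) : NNReal) : ℝ) = 1 / (1 + c) :=
    Real.coe_toNNReal _ (by positivity)
  rw [gaussianPDFReal, gaussianPDFReal, hv, mul_assoc, ← Real.exp_add, NNReal.coe_one,
    mul_one (2 * Real.pi)]
  have h1 : (√(2 * Real.pi * (1 / (1 + c))))⁻¹ = (√(2 * Real.pi))⁻¹ * √(1 + c) := by
    rw [mul_one_div, Real.sqrt_div (by positivity), inv_div, div_eq_inv_mul]
  have h2 : √(1 + c) ≠ 0 := (Real.sqrt_pos.2 h).ne'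
  have h3 : -(z - 0) ^ 2 / (2 * 1) + -c * z ^ 2 / 2 = -(z - 0) ^ 2 / (2 * (1 / (1 + c))) := by
    field_simp
    ring
  rw [h1, h3]
  field_simp

theorem integral_exp_gaussianReal {c : ℝ} (hc : 0 ≤ c) :
    ∫ z, Real.exp (-c * z ^ 2 / 2) ∂gaussianReal 0 1 = 1 / √(1 + c) := by
  have hv : Real.toNNReal (1 / (1 + c)) ≠ 0 := by
    rw [ne_eq, Real.toNNReal_eq_zero, not_le]
    positivity
  rw [integral_gaussianReal_eq_integral_smul one_ne_zero]
  simp_rw [smul_eq_mul, gaussianPDFReal_mul_exp hc]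
  rw [integral_const_mul, integral_gaussianPDFReal_eq_one _ hv, mul_one]

theorem integral_sq_gaussianReal (v : NNReal) : ∫ z, z ^ 2 ∂gaussianReal 0 v = v := by
  have h := variance_fun_id_gaussianReal (μ := 0) (v := v)
  rw [variance_eq_integral (by fun_prop), integral_id_gaussianReal] at h
  simpa using h

theorem integral_sq_mul_exp_gaussianReal {c : ℝ} (hc : 0 ≤ c) :
    ∫ z, z ^ 2 * Real.exp (-c * z ^ 2 / 2) ∂gaussianReal 0 1 = (1 / √(1 + c)) ^ 3 := by
  have h : 0 < 1 + c := by linarith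
  have hv : Real.toNNReal (1 / (1 + c)) ≠ 0 := by
    rw [ne_eq, Real.toNNReal_eq_zero, not_le]
    positivity
  have h1 := integral_sq_gaussianReal (Real.toNNReal (1 / (1 + c)))
  rw [integral_gaussianReal_eq_integral_smul hv, Real.coe_toNNReal _ (by positivity)] at h1
  rw [integral_gaussianReal_eq_integral_smul one_ne_zero]
  have h2 : ∀ z : ℝ, gaussianPDFReal 0 1 z • (z ^ 2 * Real.exp (-c * z ^ 2 / 2)) =
      (1 / √(1 + c)) * (gaussianPDFReal 0 (Real.toNNReal (1 / (1 + c))) z • z ^ 2) := by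
    intro z
    rw [smul_eq_mul, smul_eq_mul, mul_left_comm, gaussianPDFReal_mul_exp hc]
    ring
  simp_rw [h2]
  rw [integral_const_mul, h1, pow_succ', div_pow, Real.sq_sqrt h.le, one_pow]

theorem integrable_exp_gaussianReal {c : ℝ} (hc : 0 ≤ c) :
    Integrable (fun z => Real.exp (-c * z ^ 2 / 2)) (gaussianReal 0 1) := by
  refine (integrable_const (1 : ℝ)).mono' (by fun_prop) (ae_of_all _ fun z => ?_)
  rw [Real.norm_of_nonneg (Real.exp_pos _).le, Real.exp_le_one_iff]
  have := mul_nonneg hc (sq_nonneg z)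
  linarith

theorem integrable_sq_mul_exp_gaussianReal {c : ℝ} (hc : 0 ≤ c) :
    Integrable (fun z => z ^ 2 * Real.exp (-c * z ^ 2 / 2)) (gaussianReal 0 1) := by
  have h1 : Integrable (fun z : ℝ => z ^ 2) (gaussianReal 0 1) :=
    (memLp_id_gaussianReal (μ := 0) (v := 1) 2).integrable_sq
  refine h1.mono' (by fun_prop) (ae_of_all _ fun z => ?_)
  rw [Real.norm_of_nonneg (by positivity)]
  refine mul_le_of_le_one_right (sq_nonneg z) (Real.exp_le_one_iff.2 ?_)
  have := mul_nonneg hc (sq_nonneg z)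
  linarith

/-- `E[T² exp(-c T² / 2)]` for the norm `T` of a standard Gaussian vector. -/
theorem lintegral_sq_mul_exp {m : ℕ} {c : ℝ} (hc : 0 ≤ c) :
    ∫⁻ z, ENNReal.ofReal (eucl z ^ 2 * Real.exp (-c * eucl z ^ 2 / 2)) ∂gaussPi m =
      ENNReal.ofReal (m * (1 / √(1 + c)) ^ (m + 2)) := by
  -- Expanding T² = ∑ z_k² gives a sum over k of products of one-variable functions; `F k l` is the
  -- factor in the variable l.
  set F : Fin m → Fin m → ℝ → ℝ := fun k l z =>
    if l = k then z ^ 2 * Real.exp (-c * z ^ 2 / 2) else Real.exp (-c * z ^ 2 / 2) with hF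
  have h1 : ∀ z : Fin m → ℝ, eucl z ^ 2 * Real.exp (-c * eucl z ^ 2 / 2) =
      ∑ k, ∏ l, F k l (z l) := by
    intro z
    rw [eucl_sq, Finset.sum_mul]
    refine Finset.sum_congr rfl fun k _ => ?_
    have h2 : ∀ l, F k l (z l) = (if l = k then z l ^ 2 else 1) * Real.exp (-c * z l ^ 2 / 2) := by
      intro l
      simp only [hF]
      split_ifs <;> ring
    simp_rw [h2]
    rw [Finset.prod_mul_distrib, ← Real.exp_sum, Finset.prod_ite_eq' Finset.univ k fun l => z l ^ 2,
      if_pos (Finset.mem_univ k), ← Finset.sum_div, ← Finset.mul_sum]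
  have hint : ∀ k l, Integrable (F k l) (gaussianReal 0 1) := by
    intro k l
    simp only [hF]
    by_cases h : l = k
    · simp_rw [if_pos h]
      exact integrable_sq_mul_exp_gaussianReal hc
    · simp_rw [if_neg h]
      exact integrable_exp_gaussianReal hc
  have hint' : ∀ k, Integrable (fun z : Fin m → ℝ => ∏ l, F k l (z l)) (gaussPi m) :=
    fun k => Integrable.fintype_prod (hint k)
  have hval : ∀ k, ∫ z : Fin m → ℝ, ∏ l, F k l (z l) ∂gaussPi m = (1 / √(1 + c)) ^ (m + 2) := by
    intro k
    rw [integral_fintype_prod_eq_prod (F k)]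
    have h3 : ∀ l, ∫ z, F k l z ∂gaussianReal 0 1 =
        (if l = k then (1 / √(1 + c)) ^ 2 else 1) * (1 / √(1 + c)) := by
      intro l
      simp only [hF]
      by_cases h : l = k
      · simp_rw [if_pos h]
        rw [integral_sq_mul_exp_gaussianReal hc]
        ring
      · simp_rw [if_neg h]
        rw [integral_exp_gaussianReal hc, one_mul]
    simp_rw [h3]
    rw [Finset.prod_mul_distrib, Finset.prod_ite_eq' Finset.univ k fun _ => (1 / √(1 + c)) ^ 2,
      if_pos (Finset.mem_univ k), Finset.prod_const, Finset.card_univ, Fintype.card_fin]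
    ring
  rw [← ofReal_integral_eq_lintegral_ofReal]
  · simp_rw [h1]
    rw [integral_finsetSum _ fun k _ => hint' k]
    simp_rw [hval]
    simp
  · simp_rw [h1]
    exact integrable_finsetSum _ fun k _ => hint' k
  · exact ae_of_all _ fun z => by positivity

theorem lintegral_gaussianReal_prod {h : ℝ × ℝ → ℝ≥0∞} (hh : Measurable h) :
    ∫⁻ p, h p ∂(gaussianReal 0 1).prod (gaussianReal 0 1) =
      ∫⁻ p : ℝ × ℝ, ENNReal.ofReal ((2 * Real.pi)⁻¹ * Real.exp (-(p.1 ^ 2 + p.2 ^ 2) / 2)) * h p := by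
  rw [gaussianReal_of_var_ne_zero _ one_ne_zero,
    prod_withDensity (measurable_gaussianPDF _ _) (measurable_gaussianPDF _ _),
    lintegral_withDensity_eq_lintegral_mul _ (by fun_prop) hh]
  refine lintegral_congr fun p => ?_
  simp only [Pi.mul_apply, gaussianPDF]
  rw [← ENNReal.ofReal_mul (gaussianPDFReal_nonneg _ _ _)]
  congr 2
  rw [gaussianPDFReal, gaussianPDFReal, mul_mul_mul_comm, ← mul_inv, ← Real.exp_add]
  congr 2
  · rw [NNReal.coe_one, mul_one, Real.mul_self_sqrt (by positivity)]
  · simp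
    ring

theorem lintegral_prod_comp_smul {h : ℝ × ℝ → ℝ≥0∞} (hh : Measurable h) {T : ℝ} (hT : 0 < T) :
    ∫⁻ p, h p = ∫⁻ y, ENNReal.ofReal (T ^ 2) * h (T • y) := by
  have h1 := Measure.map_addHaar_smul (volume : Measure (ℝ × ℝ)) hT.ne'
  have hm : Measurable fun y : ℝ × ℝ => T • y := by fun_prop
  rw [lintegral_const_mul' _ _ ENNReal.ofReal_ne_top, ← lintegral_map hh hm, h1, lintegral_smul_measure,
    smul_eq_mul, ← mul_assoc, ← ENNReal.ofReal_mul (by positivity)]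
  rw [Module.finrank_prod, Module.finrank_self, abs_of_pos (by positivity),
    mul_inv_cancel₀ (by positivity), ENNReal.ofReal_one, one_mul]

theorem lintegral_gaussPi_split {m : ℕ} (i : Fin (m + 2)) (j : Fin (m + 1))
    {H : ℝ × ℝ → (Fin m → ℝ) → ℝ≥0∞} (hH : Measurable (Function.uncurry H)) :
    ∫⁻ x, H (x i, x (i.succAbove j)) (fun k => x (i.succAbove (j.succAbove k))) ∂gaussPi (m + 2) =
      ∫⁻ z, ∫⁻ p, H p z ∂(gaussianReal 0 1).prod (gaussianReal 0 1) ∂gaussPi m := by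
  have h1 := measurePreserving_piFinSuccAbove (fun _ : Fin (m + 2) => gaussianReal 0 1) i
  have h2 := measurePreserving_piFinSuccAbove (fun _ : Fin (m + 1) => gaussianReal 0 1) j
  set G : ℝ × (Fin (m + 1) → ℝ) → ℝ≥0∞ := fun q =>
    H (q.1, q.2 j) (fun k => q.2 (j.succAbove k)) with hG
  have hGm : Measurable G := by
    refine hH.comp (Measurable.prodMk (by fun_prop) (by fun_prop))
  have h3 : ∀ a, Measurable fun q : ℝ × (Fin m → ℝ) => H (a, q.1) q.2 := fun a =>
    hH.comp (Measurable.prodMk (by fun_prop) (by fun_prop))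
  calc _ = ∫⁻ q, G q ∂(gaussianReal 0 1).prod (gaussPi (m + 1)) := by
        rw [← h1.lintegral_comp hGm]
        rfl
    _ = ∫⁻ a, ∫⁻ y, G (a, y) ∂gaussPi (m + 1) ∂gaussianReal 0 1 :=
        lintegral_prod _ hGm.aemeasurable
    _ = ∫⁻ a, ∫⁻ b, ∫⁻ z, H (a, b) z ∂gaussPi m ∂gaussianReal 0 1 ∂gaussianReal 0 1 := by
        refine lintegral_congr fun a => ?_
        rw [← lintegral_prod (fun q : ℝ × (Fin m → ℝ) => H (a, q.1) q.2) (h3 a).aemeasurable,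
          ← h2.lintegral_comp (h3 a)]
        rfl
    _ = ∫⁻ p, ∫⁻ z, H p z ∂gaussPi m ∂(gaussianReal 0 1).prod (gaussianReal 0 1) := by
        rw [lintegral_prod]
        exact hH.lintegral_prod_right'.aemeasurable
    _ = _ := lintegral_lintegral_swap hH.aemeasurable

theorem ae_eucl_pos {m : ℕ} (hm : 0 < m) : ∀ᵐ z ∂gaussPi m, 0 < eucl z := by
  have := nullSingletonClass_gaussianReal (μ := 0) (v := 1) one_ne_zero
  have h := Measure.pi_hyperplane (fun _ : Fin m => gaussianReal 0 1) (⟨0, hm⟩ : Fin m) 0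
  refine measure_mono_null (fun x hx => ?_) h
  change x _ = 0
  by_contra hne
  refine hx (Real.sqrt_pos.2 ?_)
  exact Finset.sum_pos' (fun _ _ => sq_nonneg _)
    ⟨⟨0, hm⟩, Finset.mem_univ _, by positivity⟩

/-- For fixed other coordinates z, the pair is measured in units of ‖z‖, with Jacobian ‖z‖². A
function homogeneous of degree zero then sees z only through its direction. -/
theorem lintegral_gaussPi_pair {m : ℕ} (hm : 0 < m) (i : Fin (m + 2)) (j : Fin (m + 1))
    {H : ℝ × ℝ → (Fin m → ℝ) → ℝ≥0∞} (hH : Measurable (Function.uncurry H)) :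
    ∫⁻ x, H (x i, x (i.succAbove j)) (fun k => x (i.succAbove (j.succAbove k))) ∂gaussPi (m + 2) =
      ∫⁻ y : ℝ × ℝ, ENNReal.ofReal (2 * Real.pi)⁻¹ * ∫⁻ z, ENNReal.ofReal (eucl z ^ 2 *
        Real.exp (-(y.1 ^ 2 + y.2 ^ 2) * eucl z ^ 2 / 2)) * H (eucl z • y) z ∂gaussPi m := by
  have hmeas : Measurable fun q : (Fin m → ℝ) × (ℝ × ℝ) => ENNReal.ofReal (2 * Real.pi)⁻¹ *
      (ENNReal.ofReal (eucl q.1 ^ 2 *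
        Real.exp (-(q.2.1 ^ 2 + q.2.2 ^ 2) * eucl q.1 ^ 2 / 2)) * H (eucl q.1 • q.2) q.1) := by
    have h1 : Measurable fun q : (Fin m → ℝ) × (ℝ × ℝ) => eucl q.1 :=
      measurable_eucl.comp measurable_fst
    refine Measurable.const_mul (Measurable.mul ?_ ?_) _
    · fun_prop
    · exact hH.comp (Measurable.prodMk (h1.smul measurable_snd) measurable_fst)
  rw [lintegral_gaussPi_split i j hH]
  calc _ = ∫⁻ z, ∫⁻ y : ℝ × ℝ, ENNReal.ofReal (2 * Real.pi)⁻¹ * (ENNReal.ofReal (eucl z ^ 2 *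
        Real.exp (-(y.1 ^ 2 + y.2 ^ 2) * eucl z ^ 2 / 2)) * H (eucl z • y) z) ∂volume ∂gaussPi m := by
        refine lintegral_congr_ae ?_
        filter_upwards [ae_eucl_pos hm] with z hz
        have hHz : Measurable fun p => H p z := hH.of_uncurry_right
        have hd : Measurable fun p : ℝ × ℝ => ENNReal.ofReal
            ((2 * Real.pi)⁻¹ * Real.exp (-(p.1 ^ 2 + p.2 ^ 2) / 2)) * H p z :=
          Measurable.mul (by fun_prop) hHz
        rw [lintegral_gaussianReal_prod hHz, lintegral_prod_comp_smul hd hz]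
        refine lintegral_congr fun y => ?_
        rw [← mul_assoc, ← mul_assoc, ← ENNReal.ofReal_mul (by positivity),
          ← ENNReal.ofReal_mul (by positivity)]
        congr 2
        simp only [Prod.smul_fst, Prod.smul_snd, smul_eq_mul]
        rw [show -((eucl z * y.1) ^ 2 + (eucl z * y.2) ^ 2) / 2 =
          -(y.1 ^ 2 + y.2 ^ 2) * eucl z ^ 2 / 2 by ring]
        ring
    _ = ∫⁻ y : ℝ × ℝ, ∫⁻ z, ENNReal.ofReal (2 * Real.pi)⁻¹ * (ENNReal.ofReal (eucl z ^ 2 *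
        Real.exp (-(y.1 ^ 2 + y.2 ^ 2) * eucl z ^ 2 / 2)) * H (eucl z • y) z) ∂gaussPi m :=
        lintegral_lintegral_swap hmeas.aemeasurable
    _ = _ := by
        refine lintegral_congr fun y => lintegral_const_mul' _ _ ENNReal.ofReal_ne_top

/-- The open unit disc. -/
def disc : Set (ℝ × ℝ) := {a | a.1 ^ 2 + a.2 ^ 2 < 1}

/-- The height of the unit hemisphere over a point of the disc. -/
noncomputable def height (a : ℝ × ℝ) : ℝ := √(1 - (a.1 ^ 2 + a.2 ^ 2))

/-- The central projection of the disc, lifted to the hemisphere, to the plane. -/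
noncomputable def lift (a : ℝ × ℝ) : ℝ × ℝ := (a.1 * (height a)⁻¹, a.2 * (height a)⁻¹)

/-- The derivative of `lift`. -/
noncomputable def fderivLift (a : ℝ × ℝ) : ℝ × ℝ →L[ℝ] ℝ × ℝ :=
  (Matrix.toLin (.finTwoProd ℝ) (.finTwoProd ℝ)
    !![(height a)⁻¹ + a.1 ^ 2 * (height a)⁻¹ ^ 3, a.1 * a.2 * (height a)⁻¹ ^ 3;
      a.1 * a.2 * (height a)⁻¹ ^ 3, (height a)⁻¹ + a.2 ^ 2 * (height a)⁻¹ ^ 3]).toContinuousLinearMap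

theorem measurableSet_disc : MeasurableSet disc :=
  (isOpen_lt (by fun_prop) (by fun_prop)).measurableSet

theorem height_pos {a : ℝ × ℝ} (ha : a ∈ disc) : 0 < height a :=
  Real.sqrt_pos.2 (sub_pos.2 ha)

theorem height_sq {a : ℝ × ℝ} (ha : a ∈ disc) : height a ^ 2 = 1 - (a.1 ^ 2 + a.2 ^ 2) :=
  Real.sq_sqrt (sub_pos.2 ha).le

theorem one_add_lift_sq {a : ℝ × ℝ} (ha : a ∈ disc) :
    1 + ((lift a).1 ^ 2 + (lift a).2 ^ 2) = (height a ^ 2)⁻¹ := by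
  have h := height_pos ha
  have h2 := height_sq ha
  simp only [lift]
  field_simp
  linarith

theorem hasFDerivAt_lift {a : ℝ × ℝ} (ha : a ∈ disc) : HasFDerivAt lift (fderivLift a) a := by
  have h := height_pos ha
  have hv : HasFDerivAt (fun a => (height a)⁻¹)
      ((height a)⁻¹ ^ 3 • (a.1 • ContinuousLinearMap.fst ℝ ℝ ℝ +
        a.2 • ContinuousLinearMap.snd ℝ ℝ ℝ)) a := by
    have h1 : HasFDerivAt (fun a : ℝ × ℝ => 1 - (a.1 ^ 2 + a.2 ^ 2))
        (-((2 * a.1) • ContinuousLinearMap.fst ℝ ℝ ℝ +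
          (2 * a.2) • ContinuousLinearMap.snd ℝ ℝ ℝ)) a := by
      have := ((hasFDerivAt_fst (𝕜 := ℝ) (p := a)).pow 2).add
        ((hasFDerivAt_snd (𝕜 := ℝ) (p := a)).pow 2)
      refine (this.const_sub 1).congr_fderiv ?_
      ext <;> simp
    have h2 : HasDerivAt (fun t : ℝ => (√t)⁻¹) (-(1 / 2) * (height a)⁻¹ ^ 3)
        (1 - (a.1 ^ 2 + a.2 ^ 2)) := by
      have h3 := (Real.hasDerivAt_sqrt (sub_pos.2 ha).ne').fun_inv
        (Real.sqrt_pos.2 (sub_pos.2 ha)).ne'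
      refine h3.congr_deriv ?_
      change -(1 / (2 * height a)) / height a ^ 2 = _
      field_simp
    refine (h2.comp_hasFDerivAt a h1).congr_fderiv ?_
    ext <;> simp <;> ring
  unfold fderivLift
  rw [Matrix.toLin_finTwoProd_toContinuousLinearMap]
  refine HasFDerivAt.prodMk ((hasFDerivAt_fst.mul hv).congr_fderiv ?_)
    ((hasFDerivAt_snd.mul hv).congr_fderiv ?_) <;> ext <;> simp <;> ring

/-- With v = 1/`height a` the matrix is v times the identity plus v³ a aᵀ. Its determinant is v² +
|a|²v⁴ = v⁴. -/
theorem det_fderivLift {a : ℝ × ℝ} (ha : a ∈ disc) : (fderivLift a).det = (height a ^ 4)⁻¹ := by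
  have h := height_pos ha
  have h2 := height_sq ha
  have h3 : a.1 ^ 2 + a.2 ^ 2 = 1 - height a ^ 2 := by linarith
  unfold fderivLift
  rw [LinearMap.det_toContinuousLinearMap, LinearMap.det_toLin, Matrix.det_fin_two_of]
  have h4 : ∀ v : ℝ, (v + a.1 ^ 2 * v ^ 3) * (v + a.2 ^ 2 * v ^ 3)
      - a.1 * a.2 * v ^ 3 * (a.1 * a.2 * v ^ 3) = v ^ 2 + (a.1 ^ 2 + a.2 ^ 2) * v ^ 4 := by
    intro v
    ring
  rw [h4, h3]
  field_simp
  ring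

theorem injOn_lift : Set.InjOn lift disc := by
  intro a ha b hb hab
  have h1 := one_add_lift_sq ha
  rw [hab, one_add_lift_sq hb, inv_inj] at h1
  have h2 : height a = height b := by
    rw [← Real.sqrt_sq (height_pos ha).le, ← h1, Real.sqrt_sq (height_pos hb).le]
  have h3 := (height_pos hb).ne'
  simp only [lift, h2, Prod.mk.injEq] at hab
  exact Prod.ext (mul_right_cancel₀ (inv_ne_zero h3) hab.1)
    (mul_right_cancel₀ (inv_ne_zero h3) hab.2)

theorem image_lift : lift '' disc = Set.univ := by
  refine Set.eq_univ_of_forall fun y => ?_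
  set s := √(1 + (y.1 ^ 2 + y.2 ^ 2)) with hs
  have hs0 : 0 < s := by positivity
  have hs2 : s ^ 2 = 1 + (y.1 ^ 2 + y.2 ^ 2) := Real.sq_sqrt (by positivity)
  have h1 : (y.1 / s) ^ 2 + (y.2 / s) ^ 2 = 1 - (s ^ 2)⁻¹ := by
    field_simp
    linarith
  refine ⟨(y.1 / s, y.2 / s), ?_, ?_⟩
  · change (y.1 / s) ^ 2 + (y.2 / s) ^ 2 < 1
    rw [h1]
    have : 0 < (s ^ 2)⁻¹ := by positivity
    linarith
  · have h2 : height (y.1 / s, y.2 / s) = s⁻¹ := by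
      change √(1 - ((y.1 / s) ^ 2 + (y.2 / s) ^ 2)) = s⁻¹
      rw [h1, sub_sub_cancel, ← inv_pow, Real.sqrt_sq (by positivity)]
    simp only [lift, h2, inv_inv]
    ext <;> simp <;> field_simp

/-- Integrals over `ℝⁿ`, `n = m + 2`, against the Gaussian measure, of functions that are
homogeneous of degree zero, as integrals over the position in the unit disc of two coordinates of
the normalised vector. -/
theorem lintegral_gaussPi_le {m : ℕ} (hm : 0 < m) (i : Fin (m + 2)) (j : Fin (m + 1))
    {H : ℝ × ℝ → (Fin m → ℝ) → ℝ≥0∞} (hH : Measurable (Function.uncurry H)) {Ψ : ℝ × ℝ → ℝ≥0∞}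
    (h : ∀ a ∈ disc, ∫⁻ z, ENNReal.ofReal (eucl z ^ 2 *
        Real.exp (-((lift a).1 ^ 2 + (lift a).2 ^ 2) * eucl z ^ 2 / 2)) *
          H (eucl z • lift a) z ∂gaussPi m ≤
      Ψ a * ∫⁻ z, ENNReal.ofReal (eucl z ^ 2 *
        Real.exp (-((lift a).1 ^ 2 + (lift a).2 ^ 2) * eucl z ^ 2 / 2)) ∂gaussPi m) :
    ∫⁻ x, H (x i, x (i.succAbove j)) (fun k => x (i.succAbove (j.succAbove k))) ∂gaussPi (m + 2) ≤
      ∫⁻ a in disc, Ψ a * ENNReal.ofReal (m / (2 * Real.pi) * (height a ^ (m + 2) / height a ^ 4)) := by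
  rw [lintegral_gaussPi_pair hm i j hH, ← setLIntegral_univ, ← image_lift,
    lintegral_image_eq_lintegral_abs_det_fderiv_mul volume measurableSet_disc
      (fun a ha => (hasFDerivAt_lift ha).hasFDerivWithinAt) injOn_lift]
  refine setLIntegral_mono' measurableSet_disc fun a ha => ?_
  have hh := height_pos ha
  rw [det_fderivLift ha, abs_of_pos (by positivity)]
  have hc : 0 ≤ (lift a).1 ^ 2 + (lift a).2 ^ 2 := by positivity
  have hw : 1 / √(1 + ((lift a).1 ^ 2 + (lift a).2 ^ 2)) = height a := by
    rw [one_add_lift_sq ha, ← inv_pow, Real.sqrt_sq (by positivity), one_div, inv_inv]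
  have h1 := h a ha
  -- The weight in z has total mass m · height^(m+2); combined with the Jacobian height^(-4) it
  -- yields the density on the disc.
  rw [lintegral_sq_mul_exp hc, hw] at h1
  calc _ ≤ ENNReal.ofReal (height a ^ 4)⁻¹ * (ENNReal.ofReal (2 * Real.pi)⁻¹ *
        (Ψ a * ENNReal.ofReal (m * height a ^ (m + 2)))) := by gcongr
    _ = Ψ a * (ENNReal.ofReal (height a ^ 4)⁻¹ * ENNReal.ofReal (2 * Real.pi)⁻¹ *
        ENNReal.ofReal (m * height a ^ (m + 2))) := by ring
    _ = _ := by
        rw [← ENNReal.ofReal_mul (by positivity), ← ENNReal.ofReal_mul (by positivity)]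
        congr 2
        field_simp

theorem eucl_sq_split {m : ℕ} (x : Fin (m + 2) → ℝ) (i : Fin (m + 2)) (j : Fin (m + 1)) :
    eucl x ^ 2 = x i ^ 2 + x (i.succAbove j) ^ 2 +
      eucl (fun k => x (i.succAbove (j.succAbove k))) ^ 2 := by
  rw [eucl_sq, eucl_sq, Fin.sum_univ_succAbove _ i, Fin.sum_univ_succAbove _ j, add_assoc]

/-- Integrals, over a Haar-distributed frame, of functions of the coordinates of a fixed unit
vector, as integrals over the position in the unit disc of two of the coordinates. -/
theorem lintegral_haarOrth_le {m : ℕ} (hm : 0 < m) {g : E (m + 2)} (hg : ‖g‖ = 1)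
    (i : Fin (m + 2)) (j : Fin (m + 1)) {K : ℝ × ℝ → (Fin m → ℝ) → ℝ≥0∞}
    (hK : Measurable (Function.uncurry K))
    (hhom : ∀ a z (t : ℝ), 0 < t → K a (t • z) = K a z) {Ψ : ℝ × ℝ → ℝ≥0∞}
    (h : ∀ a ∈ disc, ∀ c : ℝ, 0 ≤ c → ∫⁻ z, ENNReal.ofReal (eucl z ^ 2 *
        Real.exp (-c * eucl z ^ 2 / 2)) * K a z ∂gaussPi m ≤
      Ψ a * ∫⁻ z, ENNReal.ofReal (eucl z ^ 2 * Real.exp (-c * eucl z ^ 2 / 2)) ∂gaussPi m) :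
    ∫⁻ U, K (frameCoord U g i, frameCoord U g (i.succAbove j))
        (fun k => frameCoord U g (i.succAbove (j.succAbove k))) ∂haarOrth (m + 2) ≤
      ∫⁻ a in disc, Ψ a * ENNReal.ofReal (m / (2 * Real.pi) * (height a ^ (m + 2) / height a ^ 4)) := by
  set N : ℝ × ℝ → (Fin m → ℝ) → ℝ := fun p z => √(p.1 ^ 2 + p.2 ^ 2 + eucl z ^ 2) with hN
  -- `H` evaluates `K` at the pair divided by the norm of the whole vector. At the pair ‖z‖ · `lift
  -- a` this quotient is a again.
  set H : ℝ × ℝ → (Fin m → ℝ) → ℝ≥0∞ := fun p z => K ((N p z)⁻¹ • p) z with hH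
  have hNm : Measurable fun q : (ℝ × ℝ) × (Fin m → ℝ) => N q.1 q.2 := by
    have : Measurable fun q : (ℝ × ℝ) × (Fin m → ℝ) => eucl q.2 :=
      measurable_eucl.comp measurable_snd
    fun_prop
  have hHm : Measurable (Function.uncurry H) :=
    hK.comp ((hNm.inv.smul measurable_fst).prodMk measurable_snd)
  have hFm : Measurable fun y : Fin (m + 2) → ℝ =>
      K (y i, y (i.succAbove j)) (fun k => y (i.succAbove (j.succAbove k))) :=
    hK.comp (Measurable.prodMk (by fun_prop) (by fun_prop))
  rw [lintegral_frameCoord (by omega) hFm hg]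
  calc _ = ∫⁻ x, H (x i, x (i.succAbove j)) (fun k => x (i.succAbove (j.succAbove k)))
        ∂gaussPi (m + 2) := by
        refine lintegral_congr_ae ?_
        filter_upwards [ae_eucl_pos (by omega : 0 < m + 2)] with x hx
        have h1 : N (x i, x (i.succAbove j)) (fun k => x (i.succAbove (j.succAbove k))) = eucl x := by
          rw [← Real.sqrt_sq hx.le, eucl_sq_split x i j]
        simp only [hH, h1]
        exact hhom _ (fun k => x (i.succAbove (j.succAbove k))) _ (inv_pos.2 hx)
    _ ≤ _ := by
        refine lintegral_gaussPi_le hm i j hHm fun a ha => ?_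
        refine le_trans (le_of_eq (lintegral_congr_ae ?_)) (h a ha _ (by positivity))
        filter_upwards [ae_eucl_pos hm] with z hz
        have hh := height_pos ha
        have h1 : N (eucl z • lift a) z = eucl z * (height a)⁻¹ := by
          simp only [hN]
          rw [← Real.sqrt_sq (by positivity : 0 ≤ eucl z * (height a)⁻¹), mul_pow, inv_pow,
            ← one_add_lift_sq ha]
          congr 1
          simp only [Prod.smul_fst, Prod.smul_snd, smul_eq_mul]
          ring
        have h2 : (eucl z * (height a)⁻¹)⁻¹ • eucl z • lift a = a := by
          rw [smul_smul]
          ext <;> simp [lift] <;> field_simp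
        simp only [hH]
        rw [h1, h2]

/-- The weight is the density (n-2)/(2π) · (1-|a|²)^((n-4)/2) of two coordinates of a random unit
vector. The quotient of powers of the height covers n = 3, where the exponent is negative. -/
theorem lintegral_haarOrth_pair_le {n : ℕ} (hn : 3 ≤ n) {g : E n} (hg : ‖g‖ = 1)
    {i j : Fin n} (hij : i ≠ j) {Φ : ℝ × ℝ → ℝ≥0∞} (hΦ : Measurable Φ) :
    ∫⁻ U, Φ (frameCoord U g i, frameCoord U g j) ∂haarOrth n ≤
      ∫⁻ a in disc, Φ a * ENNReal.ofReal
        ((n - 2) / (2 * Real.pi) * (height a ^ n / height a ^ 4)) := by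
  obtain ⟨m, rfl⟩ : ∃ m, n = m + 2 := ⟨n - 2, by omega⟩
  obtain ⟨j, rfl⟩ := Fin.exists_succAbove_eq hij.symm
  have := lintegral_haarOrth_le (by omega : 0 < m) hg i j (K := fun a _ => Φ a) (Ψ := Φ)
    (hΦ.comp measurable_fst) (fun _ _ _ _ => rfl) (fun a _ c _ => by
      rw [lintegral_mul_const, mul_comm]
      have : Measurable fun z : Fin m → ℝ => eucl z := measurable_eucl
      fun_prop)
  simpa using this

/-- For n ≥ 4 the density is largest at the centre of the disc. -/
theorem lintegral_haarOrth_pair_le_four {n : ℕ} (hn : 4 ≤ n) {g : E n} (hg : ‖g‖ = 1)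
    {i j : Fin n} (hij : i ≠ j) {Φ : ℝ × ℝ → ℝ≥0∞} (hΦ : Measurable Φ) :
    ∫⁻ U, Φ (frameCoord U g i, frameCoord U g j) ∂haarOrth n ≤
      ENNReal.ofReal ((n - 2) / (2 * Real.pi)) * ∫⁻ a, Φ a := by
  refine (lintegral_haarOrth_pair_le (by omega) hg hij hΦ).trans ?_
  rw [← lintegral_const_mul' _ _ ENNReal.ofReal_ne_top]
  refine le_trans (setLIntegral_mono' measurableSet_disc fun a ha => ?_)
    (setLIntegral_le_lintegral disc _)
  rw [mul_comm]
  gcongr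
  have h := height_pos ha
  have h1 : height a ≤ 1 := by
    rw [← Real.sqrt_one]
    refine Real.sqrt_le_sqrt ?_
    nlinarith [sq_nonneg a.1, sq_nonneg a.2]
  have h2 : (4 : ℝ) ≤ n := by exact_mod_cast hn
  refine mul_le_of_le_one_right (div_nonneg (by linarith) (by positivity)) ?_
  rw [div_le_one (by positivity)]
  exact pow_le_pow_of_le_one h.le h1 hn

/-! ### Small products under rotation-invariant laws in the plane -/

/-- By |sin φ| ≥ (2/π)|φ| on [-π/2, π/2], such a θ lies within d = πq/4 of a multiple of π/2. The
pieces inside (-π, π) have total length 8d. -/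
theorem volume_abs_sin_two_mul_lt_le {q : ℝ} (hq : 0 ≤ q) :
    volume (Set.Ioo (-Real.pi) Real.pi ∩ {θ | |Real.sin (2 * θ)| < q}) ≤
      ENNReal.ofReal (2 * Real.pi * q) := by
  have hπ := Real.pi_pos
  set d := Real.pi * q / 4 with hd
  have hd0 : 0 ≤ d := by positivity
  have hsub : Set.Ioo (-Real.pi) Real.pi ∩ {θ | |Real.sin (2 * θ)| < q} ⊆
      (((Set.Icc (-Real.pi) (-Real.pi + d) ∪ Set.Icc (-(Real.pi / 2) - d) (-(Real.pi / 2) + d)) ∪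
        Set.Icc (-d) d) ∪ Set.Icc (Real.pi / 2 - d) (Real.pi / 2 + d)) ∪
        Set.Icc (Real.pi - d) Real.pi := by
    rintro θ ⟨⟨h1, h2⟩, h3⟩
    have h3' : |Real.sin (2 * θ)| < q := h3
    have key : ∀ φ : ℝ, |Real.sin (2 * θ)| = |Real.sin φ| → |φ| ≤ Real.pi / 2 →
        -(2 * d) ≤ φ ∧ φ ≤ 2 * d := by
      intro φ h4 h5
      have h6 := Real.mul_abs_le_abs_sin h5
      rw [h4] at h3'
      have h7 : 2 / Real.pi * |φ| < q := h6.trans_lt h3'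
      rw [div_mul_eq_mul_div, div_lt_iff₀ hπ] at h7
      rw [← abs_le, hd]
      linarith
    simp only [Set.mem_union, Set.mem_Icc]
    rcases le_total θ (-(3 * Real.pi / 4)) with h | h
    · have := key (2 * θ + 2 * Real.pi) (by rw [Real.sin_add_two_pi])
        (abs_le.2 ⟨by linarith, by linarith⟩)
      exact Or.inl (Or.inl (Or.inl (Or.inl ⟨by linarith, by linarith⟩)))
    rcases le_total θ (-(Real.pi / 4)) with h' | h'
    · have := key (2 * θ + Real.pi) (by rw [Real.sin_add_pi, abs_neg])
        (abs_le.2 ⟨by linarith, by linarith⟩)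
      exact Or.inl (Or.inl (Or.inl (Or.inr ⟨by linarith, by linarith⟩)))
    rcases le_total θ (Real.pi / 4) with h'' | h''
    · have := key (2 * θ) rfl (abs_le.2 ⟨by linarith, by linarith⟩)
      exact Or.inl (Or.inl (Or.inr ⟨by linarith, by linarith⟩))
    rcases le_total θ (3 * Real.pi / 4) with h4 | h4
    · have := key (2 * θ - Real.pi) (by rw [Real.sin_sub_pi, abs_neg])
        (abs_le.2 ⟨by linarith, by linarith⟩)
      exact Or.inl (Or.inr ⟨by linarith, by linarith⟩)
    · have := key (2 * θ - 2 * Real.pi) (by rw [Real.sin_sub_two_pi])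
        (abs_le.2 ⟨by linarith, by linarith⟩)
      exact Or.inr ⟨by linarith, by linarith⟩
  refine (measure_mono hsub).trans ?_
  refine (measure_union_le _ _).trans ?_
  refine (add_le_add_left ((measure_union_le _ _).trans (add_le_add_left
    ((measure_union_le _ _).trans (add_le_add_left (measure_union_le _ _) _)) _)) _).trans ?_
  simp only [Real.volume_Icc]
  rw [← ENNReal.ofReal_add, ← ENNReal.ofReal_add, ← ENNReal.ofReal_add, ← ENNReal.ofReal_add]
  · refine ENNReal.ofReal_le_ofReal (le_of_eq ?_)
    rw [hd]
    ring
  all_goals linarith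

/-- For a rotation-invariant weight in the plane, the event `2 |x y| < q (x² + y²)` has at most
the fraction `q` of the mass. -/
theorem lintegral_radial_le {w : ℝ → ℝ≥0∞} (hw : Measurable w) {q : ℝ} (hq : 0 ≤ q) :
    ∫⁻ p : ℝ × ℝ, w (p.1 ^ 2 + p.2 ^ 2) *
        Set.indicator {p : ℝ × ℝ | 2 * |p.1 * p.2| < q * (p.1 ^ 2 + p.2 ^ 2)} 1 p ≤
      ENNReal.ofReal q * ∫⁻ p : ℝ × ℝ, w (p.1 ^ 2 + p.2 ^ 2) := by
  have hπ := Real.pi_pos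
  have hpol : ∀ r θ : ℝ, (polarCoord.symm (r, θ)).1 ^ 2 + (polarCoord.symm (r, θ)).2 ^ 2 = r ^ 2 := by
    intro r θ
    simp only [polarCoord_symm_apply]
    linear_combination r ^ 2 * Real.sin_sq_add_cos_sq θ
  set W : ℝ → ℝ≥0∞ := fun r => ENNReal.ofReal r * w (r ^ 2) with hW
  have hWm : Measurable W := by fun_prop
  set A : Set ℝ := {θ | |Real.sin (2 * θ)| < q} with hA
  have hAm : MeasurableSet A := measurableSet_lt (by fun_prop) (by fun_prop)
  have h1 : ∀ B : Set ℝ, MeasurableSet B →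
      ∫⁻ p in Set.Ioi (0 : ℝ) ×ˢ Set.Ioo (-Real.pi) Real.pi, W p.1 * B.indicator 1 p.2 =
        (∫⁻ r in Set.Ioi 0, W r) * volume (Set.Ioo (-Real.pi) Real.pi ∩ B) := by
    intro B hB
    have hBm : Measurable (B.indicator (1 : ℝ → ℝ≥0∞)) := measurable_one.indicator hB
    rw [Measure.volume_eq_prod, ← Measure.prod_restrict, lintegral_prod_mul hWm.aemeasurable
      hBm.aemeasurable, lintegral_indicator_one hB, Measure.restrict_apply hB, Set.inter_comm]
  have hL : ∫⁻ p : ℝ × ℝ, w (p.1 ^ 2 + p.2 ^ 2) *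
        Set.indicator {p : ℝ × ℝ | 2 * |p.1 * p.2| < q * (p.1 ^ 2 + p.2 ^ 2)} 1 p =
      (∫⁻ r in Set.Ioi 0, W r) * volume (Set.Ioo (-Real.pi) Real.pi ∩ A) := by
    rw [← h1 A hAm, ← lintegral_comp_polarCoord_symm]
    refine setLIntegral_congr_fun (measurableSet_Ioi.prod measurableSet_Ioo) fun p hp => ?_
    obtain ⟨r, θ⟩ := p
    have hr : 0 < r := hp.1
    simp only [smul_eq_mul, hpol, hW, mul_assoc]
    congr 2
    have h2 : 2 * |(polarCoord.symm (r, θ)).1 * (polarCoord.symm (r, θ)).2| =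
        |Real.sin (2 * θ)| * r ^ 2 := by
      simp only [polarCoord_symm_apply]
      rw [Real.sin_two_mul, show r * Real.cos θ * (r * Real.sin θ) =
        r ^ 2 * (Real.sin θ * Real.cos θ) by ring, abs_mul, abs_of_pos (by positivity : 0 < r ^ 2),
        mul_assoc 2, abs_mul 2, abs_two]
      ring
    have h3 : polarCoord.symm (r, θ) ∈
        {p : ℝ × ℝ | 2 * |p.1 * p.2| < q * (p.1 ^ 2 + p.2 ^ 2)} ↔ θ ∈ A := by
      change 2 * |_ * _| < q * (_ ^ 2 + _ ^ 2) ↔ |_| < q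
      rw [hpol, h2]
      exact mul_lt_mul_iff_of_pos_right (by positivity)
    by_cases h4 : θ ∈ A
    · rw [Set.indicator_of_mem h4, Set.indicator_of_mem (h3.2 h4)]
      rfl
    · rw [Set.indicator_of_notMem h4, Set.indicator_of_notMem (mt h3.1 h4)]
  have hR : ∫⁻ p : ℝ × ℝ, w (p.1 ^ 2 + p.2 ^ 2) =
      (∫⁻ r in Set.Ioi 0, W r) * ENNReal.ofReal (2 * Real.pi) := by
    have h2 := h1 Set.univ MeasurableSet.univ
    rw [Set.inter_univ, Real.volume_Ioo, sub_neg_eq_add, ← two_mul] at h2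
    rw [← h2, ← lintegral_comp_polarCoord_symm]
    refine setLIntegral_congr_fun (measurableSet_Ioi.prod measurableSet_Ioo) fun p hp => ?_
    obtain ⟨r, θ⟩ := p
    simp only [smul_eq_mul, hpol, hW, Set.indicator_univ, Pi.one_apply, mul_one]
  rw [hL, hR, mul_left_comm, ← ENNReal.ofReal_mul hq, mul_comm q]
  gcongr
  exact volume_abs_sin_two_mul_lt_le hq

/-- The weight and the Gaussian density depend on z only through its norm. For n = 4 this bounds the
conditional probability of a small product of the two remaining coordinates. -/
theorem lintegral_gaussPi_two_le {c q : ℝ} (hq : 0 ≤ q) :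
    ∫⁻ z, ENNReal.ofReal (eucl z ^ 2 * Real.exp (-c * eucl z ^ 2 / 2)) *
        Set.indicator {z : Fin 2 → ℝ | 2 * |z 0 * z 1| < q * eucl z ^ 2} 1 z ∂gaussPi 2 ≤
      ENNReal.ofReal q *
        ∫⁻ z, ENNReal.ofReal (eucl z ^ 2 * Real.exp (-c * eucl z ^ 2 / 2)) ∂gaussPi 2 := by
  have hmp := measurePreserving_piFinTwo (fun _ : Fin 2 => gaussianReal 0 1)
  have he : ∀ z : Fin 2 → ℝ, eucl z ^ 2 = z 0 ^ 2 + z 1 ^ 2 := fun z => by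
    rw [eucl_sq, Fin.sum_univ_two]
  set v : ℝ → ℝ≥0∞ := fun s => ENNReal.ofReal (s * Real.exp (-c * s / 2)) with hv
  have hvm : Measurable v := by fun_prop
  set A : Set (ℝ × ℝ) := {p | 2 * |p.1 * p.2| < q * (p.1 ^ 2 + p.2 ^ 2)} with hA
  have hAm : MeasurableSet A := measurableSet_lt (by fun_prop) (by fun_prop)
  have hL : ∀ h : ℝ × ℝ → ℝ≥0∞, Measurable h →
      ∫⁻ z : Fin 2 → ℝ, h (z 0, z 1) ∂gaussPi 2 = ∫⁻ p : ℝ × ℝ, ENNReal.ofReal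
        ((2 * Real.pi)⁻¹ * Real.exp (-(p.1 ^ 2 + p.2 ^ 2) / 2)) * h p := by
    intro h hh
    rw [← lintegral_gaussianReal_prod hh, ← hmp.lintegral_comp hh]
    rfl
  have hA1 : Measurable (A.indicator (1 : ℝ × ℝ → ℝ≥0∞)) := measurable_one.indicator hAm
  have h1 := hL (fun p => v (p.1 ^ 2 + p.2 ^ 2) * A.indicator 1 p)
    (Measurable.mul (by fun_prop) hA1)
  have h2 := hL (fun p => v (p.1 ^ 2 + p.2 ^ 2)) (by fun_prop)
  have h3 := lintegral_radial_le (w := fun s => ENNReal.ofReal ((2 * Real.pi)⁻¹ *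
    Real.exp (-s / 2)) * v s) (by fun_prop) hq
  have h4 : ∀ z : Fin 2 → ℝ, Set.indicator {z : Fin 2 → ℝ | 2 * |z 0 * z 1| < q * eucl z ^ 2}
      (1 : (Fin 2 → ℝ) → ℝ≥0∞) z = A.indicator 1 (z 0, z 1) := by
    intro z
    simp only [Set.indicator_apply, hA, Set.mem_ofPred_eq, he]
    rfl
  simp_rw [h4, he]
  refine (le_of_eq h1).trans (le_trans ?_ (mul_le_mul_right (le_of_eq h2.symm) _))
  simpa only [mul_assoc] using h3

/-! ### How a small signed sum forces small coordinates -/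

/-- The set of the coordinates of absolute value at most `δ`. -/
noncomputable def smallSet {n : ℕ} (δ : ℝ) (a : Fin n → ℝ) : Finset (Fin n) :=
  Finset.univ.filter fun i => |a i| ≤ δ

theorem mem_smallSet {n : ℕ} {δ : ℝ} {a : Fin n → ℝ} {i : Fin n} :
    i ∈ smallSet δ a ↔ |a i| ≤ δ := by simp [smallSet]

/-- A rearrangement of ∑(x_i - δ)² ≤ (∑(x_i - δ))². For a given sum of squares, entries that are at
least δ have the least sum when all but one equal δ. -/
theorem sum_sq_sub_le_sq {ι : Type*} (B : Finset ι) (x : ι → ℝ) {δ : ℝ}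
    (hx : ∀ i ∈ B, δ ≤ x i) :
    ∑ i ∈ B, x i ^ 2 - (B.card - 1) * δ ^ 2 ≤ (∑ i ∈ B, x i - (B.card - 1) * δ) ^ 2 := by
  have h1 : ∑ i ∈ B, (x i - δ) ^ 2 ≤ (∑ i ∈ B, (x i - δ)) ^ 2 :=
    Finset.sum_sq_le_sq_sum_of_nonneg fun i hi => sub_nonneg.2 (hx i hi)
  have h2 : ∑ i ∈ B, (x i - δ) ^ 2 = ∑ i ∈ B, x i ^ 2 - 2 * δ * ∑ i ∈ B, x i + B.card * δ ^ 2 := by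
    simp_rw [sub_sq]
    rw [Finset.sum_add_distrib, Finset.sum_sub_distrib, Finset.sum_const, nsmul_eq_mul,
      Finset.mul_sum]
    congr 2
    exact Finset.sum_congr rfl fun i _ => by ring
  have h3 : ∑ i ∈ B, (x i - δ) = ∑ i ∈ B, x i - B.card * δ := by
    rw [Finset.sum_sub_distrib, Finset.sum_const, nsmul_eq_mul]
  rw [h2, h3] at h1
  nlinarith

/-- The sum of the rescaled absolute values of the small coordinates. -/
noncomputable def smallSum {n : ℕ} (δ : ℝ) (a : Fin n → ℝ) : ℝ := ∑ i ∈ smallSet δ a, |a i| / δ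

theorem smallSum_le_card {n : ℕ} {δ : ℝ} (hδ : 0 < δ) (a : Fin n → ℝ) :
    smallSum δ a ≤ (smallSet δ a).card := by
  rw [smallSum, ← nsmul_one, ← Finset.sum_const]
  refine Finset.sum_le_sum fun i hi => ?_
  rw [div_le_one hδ]
  exact mem_smallSet.1 hi

theorem smallSum_nonneg {n : ℕ} {δ : ℝ} (hδ : 0 < δ) (a : Fin n → ℝ) : 0 ≤ smallSum δ a :=
  Finset.sum_nonneg fun _ _ => by positivity

theorem signedSum_eq {n : ℕ} (a : Fin n → ℝ) :
    signedSum a = ∑ i, |a i| - 2 * ∑ i ∈ smallSet (1 / n) a, |a i| := by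
  have h : ∑ i ∈ smallSet (1 / n) a, |a i| = ∑ i, if |a i| ≤ 1 / n then |a i| else 0 := by
    rw [smallSet, Finset.sum_filter]
  rw [h, signedSum, Finset.mul_sum, ← Finset.sum_sub_distrib]
  refine Finset.sum_congr rfl fun i _ => ?_
  split_ifs <;> ring

/-- If the signed sum is less than `1` then the small coordinates are many and not too small. -/
theorem of_signedSum_lt_one {n : ℕ} (hn : 2 ≤ n) {a : Fin n → ℝ} (ha : ∑ i, a i ^ 2 = 1)
    (h : signedSum a < 1) {d : ℝ}
    (hd : d = n - (smallSet (1 / n) a).card - 1 - smallSum (1 / n) a) :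
    2 * n * d < d ^ 2 + (n - (smallSet (1 / n) a).card - 1) + smallSum (1 / n) a := by
  set δ : ℝ := 1 / n with hδ
  have hn0 : (0 : ℝ) < n := by exact_mod_cast (by omega : 0 < n)
  have hδ0 : 0 < δ := by positivity
  set S := smallSet δ a with hS
  set s := smallSum δ a with hs
  have hcard : ((Sᶜ).card : ℝ) = n - S.card := by
    have := Finset.card_add_card_compl S
    rw [Fintype.card_fin] at this
    have h2 : (S.card : ℝ) + (Sᶜ).card = n := by exact_mod_cast this
    linarith
  have hB := sum_sq_sub_le_sq Sᶜ (fun i => |a i|) (fun i hi => by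
    rw [Finset.mem_compl, hS, mem_smallSet, not_le] at hi
    exact hi.le)
  have hBlow : ((Sᶜ).card : ℝ) * δ ≤ ∑ i ∈ Sᶜ, |a i| := by
    rw [← nsmul_eq_mul, ← Finset.sum_const]
    refine Finset.sum_le_sum fun i hi => ?_
    rw [Finset.mem_compl, hS, mem_smallSet, not_le] at hi
    exact hi.le
  simp_rw [sq_abs] at hB
  rw [hcard] at hB hBlow
  have hsq : ∑ i ∈ S, a i ^ 2 + ∑ i ∈ Sᶜ, a i ^ 2 = 1 := by
    rw [Finset.sum_add_sum_compl, ha]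
  have hS1 : ∑ i ∈ S, |a i| = δ * s := by
    rw [hs, smallSum, Finset.mul_sum]
    refine Finset.sum_congr rfl fun i _ => ?_
    field_simp
  have hS2 : ∑ i ∈ S, a i ^ 2 ≤ δ ^ 2 * s := by
    rw [sq δ, mul_assoc, ← hS1, Finset.mul_sum]
    refine Finset.sum_le_sum fun i hi => ?_
    rw [← sq_abs, sq]
    exact mul_le_mul_of_nonneg_right (mem_smallSet.1 hi) (abs_nonneg _)
  have hsum : ∑ i ∈ S, |a i| + ∑ i ∈ Sᶜ, |a i| = ∑ i, |a i| := Finset.sum_add_sum_compl _ _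
  rw [signedSum_eq] at h
  -- A signed sum below 1 means that the large coordinates sum to less than 1 + δs. This is squared
  -- and compared with `hB`, where their squares sum to at least 1 - δ²s; division by δ² gives the
  -- claim.
  have ht : ∑ i ∈ Sᶜ, |a i| - (n - S.card - 1) * δ < 1 - δ * d := by
    rw [hd]
    linarith
  have ht0 : 0 ≤ ∑ i ∈ Sᶜ, |a i| - (n - S.card - 1) * δ := by linarith
  have h5 := pow_lt_pow_left₀ ht ht0 two_ne_zero
  have h6 : 0 < δ ^ 2 * (d ^ 2 + (n - S.card - 1) + s) - 2 * δ * d := by nlinarith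
  have h7 : 2 * δ * d = δ ^ 2 * (2 * n * d) := by
    rw [hδ]
    field_simp
  rw [h7, ← mul_sub] at h6
  have := pos_of_mul_pos_right h6 (by positivity)
  linarith

/-- The claim is d < 1 for the d of `of_signedSum_lt_one`. If 1 ≤ d ≤ n - 1, then s ≤ k bounds the
right side there by d² + n - 1 ≤ (n-1)(d+1) < 2nd. -/
theorem lt_smallSum_of_signedSum_lt_one {n : ℕ} (hn : 2 ≤ n) {a : Fin n → ℝ}
    (ha : ∑ i, a i ^ 2 = 1) (h : signedSum a < 1) :
    n - (smallSet (1 / n) a).card - 2 < smallSum (1 / n) a := by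
  have hn0 : (0 : ℝ) < n := by exact_mod_cast (by omega : 0 < n)
  have h1 := of_signedSum_lt_one hn ha h rfl
  have h2 := smallSum_le_card (by positivity : (0 : ℝ) < 1 / n) a
  have h3 := smallSum_nonneg (by positivity : (0 : ℝ) < 1 / n) a
  have h4 : (0 : ℝ) ≤ (smallSet (1 / n) a).card := by positivity
  set s := smallSum (1 / n) a
  set k : ℝ := ((smallSet (1 / n) a).card : ℝ)
  set d := n - k - 1 - s with hd
  by_contra hc
  have hd1 : 1 ≤ d := by linarith
  have hd2 : d ≤ n - 1 := by linarith
  nlinarith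

/-! ### Pair weights and the union bound -/

/-- The pair weight: `c₀ + c₁ (y + y')`, and `c₂` more if `y` and `y'` exceed `η`, for coordinates
of absolute values `y δ` and `y' δ` with `y, y' ≤ 1`. -/
noncomputable def pairWeight (δ c₀ c₁ c₂ η : ℝ) (p : ℝ × ℝ) : ℝ :=
  if |p.1| ≤ δ ∧ |p.2| ≤ δ then
    c₀ + c₁ * (|p.1| / δ + |p.2| / δ) + (if η < |p.1| / δ ∧ η < |p.2| / δ then c₂ else 0)
  else 0

theorem measurable_pairWeight (δ c₀ c₁ c₂ η : ℝ) : Measurable (pairWeight δ c₀ c₁ c₂ η) := by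
  have h1 : Measurable fun p : ℝ × ℝ => |p.1| := by fun_prop
  have h2 : Measurable fun p : ℝ × ℝ => |p.2| := by fun_prop
  have h3 : Measurable fun p : ℝ × ℝ => |p.1| / δ := by fun_prop
  have h4 : Measurable fun p : ℝ × ℝ => |p.2| / δ := by fun_prop
  refine Measurable.ite ((measurableSet_le h1 measurable_const).inter
    (measurableSet_le h2 measurable_const)) (Measurable.add (by fun_prop) ?_) measurable_const
  exact Measurable.ite ((measurableSet_lt measurable_const h3).inter
    (measurableSet_lt measurable_const h4)) measurable_const measurable_const

theorem pairWeight_nonneg {δ c₀ c₁ c₂ η : ℝ} (hδ : 0 < δ) (h₀ : 0 ≤ c₀) (h₁ : 0 ≤ c₁)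
    (h₂ : 0 ≤ c₂) (p : ℝ × ℝ) : 0 ≤ pairWeight δ c₀ c₁ c₂ η p := by
  unfold pairWeight
  split_ifs <;> positivity

/-- Over [-δ, δ] the mean of |t|/δ is 1/2, and for 0 ≤ η ≤ 1 the event |t| > ηδ has proportion 1 -
η. The product structure of the square does the rest. -/
theorem lintegral_pairWeight_le {δ c₀ c₁ c₂ η : ℝ} (hδ : 0 < δ) (h₀ : 0 ≤ c₀) (h₁ : 0 ≤ c₁)
    (h₂ : 0 ≤ c₂) (hη1 : η ≤ 1) :
    ∫⁻ p, ENNReal.ofReal (pairWeight δ c₀ c₁ c₂ η p) ≤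
      ENNReal.ofReal (4 * δ ^ 2 * (c₀ + c₁ + c₂ * (1 - η) ^ 2)) := by
  set u : ℝ → ℝ≥0∞ := (Set.Icc (-δ) δ).indicator 1 with hu
  set v : ℝ → ℝ≥0∞ := (Set.Icc (-δ) δ).indicator (fun t => ENNReal.ofReal (|t| / δ)) with hv
  set w : ℝ → ℝ≥0∞ := (Set.Icc (-δ) (-(η * δ)) ∪ Set.Icc (η * δ) δ).indicator 1 with hw
  have hum : Measurable u := measurable_one.indicator measurableSet_Icc
  have hvm : Measurable v := Measurable.indicator (by fun_prop) measurableSet_Icc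
  have hwm : Measurable w :=
    measurable_one.indicator (measurableSet_Icc.union measurableSet_Icc)
  have hui : ∫⁻ t, u t = ENNReal.ofReal (2 * δ) := by
    rw [hu, lintegral_indicator_one measurableSet_Icc, Real.volume_Icc]
    congr 1
    ring
  have hwi : ∫⁻ t, w t ≤ ENNReal.ofReal (2 * δ * (1 - η)) := by
    rw [hw, lintegral_indicator_one (measurableSet_Icc.union measurableSet_Icc)]
    refine (measure_union_le _ _).trans ?_
    rw [Real.volume_Icc, Real.volume_Icc, ← ENNReal.ofReal_add (by nlinarith) (by nlinarith)]
    refine ENNReal.ofReal_le_ofReal (le_of_eq (by ring))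
  have hvi : ∫⁻ t, v t = ENNReal.ofReal δ := by
    rw [hv, lintegral_indicator measurableSet_Icc, ← ofReal_integral_eq_lintegral_ofReal]
    · congr 1
      rw [integral_Icc_eq_integral_Ioc, ← intervalIntegral.integral_of_le (by linarith)]
      simp_rw [div_eq_mul_inv]
      rw [intervalIntegral.integral_mul_const, ← intervalIntegral.integral_add_adjacent_intervals
        (b := 0) ((by fun_prop : Continuous fun t : ℝ => |t|).intervalIntegrable _ _)
        ((by fun_prop : Continuous fun t : ℝ => |t|).intervalIntegrable _ _)]
      have e1 : ∫ t in (-δ)..0, |t| = ∫ t in (-δ)..0, -t := by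
        refine intervalIntegral.integral_congr fun t ht => ?_
        rw [Set.uIcc_of_le (by linarith)] at ht
        exact abs_of_nonpos ht.2
      have e2 : ∫ t in (0 : ℝ)..δ, |t| = ∫ t in (0 : ℝ)..δ, t := by
        refine intervalIntegral.integral_congr fun t ht => ?_
        rw [Set.uIcc_of_le hδ.le] at ht
        exact abs_of_nonneg ht.1
      rw [e1, e2, intervalIntegral.integral_neg, integral_id, integral_id]
      field_simp
      ring
    · exact (by fun_prop : Continuous fun t : ℝ => |t| / δ).continuousOn.integrableOn_Icc
    · exact ae_of_all _ fun t => by positivity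
  have hpt : ∀ p : ℝ × ℝ, ENNReal.ofReal (pairWeight δ c₀ c₁ c₂ η p) ≤
      ENNReal.ofReal c₀ * (u p.1 * u p.2) + ENNReal.ofReal c₁ * (v p.1 * u p.2 + u p.1 * v p.2) +
        ENNReal.ofReal c₂ * (w p.1 * w p.2) := by
    intro p
    unfold pairWeight
    split_ifs with hs hb
    · have hw' : ∀ t : ℝ, |t| ≤ δ → η < |t| / δ → w t = 1 := by
        intro t h1 h2
        rw [lt_div_iff₀ hδ] at h2
        refine Set.indicator_of_mem ?_ _
        rcases abs_cases t with h3 | h3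
        · exact Or.inr ⟨by linarith, by linarith⟩
        · exact Or.inl ⟨by linarith, by linarith⟩
      have m1 : p.1 ∈ Set.Icc (-δ) δ := abs_le.1 hs.1
      have m2 : p.2 ∈ Set.Icc (-δ) δ := abs_le.1 hs.2
      rw [hw' _ hs.1 hb.1, hw' _ hs.2 hb.2, hu, hv]
      simp only [Set.indicator_of_mem m1, Set.indicator_of_mem m2, Pi.one_apply, mul_one, one_mul]
      rw [← ENNReal.ofReal_add (by positivity) (by positivity), ← ENNReal.ofReal_mul h₁,
        ← ENNReal.ofReal_add h₀ (by positivity), ← ENNReal.ofReal_add (by positivity) h₂]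
    · have m1 : p.1 ∈ Set.Icc (-δ) δ := abs_le.1 hs.1
      have m2 : p.2 ∈ Set.Icc (-δ) δ := abs_le.1 hs.2
      refine le_trans (le_of_eq ?_) le_self_add
      rw [hu, hv]
      simp only [Set.indicator_of_mem m1, Set.indicator_of_mem m2, Pi.one_apply, mul_one, one_mul,
        add_zero]
      rw [← ENNReal.ofReal_add (by positivity) (by positivity), ← ENNReal.ofReal_mul h₁,
        ← ENNReal.ofReal_add h₀ (by positivity)]
    · simp
  have hprod : ∀ f h : ℝ → ℝ≥0∞, Measurable f → Measurable h →
      ∫⁻ p : ℝ × ℝ, f p.1 * h p.2 = (∫⁻ t, f t) * ∫⁻ t, h t := fun f h hf hh =>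
    lintegral_prod_mul hf.aemeasurable hh.aemeasurable
  refine (lintegral_mono hpt).trans ?_
  rw [lintegral_add_left (by fun_prop), lintegral_add_left (by fun_prop),
    lintegral_const_mul' _ _ ENNReal.ofReal_ne_top, lintegral_const_mul' _ _ ENNReal.ofReal_ne_top,
    lintegral_const_mul' _ _ ENNReal.ofReal_ne_top, lintegral_add_left (by fun_prop),
    hprod u u hum hum, hprod v u hvm hum, hprod u v hum hvm, hprod w w hwm hwm, hui, hvi]
  calc _ ≤ ENNReal.ofReal c₀ * (ENNReal.ofReal (2 * δ) * ENNReal.ofReal (2 * δ)) +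
        ENNReal.ofReal c₁ * (ENNReal.ofReal δ * ENNReal.ofReal (2 * δ) +
          ENNReal.ofReal (2 * δ) * ENNReal.ofReal δ) +
        ENNReal.ofReal c₂ * (ENNReal.ofReal (2 * δ * (1 - η)) *
          ENNReal.ofReal (2 * δ * (1 - η))) := by gcongr
    _ = _ := by
        have h1 : 0 ≤ 2 * δ * (1 - η) := mul_nonneg (by positivity) (by linarith)
        simp only [← ENNReal.ofReal_mul h₀, ← ENNReal.ofReal_mul h₂,
          ← ENNReal.ofReal_mul hδ.le, ← ENNReal.ofReal_mul (by positivity : 0 ≤ 2 * δ),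
          ← ENNReal.ofReal_mul h1]
        rw [← ENNReal.ofReal_add (by positivity) (by positivity), ← ENNReal.ofReal_mul h₁,
          ← ENNReal.ofReal_add (by positivity) (by positivity),
          ← ENNReal.ofReal_add (by positivity) (by positivity)]
        congr 1
        ring

/-- Only the k(k-1) ordered pairs of small coordinates contribute, and each small coordinate occurs
in 2(k-1) of them. -/
theorem sum_pairWeight_ge {n : ℕ} {δ c₀ c₁ c₂ η : ℝ} (hδ : 0 < δ) (h₀ : 0 ≤ c₀) (h₁ : 0 ≤ c₁)
    (h₂ : 0 ≤ c₂) {a : Fin n → ℝ} {k s : ℝ} (hk : k = (smallSet δ a).card) (hs : s = smallSum δ a) :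
    c₀ * (k * (k - 1)) + 2 * c₁ * (k - 1) * s ≤
        ∑ p ∈ Finset.univ.offDiag, pairWeight δ c₀ c₁ c₂ η (a p.1, a p.2) ∧
      ((∀ i ∈ smallSet δ a, η < |a i| / δ) →
        (c₀ + c₂) * (k * (k - 1)) + 2 * c₁ * (k - 1) * s ≤
          ∑ p ∈ Finset.univ.offDiag, pairWeight δ c₀ c₁ c₂ η (a p.1, a p.2)) := by
  set S := smallSet δ a with hS
  have hsub : ∑ p ∈ S.offDiag, pairWeight δ c₀ c₁ c₂ η (a p.1, a p.2) ≤
      ∑ p ∈ Finset.univ.offDiag, pairWeight δ c₀ c₁ c₂ η (a p.1, a p.2) :=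
    Finset.sum_le_sum_of_subset_of_nonneg (Finset.offDiag_mono (Finset.subset_univ _))
      fun _ _ _ => pairWeight_nonneg hδ h₀ h₁ h₂ _
  have hval : ∀ c : ℝ, ∑ p ∈ S.offDiag, (c + c₁ * (|a p.1| / δ + |a p.2| / δ)) =
      c * (k * (k - 1)) + 2 * c₁ * (k - 1) * s := by
    intro c
    have h3 := Finset.sum_product S S fun p => c + c₁ * (|a p.1| / δ + |a p.2| / δ)
    rw [← Finset.diag_union_offDiag, Finset.sum_union (Finset.disjoint_diag_offDiag _)] at h3
    have h4 : ∑ p ∈ S.diag, (c + c₁ * (|a p.1| / δ + |a p.2| / δ)) = c * k + 2 * c₁ * s := by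
      rw [Finset.sum_diag (f := fun p : Fin n × Fin n => c + c₁ * (|a p.1| / δ + |a p.2| / δ)),
        Finset.sum_add_distrib, Finset.sum_const, nsmul_eq_mul, ← Finset.mul_sum,
        Finset.sum_add_distrib, hs, smallSum, hk]
      ring
    have h5 : ∑ i ∈ S, ∑ j ∈ S, (c + c₁ * (|a i| / δ + |a j| / δ)) =
        c * k ^ 2 + 2 * c₁ * k * s := by
      simp_rw [Finset.sum_add_distrib, ← Finset.mul_sum, Finset.sum_add_distrib, Finset.sum_const,
        nsmul_eq_mul, ← Finset.mul_sum, hs, smallSum, hk]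
      ring
    rw [h4, h5] at h3
    linarith
  have hmem : ∀ p ∈ S.offDiag, |a p.1| ≤ δ ∧ |a p.2| ≤ δ := fun p hp => by
    rw [Finset.mem_offDiag] at hp
    exact ⟨mem_smallSet.1 hp.1, mem_smallSet.1 hp.2.1⟩
  constructor
  · rw [← hval]
    refine le_trans (Finset.sum_le_sum fun p hp => ?_) hsub
    rw [pairWeight, if_pos (hmem p hp)]
    split_ifs <;> linarith
  · intro hall
    rw [← hval]
    refine le_trans (Finset.sum_le_sum fun p hp => ?_) hsub
    have hp' := Finset.mem_offDiag.1 hp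
    rw [pairWeight, if_pos (hmem p hp), if_pos ⟨hall _ hp'.1, hall _ hp'.2.1⟩]
    linarith

/-- A union bound over pairs of coordinates for Haar-distributed frames. -/
theorem haarOrth_le_of_offDiag {n : ℕ} {g : E n} {A : Set (Fin n → ℝ)} (hg : ‖g‖ = 1)
    {Φ : ℝ × ℝ → ℝ} (hΦ0 : ∀ p, 0 ≤ Φ p) (hΦ : Measurable Φ)
    (hA : ∀ a ∈ A, ∑ i, a i ^ 2 = 1 → 1 ≤ ∑ p ∈ Finset.univ.offDiag, Φ (a p.1, a p.2))
    {I : ℝ} (hint : ∀ i j : Fin n, i ≠ j →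
      ∫⁻ U, ENNReal.ofReal (Φ (frameCoord U g i, frameCoord U g j)) ∂haarOrth n ≤
        ENNReal.ofReal I) :
    haarOrth n {U | frameCoord U g ∈ A} ≤ ENNReal.ofReal (n * (n - 1) * I) := by
  have hm : Measurable fun U : OrthGroup n => frameCoord U g :=
    measurable_frameCoord.comp (measurable_id.prodMk measurable_const)
  have hmi : ∀ i, Measurable fun U : OrthGroup n => frameCoord U g i := fun i =>
    (measurable_pi_apply i).comp hm
  have hmp : ∀ p : Fin n × Fin n, Measurable fun U : OrthGroup n =>
      ENNReal.ofReal (Φ (frameCoord U g p.1, frameCoord U g p.2)) := fun p =>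
    (hΦ.comp ((hmi p.1).prodMk (hmi p.2))).ennreal_ofReal
  calc haarOrth n {U | frameCoord U g ∈ A}
      ≤ ∫⁻ U, ∑ p ∈ Finset.univ.offDiag,
          ENNReal.ofReal (Φ (frameCoord U g p.1, frameCoord U g p.2)) ∂haarOrth n := by
        -- Markov's inequality for the total weight, which is at least 1 on the event.
        refine meas_le_lintegral₀ (Finset.measurable_sum _ fun p _ => hmp p).aemeasurable
          fun U hU => ?_
        rw [← ENNReal.ofReal_sum_of_nonneg fun _ _ => hΦ0 _, ENNReal.one_le_ofReal]
        refine hA _ hU ?_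
        rw [← eucl_sq, eucl_frameCoord, hg, one_pow]
    _ = ∑ p ∈ Finset.univ.offDiag,
          ∫⁻ U, ENNReal.ofReal (Φ (frameCoord U g p.1, frameCoord U g p.2)) ∂haarOrth n :=
        lintegral_finsetSum _ fun p _ => hmp p
    _ ≤ ∑ _p ∈ (Finset.univ : Finset (Fin n)).offDiag, ENNReal.ofReal I :=
        Finset.sum_le_sum fun p hp => hint _ _ (Finset.mem_offDiag.1 hp).2.2
    _ = _ := by
        rw [Finset.sum_const, Finset.offDiag_card, Finset.card_univ, Fintype.card_fin,
          nsmul_eq_mul, ← ENNReal.ofReal_natCast, ← ENNReal.ofReal_mul (by positivity)]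
        congr 2
        rw [Nat.cast_sub (Nat.le_mul_self n)]
        push_cast
        ring

/-- There are n(n-1) ordered pairs, the density is at most (n-2)/(2π), and the weight has the
integral computed above; `hnum` makes the product at most 1/3 because 3.14 < π. -/
theorem haarOrth_le_of_pairWeight {n : ℕ} (hn : 4 ≤ n) {g : E n} (hg : ‖g‖ = 1)
    {δ c₀ c₁ c₂ η : ℝ} (hδ : 0 < δ) (h₀ : 0 ≤ c₀) (h₁ : 0 ≤ c₁)
    (h₂ : 0 ≤ c₂) (hη1 : η ≤ 1) {A : Set (Fin n → ℝ)}
    (hA : ∀ a ∈ A, ∑ i, a i ^ 2 = 1 →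
      1 ≤ ∑ p ∈ Finset.univ.offDiag, pairWeight δ c₀ c₁ c₂ η (a p.1, a p.2))
    (hnum : 6 * (n * (n - 1) * (n - 2) * δ ^ 2 * (c₀ + c₁ + c₂ * (1 - η) ^ 2)) ≤ 3.14) :
    haarOrth n {U | frameCoord U g ∈ A} ≤ ENNReal.ofReal (1 / 3) := by
  have hn4 : (4 : ℝ) ≤ n := by exact_mod_cast hn
  have hπ := Real.pi_gt_d2
  have hI : 0 ≤ c₀ + c₁ + c₂ * (1 - η) ^ 2 := by positivity
  have hn2 : (0 : ℝ) ≤ (n - 2) / (2 * Real.pi) := div_nonneg (by linarith) (by positivity)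
  refine (haarOrth_le_of_offDiag hg (pairWeight_nonneg hδ h₀ h₁ h₂)
    (measurable_pairWeight δ c₀ c₁ c₂ η) hA
    (I := (n - 2) / (2 * Real.pi) * (4 * δ ^ 2 * (c₀ + c₁ + c₂ * (1 - η) ^ 2)))
    fun i j hij => ?_).trans ?_
  · refine (lintegral_haarOrth_pair_le_four hn hg hij
      (measurable_pairWeight δ c₀ c₁ c₂ η).ennreal_ofReal).trans ?_
    rw [ENNReal.ofReal_mul hn2]
    gcongr
    exact lintegral_pairWeight_le hδ h₀ h₁ h₂ hη1
  · refine ENNReal.ofReal_le_ofReal ?_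
    have h3 : n * (n - 1) * ((n - 2) / (2 * Real.pi) *
        (4 * δ ^ 2 * (c₀ + c₁ + c₂ * (1 - η) ^ 2))) =
        2 * (n * (n - 1) * (n - 2) * δ ^ 2 * (c₀ + c₁ + c₂ * (1 - η) ^ 2)) / Real.pi := by
      field_simp
      ring
    rw [h3, div_le_div_iff₀ (by positivity) (by norm_num)]
    linarith

/-! ### Bad frames in dimension at least five -/

/-- Each of the other ratios is at most 1. So when the sum of the ratios is close to its maximum, no
single ratio can be small. -/
theorem smallSum_sub_le {n : ℕ} {δ : ℝ} (hδ : 0 < δ) {a : Fin n → ℝ} {i : Fin n}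
    (hi : i ∈ smallSet δ a) : smallSum δ a - ((smallSet δ a).card - 1) ≤ |a i| / δ := by
  have h : ∑ j ∈ smallSet δ a, (|a j| / δ - 1) ≤ |a i| / δ - 1 := by
    rw [← Finset.add_sum_erase _ _ hi]
    have : ∑ j ∈ (smallSet δ a).erase i, (|a j| / δ - 1) ≤ 0 :=
      Finset.sum_nonpos fun j hj => by
        rw [sub_nonpos, div_le_one hδ]
        exact mem_smallSet.1 (Finset.mem_of_mem_erase hj)
    linarith
  rw [Finset.sum_sub_distrib, Finset.sum_const, nsmul_eq_mul, mul_one] at h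
  rw [smallSum]
  linarith

/-- Since 576 = 24², the threshold √n/24 is below 1 in this range. -/
theorem signedSum_lt_one_of_not_goodFrame {n : ℕ} (hn : n < 576) {a : Fin n → ℝ}
    (h : ¬ GoodFrame a) : signedSum a < 1 := by
  by_contra! h1
  refine h (Or.inr ⟨h1, le_trans ?_ h1⟩)
  rw [div_le_one (by norm_num), Real.sqrt_le_left (by norm_num)]
  have : (n : ℝ) < 576 := by exact_mod_cast hn
  linarith

theorem lt_two_mul_card_smallSet {n : ℕ} (hn : 2 ≤ n) {a : Fin n → ℝ} (ha : ∑ i, a i ^ 2 = 1)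
    (h : signedSum a < 1) : n < 2 * (smallSet (1 / n) a).card + 2 := by
  have hn0 : (0 : ℝ) < n := by exact_mod_cast (by omega : 0 < n)
  have h1 := lt_smallSum_of_signedSum_lt_one hn ha h
  have h2 := smallSum_le_card (by positivity : (0 : ℝ) < 1 / n) a
  have : (n : ℝ) < 2 * (smallSet (1 / n) a).card + 2 := by linarith
  exact_mod_cast this

/-- Otherwise more than n/2 coordinates exceed 1/(3√n) and contribute √n/6, while those of size at
most 1/n sum to at most 1. The signed sum is then at least √n/6 - 2, above both thresholds once √n ≥
24. -/
theorem card_smallSet_of_not_goodFrame {n : ℕ} (hn : 576 ≤ n) {a : Fin n → ℝ}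
    (h : ¬ GoodFrame a) : n ≤ 2 * (smallSet (1 / (3 * √(n : ℝ))) a).card := by
  have hn0 : (576 : ℝ) ≤ n := by exact_mod_cast hn
  have hs : (24 : ℝ) ≤ √(n : ℝ) := Real.le_sqrt_of_sq_le (by linarith)
  have hsq : √(n : ℝ) ^ 2 = n := Real.sq_sqrt (by linarith)
  by_contra! hk
  set S := smallSet (1 / (3 * √(n : ℝ))) a with hS
  have hk' : 2 * (S.card : ℝ) < n := by exact_mod_cast hk
  have hcard : ((Sᶜ).card : ℝ) = n - S.card := by
    have := Finset.card_add_card_compl S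
    rw [Fintype.card_fin] at this
    have h2 : (S.card : ℝ) + (Sᶜ).card = n := by exact_mod_cast this
    linarith
  have h1 : ((Sᶜ).card : ℝ) * (1 / (3 * √(n : ℝ))) ≤ ∑ i ∈ Sᶜ, |a i| := by
    rw [← nsmul_eq_mul, ← Finset.sum_const]
    refine Finset.sum_le_sum fun i hi => ?_
    rw [Finset.mem_compl, hS, mem_smallSet, not_le] at hi
    exact hi.le
  have h2 : ∑ i ∈ Sᶜ, |a i| ≤ ∑ i, |a i| :=
    Finset.sum_le_sum_of_subset_of_nonneg (Finset.subset_univ _) fun _ _ _ => abs_nonneg _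
  have h3 : √(n : ℝ) / 6 ≤ (n - S.card) * (1 / (3 * √(n : ℝ))) := by
    rw [mul_one_div, div_le_div_iff₀ (by norm_num) (by positivity)]
    nlinarith
  have h4 : ∑ i ∈ smallSet (1 / n) a, |a i| ≤ 1 := by
    calc ∑ i ∈ smallSet (1 / n) a, |a i| ≤ ∑ _i ∈ smallSet (1 / n) a, (1 / n : ℝ) :=
          Finset.sum_le_sum fun i hi => mem_smallSet.1 hi
      _ = (smallSet (1 / n) a).card / n := by
          rw [Finset.sum_const, nsmul_eq_mul, mul_one_div]
      _ ≤ 1 := by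
          rw [div_le_one (by linarith)]
          have := Finset.card_le_univ (smallSet (1 / n) a)
          rw [Fintype.card_fin] at this
          exact_mod_cast this
  rw [hcard] at h1
  have h5 := signedSum_eq a
  exact h (Or.inr ⟨by linarith, by linarith⟩)

theorem haarOrth_not_goodFrame_le_of_five_le {n : ℕ} (hn : 5 ≤ n) {g : E n} (hg : ‖g‖ = 1) :
    haarOrth n {U | ¬ GoodFrame (frameCoord U g)} ≤ ENNReal.ofReal (1 / 3) := by
  have hn5 : (5 : ℝ) ≤ n := by exact_mod_cast hn
  have hδ : (0 : ℝ) < 1 / n := by positivity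
  rcases le_or_gt 576 n with hbig | hsmall
  · have hs : 0 < √(n : ℝ) := Real.sqrt_pos.2 (by linarith)
    have hsq : √(n : ℝ) ^ 2 = n := Real.sq_sqrt (by linarith)
    -- k ≥ n/2 gives k(k-1) ≥ n(n-2)/4, and c₀ is the reciprocal.
    refine haarOrth_le_of_pairWeight (A := {a | ¬ GoodFrame a}) (by omega) hg
      (δ := 1 / (3 * √(n : ℝ))) (c₀ := 4 / (n * (n - 2))) (c₁ := 0) (c₂ := 0) (η := 0)
      (by positivity) (div_nonneg (by norm_num) (mul_nonneg (by linarith) (by linarith)))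
      le_rfl le_rfl zero_le_one (fun a ha _ => ?_) ?_
    · refine le_trans ?_ (sum_pairWeight_ge (by positivity)
        (div_nonneg (by norm_num) (mul_nonneg (by linarith) (by linarith)))
        le_rfl le_rfl rfl rfl).1
      have hk : (n : ℝ) ≤ 2 * (smallSet (1 / (3 * √(n : ℝ))) a).card := by
        exact_mod_cast card_smallSet_of_not_goodFrame hbig ha
      have hpos : 0 < (n : ℝ) * (n - 2) := mul_pos (by linarith) (by linarith)
      rw [mul_zero, zero_mul, zero_mul, add_zero, div_mul_eq_mul_div, le_div_iff₀ hpos]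
      nlinarith
    · have hpos : (0 : ℝ) < n - 2 := by linarith
      rw [div_pow, mul_pow, hsq]
      field_simp
      linarith
  set A : Set (Fin n → ℝ) := {a | signedSum a < 1} with hA
  refine le_trans (measure_mono fun U hU => ?_ :
    _ ≤ haarOrth n {U | frameCoord U g ∈ A}) ?_
  · exact signedSum_lt_one_of_not_goodFrame hsmall hU
  rcases le_or_gt 9 n with h9 | h9
  · have hn9 : (9 : ℝ) ≤ n := by exact_mod_cast h9
    have hpos : 0 < ((n : ℝ) - 1) * (n - 3) := mul_pos (by linarith) (by linarith)
    -- k ≥ (n-1)/2 gives k(k-1) ≥ (n-1)(n-3)/4. The resulting 24(n-2)/(n(n-3)) is about 3.11 at n =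
    -- 9 and too large at n = 8.
    refine haarOrth_le_of_pairWeight (by omega) hg (δ := 1 / n)
      (c₀ := 4 / ((n - 1) * (n - 3))) (c₁ := 0) (c₂ := 0) (η := 0) hδ
      (div_nonneg (by norm_num) hpos.le) le_rfl le_rfl zero_le_one (fun a ha ha1 => ?_) ?_
    · refine le_trans ?_ (sum_pairWeight_ge hδ (div_nonneg (by norm_num) hpos.le)
        le_rfl le_rfl rfl rfl).1
      have hk : (n : ℝ) ≤ 2 * (smallSet (1 / n) a).card + 1 := by
        have := lt_two_mul_card_smallSet (by omega) ha1 ha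
        exact_mod_cast (by omega : n ≤ 2 * (smallSet (1 / n) a).card + 1)
      rw [mul_zero, zero_mul, zero_mul, add_zero, div_mul_eq_mul_div, le_div_iff₀ hpos]
      nlinarith
    · have h3 : (0 : ℝ) < n - 3 := by linarith
      have h1 : (0 : ℝ) < n - 1 := by linarith
      have : 6 * (n * ((n : ℝ) - 1) * (n - 2) * (1 / n) ^ 2 *
          (4 / ((n - 1) * (n - 3)) + 0 + 0 * (1 - 0) ^ 2)) =
          24 * (n - 2) / (n * (n - 3)) := by
        field_simp
        ring
      rw [this, div_le_iff₀ (by positivity)]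
      nlinarith
  have key : ∀ a ∈ A, ∑ i, a i ^ 2 = 1 → ∃ k : ℕ, (smallSet (1 / n) a).card = k ∧ n < 2 * k + 2 ∧
      k ≤ n ∧ (2 * n * (n - k - 1 - smallSum (1 / n) a) < (n - k - 1 - smallSum (1 / n) a) ^ 2 +
        (n - k - 1) + smallSum (1 / n) a) ∧ 0 ≤ smallSum (1 / n) a ∧
        smallSum (1 / n) a ≤ k ∧ n - k - 2 < smallSum (1 / n) a := fun a ha ha1 => by
    refine ⟨_, rfl, lt_two_mul_card_smallSet (by omega) ha1 ha, ?_,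
      of_signedSum_lt_one (by omega) ha1 ha rfl, smallSum_nonneg hδ a, smallSum_le_card hδ a,
      lt_smallSum_of_signedSum_lt_one (by omega) ha1 ha⟩
    exact (Finset.card_le_univ _).trans_eq (Fintype.card_fin n)
  interval_cases n
  -- If k = 2, then s > 1.62, so both ratios exceed 0.62 and the two ordered pairs weigh 1/2 each.
  -- If k ≥ 3, at least six pairs weigh 1/6 each.
  · refine haarOrth_le_of_pairWeight (by norm_num) hg (δ := 1 / (5 : ℕ)) (c₀ := 1 / 6) (c₁ := 0)
      (c₂ := 1 / 3) (η := 0.62) hδ (by norm_num) le_rfl (by norm_num) (by norm_num)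
      (fun a ha ha1 => ?_) (by norm_num)
    obtain ⟨k, hk, h1, h2, h3, h4, h5, h6⟩ := key a ha ha1
    have hW := sum_pairWeight_ge (n := 5) (c₀ := 1 / 6) (c₁ := 0) (c₂ := 1 / 3) (η := 0.62) hδ
      (by norm_num) le_rfl (by norm_num) (a := a) rfl rfl
    rw [hk] at hW
    rcases (by omega : k = 2 ∨ 3 ≤ k) with rfl | hk3
    · refine le_trans ?_ (hW.2 fun i hi => ?_)
      · norm_num
      · refine lt_of_lt_of_le ?_ (smallSum_sub_le hδ hi)
        rw [hk]
        push_cast at *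
        nlinarith
    · have : (3 : ℝ) ≤ k := by exact_mod_cast hk3
      refine le_trans ?_ hW.1
      nlinarith
  -- The linear term rewards size where the count is low: s > 1.67 for k = 3 and s > 0.8 for k = 4
  -- suffice, and for k ≥ 5 the term c₀ does.
  · refine haarOrth_le_of_pairWeight (by norm_num) hg (δ := 1 / (6 : ℕ)) (c₀ := 0.05)
      (c₁ := 0.105) (c₂ := 0) (η := 0) hδ (by norm_num) (by norm_num) le_rfl (by norm_num)
      (fun a ha ha1 => ?_) (by norm_num)
    obtain ⟨k, hk, h1, h2, h3, h4, h5, h6⟩ := key a ha ha1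
    have hW := sum_pairWeight_ge (n := 6) (c₀ := 0.05) (c₁ := 0.105) (c₂ := 0) (η := 0) hδ
      (by norm_num) (by norm_num) le_rfl (a := a) rfl rfl
    rw [hk] at hW
    refine le_trans ?_ hW.1
    rcases (by omega : k = 3 ∨ k = 4 ∨ 5 ≤ k) with rfl | rfl | hk5
    · push_cast at *
      have : 1.67 < smallSum (1 / 6) a := by nlinarith
      linarith
    · push_cast at *
      have : 0.8 < smallSum (1 / 6) a := by nlinarith
      linarith
    · have : (5 : ℝ) ≤ k := by exact_mod_cast hk5
      have := mul_nonneg (by linarith : (0 : ℝ) ≤ k - 1) h4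
      nlinarith
  -- If k = 3, then s > 5/2, so all ratios exceed 1/2 and the six pairs weigh 1/6 each. If k ≥ 4, at
  -- least twelve pairs weigh 1/12 each.
  · refine haarOrth_le_of_pairWeight (by norm_num) hg (δ := 1 / (7 : ℕ)) (c₀ := 1 / 12) (c₁ := 0)
      (c₂ := 1 / 12) (η := 1 / 2) hδ (by norm_num) le_rfl (by norm_num) (by norm_num)
      (fun a ha ha1 => ?_) (by norm_num)
    obtain ⟨k, hk, h1, h2, h3, h4, h5, h6⟩ := key a ha ha1
    have hW := sum_pairWeight_ge (n := 7) (c₀ := 1 / 12) (c₁ := 0) (c₂ := 1 / 12) (η := 1 / 2) hδ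
      (by norm_num) le_rfl (by norm_num) (a := a) rfl rfl
    rw [hk] at hW
    rcases (by omega : k = 3 ∨ 4 ≤ k) with rfl | hk3
    · refine le_trans ?_ (hW.2 fun i hi => ?_)
      · norm_num
      · refine lt_of_lt_of_le ?_ (smallSum_sub_le hδ hi)
        rw [hk]
        push_cast at *
        nlinarith
    · have : (4 : ℝ) ≤ k := by exact_mod_cast hk3
      refine le_trans ?_ hW.1
      nlinarith
  · refine haarOrth_le_of_pairWeight (by norm_num) hg (δ := 1 / (8 : ℕ)) (c₀ := 1 / 12) (c₁ := 0)
      (c₂ := 0) (η := 0) hδ (by norm_num) le_rfl le_rfl (by norm_num)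
      (fun a ha ha1 => ?_) (by norm_num)
    obtain ⟨k, hk, h1, -⟩ := key a ha ha1
    have hW := sum_pairWeight_ge (n := 8) (c₀ := 1 / 12) (c₁ := 0) (c₂ := 0) (η := 0) hδ
      (by norm_num) le_rfl le_rfl (a := a) rfl rfl
    rw [hk] at hW
    have : (4 : ℝ) ≤ k := by exact_mod_cast (by omega : 4 ≤ k)
    refine le_trans ?_ hW.1
    nlinarith

/-! ### Bad frames in dimension four -/

theorem measurableSet_abs_mem_Icc (α β : ℝ) : MeasurableSet {t : ℝ | α ≤ |t| ∧ |t| ≤ β} :=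
  (measurableSet_le measurable_const (measurable_abs (α := ℝ))).inter
    (measurableSet_le (measurable_abs (α := ℝ)) measurable_const)

theorem setLIntegral_Icc_ofReal {α β : ℝ} (h : α ≤ β) {f : ℝ → ℝ} (hf : Continuous f)
    (hf0 : ∀ t, α ≤ t → t ≤ β → 0 ≤ f t) :
    ∫⁻ t in Set.Icc α β, ENNReal.ofReal (f t) = ENNReal.ofReal (∫ t in α..β, f t) := by
  rw [← ofReal_integral_eq_lintegral_ofReal hf.continuousOn.integrableOn_Icc,
    integral_Icc_eq_integral_Ioc, ← intervalIntegral.integral_of_le h]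
  filter_upwards [ae_restrict_mem measurableSet_Icc] with t ht using hf0 t ht.1 ht.2

theorem setLIntegral_abs_le {α β : ℝ} (hα : 0 ≤ α) (h : α ≤ β) {f : ℝ → ℝ} (hf : Continuous f)
    (hf0 : ∀ t, α ≤ t → t ≤ β → 0 ≤ f t) :
    ∫⁻ t in {t : ℝ | α ≤ |t| ∧ |t| ≤ β}, ENNReal.ofReal (f |t|) ≤
      ENNReal.ofReal (2 * ∫ t in α..β, f t) := by
  have hsub : {t : ℝ | α ≤ |t| ∧ |t| ≤ β} ⊆ Set.Icc (-β) (-α) ∪ Set.Icc α β := by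
    rintro t ⟨h1, h2⟩
    rcases abs_cases t with h3 | h3
    · exact Or.inr ⟨by linarith, by linarith⟩
    · exact Or.inl ⟨by linarith, by linarith⟩
  have h0 : 0 ≤ ∫ t in α..β, f t :=
    intervalIntegral.integral_nonneg h fun t ht => hf0 t ht.1 ht.2
  have e1 : ∫⁻ t in Set.Icc (-β) (-α), ENNReal.ofReal (f |t|) =
      ENNReal.ofReal (∫ t in α..β, f t) := by
    rw [← neg_neg α, ← neg_neg β, ← intervalIntegral.integral_comp_neg, neg_neg, neg_neg,
      ← setLIntegral_Icc_ofReal (by linarith) (by fun_prop) fun t h1 h2 =>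
        hf0 _ (by linarith) (by linarith)]
    refine setLIntegral_congr_fun measurableSet_Icc fun t ht => ?_
    rw [abs_of_nonpos (by linarith [ht.2])]
  have e2 : ∫⁻ t in Set.Icc α β, ENNReal.ofReal (f |t|) =
      ENNReal.ofReal (∫ t in α..β, f t) := by
    rw [← setLIntegral_Icc_ofReal h hf hf0]
    refine setLIntegral_congr_fun measurableSet_Icc fun t ht => ?_
    rw [abs_of_nonneg (by linarith [ht.1])]
  calc _ ≤ ∫⁻ t in Set.Icc (-β) (-α) ∪ Set.Icc α β, ENNReal.ofReal (f |t|) :=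
        lintegral_mono_set hsub
    _ ≤ ENNReal.ofReal (∫ t in α..β, f t) + ENNReal.ofReal (∫ t in α..β, f t) := by
        refine (lintegral_union_le _ _ _).trans ?_
        rw [e2, e1]
    _ = _ := by
        rw [← ENNReal.ofReal_add h0 h0, two_mul]

/-- A pair of small coordinates which, for a frame of `ℝ⁴` of small signed sum, forces the other
two coordinates to have a small product. -/
theorem exists_pair_of_signedSum_lt_one {a : Fin 4 → ℝ} (ha : ∑ i, a i ^ 2 = 1)
    (h : signedSum a < 1) : ∃ i j, i ≠ j ∧ |a i| ≤ 1 / 4 ∧ |a j| ≤ 1 / 4 ∧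
      ∑ k, |a k| < 1 + 2 * (|a i| + |a j|) := by
  have hcard := lt_two_mul_card_smallSet (by norm_num) ha h
  have hmem : ∀ i, i ∈ smallSet (1 / (4 : ℕ)) a ↔ |a i| ≤ 1 / 4 := fun i => by
    rw [mem_smallSet, Nat.cast_ofNat]
  set S := smallSet (1 / (4 : ℕ)) a with hS
  have hS0 : S.Nonempty := Finset.card_pos.1 (by omega)
  obtain ⟨i, hi, hmax⟩ := S.exists_max_image (fun i => |a i|) hS0
  have hS1 : (S.erase i).Nonempty := Finset.card_pos.1 (by
    rw [Finset.card_erase_of_mem hi]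
    omega)
  obtain ⟨j, hj, hmaxj⟩ := (S.erase i).exists_max_image (fun i => |a i|) hS1
  obtain ⟨hij, hjS⟩ := Finset.mem_erase.1 hj
  obtain ⟨j', rfl⟩ := Fin.exists_succAbove_eq hij
  have hile := (hmem _).1 hi
  have hjle := (hmem _).1 hjS
  refine ⟨i, _, hij.symm, hile, hjle, ?_⟩
  have hother : ∀ k : Fin 2, |a (i.succAbove (j'.succAbove k))| ≤ 1 / 4 →
      |a (i.succAbove (j'.succAbove k))| ≤ |a (i.succAbove j')| := fun k hk =>
    hmaxj _ (Finset.mem_erase.2 ⟨Fin.succAbove_ne _ _, (hmem _).2 hk⟩)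
  have hp := hother 0
  have hq := hother 1
  have hji := hmax _ hjS
  rw [signedSum, Fin.sum_univ_succAbove _ i, Fin.sum_univ_succAbove _ j', Fin.sum_univ_two,
    Nat.cast_ofNat, if_pos hile, if_pos hjle] at h
  simp_rw [← sq_abs (a _)] at ha
  rw [Fin.sum_univ_succAbove _ i, Fin.sum_univ_succAbove _ j', Fin.sum_univ_two] at ha
  rw [Fin.sum_univ_succAbove _ i, Fin.sum_univ_succAbove _ j', Fin.sum_univ_two]
  have hx := abs_nonneg (a i)
  have hy := abs_nonneg (a (i.succAbove j'))
  have hp0 := abs_nonneg (a (i.succAbove (j'.succAbove 0)))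
  have hq0 := abs_nonneg (a (i.succAbove (j'.succAbove 1)))
  generalize |a i| = x at *
  generalize |a (i.succAbove j')| = y at *
  generalize |a (i.succAbove (j'.succAbove 0))| = p at *
  generalize |a (i.succAbove (j'.succAbove 1))| = q at *
  -- The case of one large coordinate b and a third small one z ≤ y ≤ x. If the claim failed, b ≤ 1
  -- would force x = 0, then y = z = 0, against the strict bound on b.
  have key : ∀ b z : ℝ, 0 ≤ b → 0 ≤ z → z ≤ y → x ^ 2 + y ^ 2 + b ^ 2 + z ^ 2 = 1 →
      b < 1 + x + y + z → b + z < 1 + x + y := by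
    intro b z hb hz hzy hs hlt
    by_contra! hc
    have hb1 : b ≤ 1 := by nlinarith
    have hx0 : x = 0 := by linarith
    have hy0 : y = 0 := by linarith
    have hz0 : z = 0 := by linarith
    subst hx0 hy0 hz0
    linarith
  split_ifs at h with h1 h2 h2
  · exfalso
    nlinarith
  · have := key q p hq0 hp0 (hp h1) (by linarith) (by linarith)
    linarith
  · have := key p q hp0 hq0 (hq h2) (by linarith) (by linarith)
    linarith
  · linarith

/-- The square of the pairs of coordinates of absolute value at most `δ`. -/
def smallSquare (δ : ℝ) : Set (ℝ × ℝ) := {a | |a.1| ≤ δ ∧ |a.2| ≤ δ}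

theorem measurableSet_smallSquare (δ : ℝ) : MeasurableSet (smallSquare δ) :=
  (measurableSet_le (by fun_prop : Measurable fun a : ℝ × ℝ => |a.1|) measurable_const).inter
    (measurableSet_le (by fun_prop : Measurable fun a : ℝ × ℝ => |a.2|) measurable_const)

theorem setLIntegral_smallSquare_mul {δ : ℝ} (f h : ℝ → ℝ≥0∞) (hf : Measurable f)
    (hh : Measurable h) :
    ∫⁻ p in smallSquare δ, f p.1 * h p.2 =
      (∫⁻ t in {t : ℝ | 0 ≤ |t| ∧ |t| ≤ δ}, f t) * ∫⁻ t in {t : ℝ | 0 ≤ |t| ∧ |t| ≤ δ}, h t := by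
  have : smallSquare δ = {t : ℝ | 0 ≤ |t| ∧ |t| ≤ δ} ×ˢ {t : ℝ | 0 ≤ |t| ∧ |t| ≤ δ} := by
    ext p
    simp [smallSquare]
  rw [this, Measure.volume_eq_prod, ← Measure.prod_restrict]
  exact lintegral_prod_mul hf.aemeasurable hh.aemeasurable

/-- A bound for the conditional probability of a small product of two coordinates in `ℝ⁴`, as a
function of the other two coordinates. -/
noncomputable def productBound (a : ℝ × ℝ) : ℝ :=
  2 * |a.1| + 25 / 7 * |a.1| ^ 2 + (2 * |a.2| + 25 / 7 * |a.2| ^ 2) + 2 * (|a.1| * |a.2|)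

theorem productBound_nonneg (a : ℝ × ℝ) : 0 ≤ productBound a := by
  unfold productBound
  positivity

theorem measurable_productBound : Measurable productBound := by
  unfold productBound
  fun_prop

theorem lintegral_productBound_le :
    ∫⁻ a in smallSquare (1 / 4), ENNReal.ofReal (productBound a) ≤ ENNReal.ofReal 0.171 := by
  set u : ℝ → ℝ := fun t => 2 * t + 25 / 7 * t ^ 2 with hu
  have hu0 : ∀ t, 0 ≤ t → 0 ≤ u t := fun t ht => by
    rw [hu]
    positivity
  have hone : ∫⁻ t in {t : ℝ | 0 ≤ |t| ∧ |t| ≤ 1 / 4}, (1 : ℝ≥0∞) ≤ ENNReal.ofReal (1 / 2) := by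
    have := setLIntegral_abs_le (f := fun _ => 1) le_rfl (by norm_num : (0 : ℝ) ≤ 1 / 4)
      continuous_const fun _ _ _ => zero_le_one
    simp only [ENNReal.ofReal_one] at this
    refine this.trans (ENNReal.ofReal_le_ofReal ?_)
    rw [intervalIntegral.integral_const]
    norm_num
  have hid : ∫⁻ t in {t : ℝ | 0 ≤ |t| ∧ |t| ≤ 1 / 4}, ENNReal.ofReal |t| ≤
      ENNReal.ofReal (1 / 16) := by
    refine (setLIntegral_abs_le (f := fun t => t) le_rfl (by norm_num) continuous_id
      fun _ h _ => h).trans (ENNReal.ofReal_le_ofReal ?_)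
    rw [integral_id]
    norm_num
  have huu : ∫⁻ t in {t : ℝ | 0 ≤ |t| ∧ |t| ≤ 1 / 4}, ENNReal.ofReal (u |t|) ≤
      ENNReal.ofReal (1 / 8 + 25 / 672) := by
    refine (setLIntegral_abs_le (f := u) le_rfl (by norm_num) (by fun_prop)
      fun t h _ => hu0 t h).trans (ENNReal.ofReal_le_ofReal ?_)
    rw [hu, intervalIntegral.integral_add ((by fun_prop : Continuous _).intervalIntegrable _ _)
      ((by fun_prop : Continuous _).intervalIntegrable _ _),
      intervalIntegral.integral_const_mul, intervalIntegral.integral_const_mul, integral_id,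
      integral_pow]
    norm_num
  have hmu : Measurable fun t : ℝ => ENNReal.ofReal (u |t|) := by fun_prop
  have hpt : ∀ a : ℝ × ℝ, ENNReal.ofReal (productBound a) =
      ENNReal.ofReal (u |a.1|) * 1 + 1 * ENNReal.ofReal (u |a.2|) +
        2 * (ENNReal.ofReal |a.1| * ENNReal.ofReal |a.2|) := by
    intro a
    have h1 := hu0 _ (abs_nonneg a.1)
    have h2 := hu0 _ (abs_nonneg a.2)
    rw [mul_one, one_mul, ← ENNReal.ofReal_add h1 h2, ← ENNReal.ofReal_mul (abs_nonneg _),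
      ← ENNReal.ofReal_ofNat, ← ENNReal.ofReal_mul (by norm_num),
      ← ENNReal.ofReal_add (by positivity) (by positivity)]
    rfl
  simp_rw [hpt]
  rw [lintegral_add_left (by fun_prop), lintegral_add_left (by fun_prop),
    lintegral_const_mul' 2 _ (by norm_num),
    setLIntegral_smallSquare_mul (fun t => ENNReal.ofReal (u |t|)) (fun _ => 1) hmu
      measurable_const,
    setLIntegral_smallSquare_mul (fun _ => 1) (fun t => ENNReal.ofReal (u |t|)) measurable_const
      hmu,
    setLIntegral_smallSquare_mul (fun t => ENNReal.ofReal |t|) (fun t => ENNReal.ofReal |t|)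
      (by fun_prop) (by fun_prop)]
  calc _ ≤ ENNReal.ofReal (1 / 8 + 25 / 672) * ENNReal.ofReal (1 / 2) +
        ENNReal.ofReal (1 / 2) * ENNReal.ofReal (1 / 8 + 25 / 672) +
        ENNReal.ofReal 2 * (ENNReal.ofReal (1 / 16) * ENNReal.ofReal (1 / 16)) := by
        rw [ENNReal.ofReal_ofNat]
        gcongr
    _ ≤ _ := by
        rw [← ENNReal.ofReal_mul (by norm_num), ← ENNReal.ofReal_mul (by norm_num),
          ← ENNReal.ofReal_mul (by norm_num), ← ENNReal.ofReal_mul (by norm_num),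
          ← ENNReal.ofReal_add (by norm_num) (by norm_num),
          ← ENNReal.ofReal_add (by norm_num) (by norm_num)]
        exact ENNReal.ofReal_le_ofReal (by norm_num)

/-- The event that two coordinates are small and the product of the others is small. -/
noncomputable def productEvent (a : ℝ × ℝ) (z : Fin 2 → ℝ) : ℝ≥0∞ :=
  (smallSquare (1 / 4)).indicator
    (fun a => Set.indicator {z : Fin 2 → ℝ | 2 * |z 0 * z 1| < productBound a * eucl z ^ 2} 1 z) a

theorem measurable_productEvent : Measurable (Function.uncurry productEvent) := by
  have hset : MeasurableSet {p : (ℝ × ℝ) × (Fin 2 → ℝ) |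
      2 * |p.2 0 * p.2 1| < productBound p.1 * eucl p.2 ^ 2} := by
    have h1 : Measurable fun p : (ℝ × ℝ) × (Fin 2 → ℝ) => productBound p.1 :=
      measurable_productBound.comp measurable_fst
    refine measurableSet_lt (by fun_prop) (h1.mul ?_)
    simp_rw [eucl_sq]
    fun_prop
  have : Function.uncurry productEvent = Set.indicator
      ((Prod.fst ⁻¹' smallSquare (1 / 4)) ∩ {p : (ℝ × ℝ) × (Fin 2 → ℝ) |
        2 * |p.2 0 * p.2 1| < productBound p.1 * eucl p.2 ^ 2}) 1 := by
    classical
    ext ⟨a, z⟩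
    simp only [Function.uncurry_apply_pair, productEvent, Set.indicator_apply, Set.mem_inter_iff,
      Set.mem_preimage, Set.mem_ofPred_eq, Pi.one_apply]
    split_ifs <;> tauto
  rw [this]
  exact measurable_one.indicator ((measurable_fst (measurableSet_smallSquare _)).inter hset)

theorem productEvent_smul (a : ℝ × ℝ) (z : Fin 2 → ℝ) (t : ℝ) (ht : 0 < t) :
    productEvent a (t • z) = productEvent a z := by
  have h : ∀ a : ℝ × ℝ, (2 * |(t • z) 0 * (t • z) 1| < productBound a * eucl (t • z) ^ 2 ↔
      2 * |z 0 * z 1| < productBound a * eucl z ^ 2) := by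
    intro a
    have e1 : 2 * |(t • z) 0 * (t • z) 1| = t ^ 2 * (2 * |z 0 * z 1|) := by
      rw [Pi.smul_apply, Pi.smul_apply, smul_eq_mul, smul_eq_mul, mul_mul_mul_comm, abs_mul,
        abs_mul_self]
      ring
    have e2 : productBound a * eucl (t • z) ^ 2 = t ^ 2 * (productBound a * eucl z ^ 2) := by
      simp only [eucl_sq, Fin.sum_univ_two, Pi.smul_apply, smul_eq_mul]
      ring
    rw [e1, e2, mul_lt_mul_iff_right₀ (by positivity)]
  classical
  simp only [productEvent, Set.indicator_apply, Set.mem_ofPred_eq, h, Pi.one_apply]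

/-- For n = 4 two coordinates are uniform on the disc, with density 1/π, and given them the event
has probability at most `productBound`. Then 0.171/π < 1/18, one sixth of 1/3 for each of the six
unordered pairs. -/
theorem lintegral_productEvent_le {g : E 4} (hg : ‖g‖ = 1) (i : Fin 4) (j : Fin 3) :
    ∫⁻ U, productEvent (frameCoord U g i, frameCoord U g (i.succAbove j))
      (fun k => frameCoord U g (i.succAbove (j.succAbove k))) ∂haarOrth 4 ≤
      ENNReal.ofReal (1 / 18) := by
  refine (lintegral_haarOrth_le (m := 2) (by norm_num) hg i j measurable_productEvent
    productEvent_smul (Ψ := (smallSquare (1 / 4)).indicator fun a =>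
      ENNReal.ofReal (productBound a)) fun a _ c _ => ?_).trans ?_
  · by_cases ha : a ∈ smallSquare (1 / 4)
    · simp only [productEvent, Set.indicator_of_mem ha]
      exact lintegral_gaussPi_two_le (productBound_nonneg a)
    · have hz : ∀ z, productEvent a z = 0 := fun z => Set.indicator_of_notMem ha _
      simp [hz]
  · calc _ = ∫⁻ a in disc, (smallSquare (1 / 4)).indicator
          (fun a => ENNReal.ofReal (productBound a)) a * ENNReal.ofReal (1 / Real.pi) := by
          refine setLIntegral_congr_fun measurableSet_disc fun a ha => ?_
          have := height_pos ha
          congr 2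
          rw [div_self (by positivity)]
          push_cast
          field_simp
      _ ≤ ∫⁻ a, (smallSquare (1 / 4)).indicator
          (fun a => ENNReal.ofReal (productBound a)) a * ENNReal.ofReal (1 / Real.pi) :=
          setLIntegral_le_lintegral _ _
      _ = (∫⁻ a in smallSquare (1 / 4), ENNReal.ofReal (productBound a)) *
          ENNReal.ofReal (1 / Real.pi) := by
          rw [lintegral_mul_const' _ _ ENNReal.ofReal_ne_top,
            lintegral_indicator (measurableSet_smallSquare _)]
      _ ≤ ENNReal.ofReal 0.171 * ENNReal.ofReal (1 / Real.pi) := by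
          gcongr
          exact lintegral_productBound_le
      _ ≤ _ := by
          rw [← ENNReal.ofReal_mul (by norm_num)]
          refine ENNReal.ofReal_le_ofReal ?_
          have := Real.pi_gt_d2
          rw [mul_one_div, div_le_div_iff₀ (by positivity) (by norm_num)]
          linarith

/-- The other two coordinates p, q satisfy p + q < 1 + x + y and p² + q² = 1 - x² - y², which bounds
2pq = (p + q)² - (p² + q²). -/
theorem productEvent_eq_one {a : Fin 4 → ℝ} (ha : ∑ i, a i ^ 2 = 1) {i : Fin 4} {j : Fin 3}
    (hi : |a i| ≤ 1 / 4) (hj : |a (i.succAbove j)| ≤ 1 / 4)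
    (h : ∑ k, |a k| < 1 + 2 * (|a i| + |a (i.succAbove j)|)) :
    productEvent (a i, a (i.succAbove j)) (fun k => a (i.succAbove (j.succAbove k))) = 1 := by
  have hmem : (a i, a (i.succAbove j)) ∈ smallSquare (1 / 4) := ⟨hi, hj⟩
  rw [productEvent, Set.indicator_of_mem hmem, Set.indicator_of_mem, Pi.one_apply]
  simp_rw [← sq_abs (a _)] at ha
  rw [Fin.sum_univ_succAbove _ i, Fin.sum_univ_succAbove _ j, Fin.sum_univ_two] at ha h
  rw [Set.mem_ofPred_eq, eucl_sq, Fin.sum_univ_two, productBound, abs_mul]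
  simp_rw [← sq_abs (a _)]
  have hx := abs_nonneg (a i)
  have hy := abs_nonneg (a (i.succAbove j))
  have hp0 := abs_nonneg (a (i.succAbove (j.succAbove 0)))
  have hq0 := abs_nonneg (a (i.succAbove (j.succAbove 1)))
  generalize |a i| = x at *
  generalize |a (i.succAbove j)| = y at *
  generalize |a (i.succAbove (j.succAbove 0))| = p at *
  generalize |a (i.succAbove (j.succAbove 1))| = q at *
  have hr : p ^ 2 + q ^ 2 = 1 - (x ^ 2 + y ^ 2) := by linarith
  have hx2 : x ^ 2 ≤ 1 / 16 := by nlinarith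
  have hy2 : y ^ 2 ≤ 1 / 16 := by nlinarith
  have h1 : 2 * (p * q) < 2 * x + 2 * x ^ 2 + (2 * y + 2 * y ^ 2) + 2 * (x * y) := by
    have : (p + q) ^ 2 < (1 + x + y) ^ 2 := pow_lt_pow_left₀ (by linarith) (by positivity) two_ne_zero
    nlinarith
  refine h1.trans_le ?_
  rw [hr]
  -- Let N be this left side and s = x² + y² ≤ 1/8. Then `productBound` is N + (11/7)s, and (N +
  -- (11/7)s)(1 - s) ≥ N because N ≤ 11/8 = (11/7)(7/8). This explains the coefficient 25/7 = 2 +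
  -- 11/7.
  have hN : 2 * x + 2 * x ^ 2 + (2 * y + 2 * y ^ 2) + 2 * (x * y) ≤ 11 / 8 := by nlinarith
  have hs : 0 ≤ x ^ 2 + y ^ 2 := by positivity
  nlinarith [mul_nonneg hs (by linarith : 0 ≤ 1 / 8 - (x ^ 2 + y ^ 2)), mul_nonneg hs (sub_nonneg.2 hN)]

theorem exists_productEvent_eq_one {a : Fin 4 → ℝ} (ha : ∑ i, a i ^ 2 = 1) (h : signedSum a < 1) :
    ∃ (i : Fin 4) (j : Fin 3), i ≤ j.castSucc ∧
      productEvent (a i, a (i.succAbove j)) (fun k => a (i.succAbove (j.succAbove k))) = 1 := by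
  obtain ⟨i, j, hij, hi, hj, hlt⟩ : ∃ i j, i < j ∧ |a i| ≤ 1 / 4 ∧ |a j| ≤ 1 / 4 ∧
      ∑ k, |a k| < 1 + 2 * (|a i| + |a j|) := by
    obtain ⟨i, j, hij, hi, hj, hlt⟩ := exists_pair_of_signedSum_lt_one ha h
    rcases lt_or_gt_of_ne hij with h | h
    · exact ⟨i, j, h, hi, hj, hlt⟩
    · exact ⟨j, i, h, hj, hi, by rwa [add_comm |a j|]⟩
  obtain ⟨j, rfl⟩ := Fin.exists_succAbove_eq hij.ne'
  exact ⟨i, j, (Fin.lt_succAbove_iff_le_castSucc _ _).1 hij, productEvent_eq_one ha hi hj hlt⟩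

/-- The event `productEvent` for the pair of coordinates `p.1`, `p.1.succAbove p.2`. -/
noncomputable def pairEvent (a : Fin 4 → ℝ) (p : Fin 4 × Fin 3) : ℝ≥0∞ :=
  productEvent (a p.1, a (p.1.succAbove p.2)) (fun k => a (p.1.succAbove (p.2.succAbove k)))

theorem measurable_pairEvent (p : Fin 4 × Fin 3) : Measurable fun a => pairEvent a p := by
  have h : Measurable fun a : Fin 4 → ℝ => ((a p.1, a (p.1.succAbove p.2)),
      fun k => a (p.1.succAbove (p.2.succAbove k))) :=
    ((measurable_pi_apply _).prodMk (measurable_pi_apply _)).prodMk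
      (measurable_pi_lambda _ fun k => measurable_pi_apply _)
  exact measurable_productEvent.comp h

/-- Representatives of the pairs of coordinates. -/
def coordPairs : Finset (Fin 4 × Fin 3) := Finset.univ.filter fun p => p.1 ≤ p.2.castSucc

theorem card_coordPairs : coordPairs.card = 6 := by decide

theorem one_le_sum_pairEvent {a : Fin 4 → ℝ} (ha : ∑ i, a i ^ 2 = 1) (h : signedSum a < 1) :
    1 ≤ ∑ p ∈ coordPairs, pairEvent a p := by
  obtain ⟨i, j, hij, he⟩ := exists_productEvent_eq_one ha h
  have hmem : (i, j) ∈ coordPairs := Finset.mem_filter.2 ⟨Finset.mem_univ _, hij⟩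
  have he' : pairEvent a (i, j) = 1 := he
  exact he'.ge.trans (Finset.single_le_sum (fun _ _ => zero_le) hmem)

theorem haarOrth_not_goodFrame_le_of_four {g : E 4} (hg : ‖g‖ = 1) :
    haarOrth 4 {U | ¬ GoodFrame (frameCoord U g)} ≤ ENNReal.ofReal (1 / 3) := by
  have hm : Measurable fun U : OrthGroup 4 => frameCoord U g :=
    measurable_frameCoord.comp (measurable_id.prodMk measurable_const)
  have hFm : ∀ p, Measurable fun U : OrthGroup 4 => pairEvent (frameCoord U g) p := fun p =>
    (measurable_pairEvent p).comp hm
  have h1 : haarOrth 4 {U | ¬ GoodFrame (frameCoord U g)} ≤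
      ∫⁻ U, ∑ p ∈ coordPairs, pairEvent (frameCoord U g) p ∂haarOrth 4 := by
    refine meas_le_lintegral₀ (Finset.measurable_sum _ fun p _ => hFm p).aemeasurable
      fun U hU => ?_
    have ha : ∑ i, frameCoord U g i ^ 2 = 1 := by
      rw [← eucl_sq, eucl_frameCoord, hg, one_pow]
    exact one_le_sum_pairEvent ha (signedSum_lt_one_of_not_goodFrame (by norm_num) hU)
  refine h1.trans ?_
  rw [lintegral_finsetSum _ fun p _ => hFm p]
  have h2 : ∀ p ∈ coordPairs, ∫⁻ U, pairEvent (frameCoord U g) p ∂haarOrth 4 ≤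
      ENNReal.ofReal (1 / 18) := fun p _ => lintegral_productEvent_le hg p.1 p.2
  refine (Finset.sum_le_sum h2).trans ?_
  rw [Finset.sum_const, card_coordPairs, nsmul_eq_mul, ← ENNReal.ofReal_natCast,
    ← ENNReal.ofReal_mul (by norm_num)]
  norm_num

/-! ### Bad frames in dimension three -/

/-- The region of a small coordinate `z` and a coordinate `y` of medium size. -/
def earRegion : Set (ℝ × ℝ) :=
  {a | (6 / 25 ≤ |a.1| ∧ |a.1| ≤ 1 / 3) ∧
    1 / 3 ≤ |a.2| ∧ |a.2| ≤ 1 / 3 + 25 / 7 * (|a.1| - 6 / 25)}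

theorem measurableSet_earRegion : MeasurableSet earRegion := by
  have h1 : Measurable fun a : ℝ × ℝ => |a.1| := by fun_prop
  have h2 : Measurable fun a : ℝ × ℝ => |a.2| := by fun_prop
  have h3 : Measurable fun a : ℝ × ℝ => 1 / 3 + 25 / 7 * (|a.1| - 6 / 25) := by fun_prop
  exact ((measurableSet_le measurable_const h1).inter (measurableSet_le h1 measurable_const)).inter
    ((measurableSet_le measurable_const h2).inter (measurableSet_le h2 h3))

/-- The region consists of four right triangles with legs 7/75 and 1/3. -/
theorem volume_earRegion_le : volume earRegion ≤ ENNReal.ofReal (14 / 225) := by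
  have hslice : ∀ z : ℝ, volume (Prod.mk z ⁻¹' earRegion) ≤
      {t : ℝ | 6 / 25 ≤ |t| ∧ |t| ≤ 1 / 3}.indicator
        (fun t => ENNReal.ofReal (50 / 7 * (|t| - 6 / 25))) z := by
    intro z
    by_cases hz : z ∈ {t : ℝ | 6 / 25 ≤ |t| ∧ |t| ≤ 1 / 3}
    · have hz1 : 6 / 25 ≤ |z| := hz.1
      rw [Set.indicator_of_mem hz]
      have h := setLIntegral_abs_le (α := 1 / 3) (β := 1 / 3 + 25 / 7 * (|z| - 6 / 25))
        (f := fun _ => 1) (by norm_num) (by linarith) continuous_const fun _ _ _ => zero_le_one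
      rw [ENNReal.ofReal_one, setLIntegral_one, intervalIntegral.integral_const] at h
      refine (measure_mono fun y hy => ?_).trans (h.trans (ENNReal.ofReal_le_ofReal ?_))
      · exact hy.2
      · rw [smul_eq_mul]
        linarith
    · rw [Set.indicator_of_notMem hz]
      have : Prod.mk z ⁻¹' earRegion = ∅ := Set.eq_empty_of_forall_notMem fun y hy => hz hy.1
      rw [this, measure_empty]
  rw [Measure.volume_eq_prod, Measure.prod_apply measurableSet_earRegion]
  refine (lintegral_mono hslice).trans ?_
  rw [lintegral_indicator (measurableSet_abs_mem_Icc _ _)]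
  refine (setLIntegral_abs_le (f := fun t => 50 / 7 * (t - 6 / 25)) (by norm_num) (by norm_num)
    (by fun_prop) fun t h _ => by linarith).trans (ENNReal.ofReal_le_ofReal ?_)
  rw [intervalIntegral.integral_const_mul, intervalIntegral.integral_sub
    intervalIntegral.intervalIntegrable_id intervalIntegrable_const, integral_id,
    intervalIntegral.integral_const, smul_eq_mul]
  norm_num

theorem volume_smallSquare_le {δ : ℝ} (hδ : 0 ≤ δ) :
    volume (smallSquare δ) ≤ ENNReal.ofReal ((2 * δ) ^ 2) := by
  have h := setLIntegral_smallSquare_mul (δ := δ) (fun _ => 1) (fun _ => 1) measurable_const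
    measurable_const
  have h1 := setLIntegral_abs_le (f := fun _ => 1) le_rfl hδ continuous_const
    fun _ _ _ => zero_le_one
  simp only [ENNReal.ofReal_one, setLIntegral_one, mul_one, intervalIntegral.integral_const,
    smul_eq_mul, sub_zero] at h h1
  rw [h, sq, ENNReal.ofReal_mul (by positivity)]
  gcongr

/-- Squaring x < 1 + z - y gives φ(y) > 0 for φ(c) = c² - (1+z)c + z² + z, which decreases up to
(1+z)/2 > y. So no c ≤ y has φ(c) ≤ 0. For z < 6/25 this excludes c = 1/3. -/
theorem mem_earRegion_of_signedSum {x y z : ℝ} (hz0 : 0 ≤ z) (hz : z ≤ 1 / 3) (hy : 1 / 3 < y)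
    (hyx : y ≤ x) (hs : x ^ 2 + y ^ 2 + z ^ 2 = 1) (h : x + y - z < 1) :
    6 / 25 ≤ z ∧ y ≤ 1 / 3 + 25 / 7 * (z - 6 / 25) := by
  have hp : 0 < y ^ 2 + z ^ 2 + z - y - y * z := by
    have : x ^ 2 < (1 + z - y) ^ 2 := pow_lt_pow_left₀ (by linarith) (by linarith) two_ne_zero
    nlinarith
  have hmono : ∀ c, 0 ≤ y - c → c ^ 2 + z ^ 2 + z - c - c * z ≤ 0 → False := fun c hc hcp => by
    nlinarith [mul_nonneg hc (by linarith : 0 ≤ 1 + z - y - c)]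
  have hz1 : 6 / 25 ≤ z := by
    by_contra! hlt
    exact hmono (1 / 3) (by linarith) (by nlinarith)
  refine ⟨hz1, ?_⟩
  by_contra! hlt
  -- The line c(z) joins (6/25, 1/3) to (1/3, 2/3). Along it φ is convex in z and nonpositive at
  -- both ends, 2/3 being the double root of φ at z = 1/3.
  refine hmono _ (sub_nonneg.2 hlt.le) ?_
  nlinarith [mul_nonneg (sub_nonneg.2 hz1) (sub_nonneg.2 hz)]

/-- The weight of an ordered pair of coordinates in `ℝ³`. -/
noncomputable def tripleWeight (a : ℝ × ℝ) : ℝ :=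
  (smallSquare (1 / 3)).indicator (fun _ => 1 / 2) a + earRegion.indicator (fun _ => 1) a

theorem tripleWeight_nonneg (a : ℝ × ℝ) : 0 ≤ tripleWeight a :=
  add_nonneg (Set.indicator_nonneg (fun _ _ => by norm_num) _)
    (Set.indicator_nonneg (fun _ _ => zero_le_one) _)

theorem measurable_tripleWeight : Measurable tripleWeight :=
  (measurable_const.indicator (measurableSet_smallSquare _)).add
    (measurable_const.indicator measurableSet_earRegion)

/-- Two small coordinates count 1/2 in each order. If only one is small, it forms a point of the ear
region with the smaller of the other two. -/
theorem one_le_sum_tripleWeight {a : Fin 3 → ℝ} (ha : ∑ i, a i ^ 2 = 1) (h : signedSum a < 1) :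
    1 ≤ ∑ p ∈ Finset.univ.offDiag, tripleWeight (a p.1, a p.2) := by
  by_cases htwo : ∃ i j, i ≠ j ∧ |a i| ≤ 1 / 3 ∧ |a j| ≤ 1 / 3
  · obtain ⟨i, j, hij, hi, hj⟩ := htwo
    have hhalf : ∀ i j, |a i| ≤ 1 / 3 → |a j| ≤ 1 / 3 → 1 / 2 ≤ tripleWeight (a i, a j) :=
      fun i j hi hj => by
        have hmem : (a i, a j) ∈ smallSquare (1 / 3) := ⟨hi, hj⟩
        rw [tripleWeight, Set.indicator_of_mem hmem]
        exact le_add_of_nonneg_right (Set.indicator_nonneg (fun _ _ => zero_le_one) _)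
    have hsub : ({(i, j), (j, i)} : Finset (Fin 3 × Fin 3)) ⊆ Finset.univ.offDiag := by
      intro p hp
      rw [Finset.mem_insert, Finset.mem_singleton] at hp
      rcases hp with rfl | rfl
      · simpa using hij
      · simpa using hij.symm
    refine le_trans ?_ (Finset.sum_le_sum_of_subset_of_nonneg hsub fun _ _ _ =>
      tripleWeight_nonneg _)
    rw [Finset.sum_pair (by simp [hij])]
    linarith [hhalf i j hi hj, hhalf j i hj hi]
  · have hcard := lt_two_mul_card_smallSet (by norm_num) ha h
    obtain ⟨i, hi⟩ := Finset.card_pos.1 (by omega : 0 < (smallSet (1 / (3 : ℕ)) a).card)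
    rw [mem_smallSet, Nat.cast_ofNat] at hi
    have hbig : ∀ j : Fin 2, 1 / 3 < |a (i.succAbove j)| := fun j => by
      by_contra! hj
      exact htwo ⟨i, _, (Fin.succAbove_ne i j).symm, hi, hj⟩
    rw [signedSum, Fin.sum_univ_succAbove _ i, Fin.sum_univ_two, Nat.cast_ofNat, if_pos hi,
      if_neg (hbig 0).not_ge, if_neg (hbig 1).not_ge] at h
    simp_rw [← sq_abs (a _)] at ha
    rw [Fin.sum_univ_succAbove _ i, Fin.sum_univ_two] at ha
    have hex : ∃ j : Fin 2, (a i, a (i.succAbove j)) ∈ earRegion := by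
      rcases le_total |a (i.succAbove 0)| |a (i.succAbove 1)| with hle | hle
      · have := mem_earRegion_of_signedSum (abs_nonneg _) hi (hbig 0) hle (by linarith)
          (by linarith)
        exact ⟨0, ⟨this.1, hi⟩, (hbig 0).le, this.2⟩
      · have := mem_earRegion_of_signedSum (abs_nonneg _) hi (hbig 1) hle (by linarith)
          (by linarith)
        exact ⟨1, ⟨this.1, hi⟩, (hbig 1).le, this.2⟩
    obtain ⟨j, hj⟩ := hex
    have h1 : 1 ≤ tripleWeight (a i, a (i.succAbove j)) := by
      rw [tripleWeight, Set.indicator_of_mem hj]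
      exact le_add_of_nonneg_left (Set.indicator_nonneg (fun _ _ => by norm_num) _)
    refine h1.trans (Finset.single_le_sum (f := fun p : Fin 3 × Fin 3 => tripleWeight (a p.1, a p.2))
      (fun _ _ => tripleWeight_nonneg _) (a := (i, i.succAbove j)) ?_)
    simp

theorem lintegral_tripleWeight_le :
    ∫⁻ a in disc, ENNReal.ofReal (tripleWeight a) *
        ENNReal.ofReal (1 / (2 * Real.pi) * (height a)⁻¹) ≤ ENNReal.ofReal (1 / 18) := by
  have hden : ∀ (a : ℝ × ℝ) (r : ℝ), a ∈ disc → 0 < r → a.1 ^ 2 + a.2 ^ 2 ≤ 1 - r ^ 2 →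
      (height a)⁻¹ ≤ r⁻¹ := fun a r ha hr h => by
    refine inv_anti₀ hr (Real.le_sqrt_of_sq_le (by linarith))
  have hpt : ∀ a ∈ disc, ENNReal.ofReal (tripleWeight a) *
      ENNReal.ofReal (1 / (2 * Real.pi) * (height a)⁻¹) ≤
      ENNReal.ofReal (1 / (2 * Real.pi)) *
        ((smallSquare (1 / 3)).indicator (fun _ => ENNReal.ofReal 0.567) a +
          earRegion.indicator (fun _ => ENNReal.ofReal (3 / 2)) a) := by
    intro a ha
    have hh : 0 ≤ (height a)⁻¹ := inv_nonneg.2 (height_pos ha).le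
    have e1 : (smallSquare (1 / 3)).indicator (fun _ => ENNReal.ofReal 0.567) a =
        ENNReal.ofReal ((smallSquare (1 / 3)).indicator (fun _ => 0.567) a) := by
      by_cases h : a ∈ smallSquare (1 / 3)
      · rw [Set.indicator_of_mem h, Set.indicator_of_mem h]
      · rw [Set.indicator_of_notMem h, Set.indicator_of_notMem h, ENNReal.ofReal_zero]
    have e2 : earRegion.indicator (fun _ => ENNReal.ofReal (3 / 2)) a =
        ENNReal.ofReal (earRegion.indicator (fun _ => 3 / 2) a) := by
      by_cases h : a ∈ earRegion <;> simp [h]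
    have n1 : 0 ≤ (smallSquare (1 / 3)).indicator (fun _ => (0.567 : ℝ)) a :=
      Set.indicator_nonneg (fun _ _ => by norm_num) _
    have n2 : 0 ≤ earRegion.indicator (fun _ => (3 / 2 : ℝ)) a :=
      Set.indicator_nonneg (fun _ _ => by norm_num) _
    rw [e1, e2, ← ENNReal.ofReal_add n1 n2, ← ENNReal.ofReal_mul (tripleWeight_nonneg a),
      ← ENNReal.ofReal_mul (by positivity)]
    refine ENNReal.ofReal_le_ofReal ?_
    rw [mul_left_comm]
    refine mul_le_mul_of_nonneg_left ?_ (by positivity)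
    rw [tripleWeight, add_mul]
    refine add_le_add ?_ ?_
    · by_cases h : a ∈ smallSquare (1 / 3)
      · rw [Set.indicator_of_mem h, Set.indicator_of_mem h]
        have h1 : a.1 ^ 2 ≤ (1 / 3) ^ 2 := sq_le_sq' (abs_le.1 h.1).1 (abs_le.1 h.1).2
        have h2 : a.2 ^ 2 ≤ (1 / 3) ^ 2 := sq_le_sq' (abs_le.1 h.2).1 (abs_le.1 h.2).2
        -- The height squared is at least 1 - 2/9 = 7/9, so half its inverse is at most 0.567.
        have := hden a (1000 / 1134) ha (by norm_num) (by linarith)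
        linarith
      · rw [Set.indicator_of_notMem h, Set.indicator_of_notMem h, zero_mul]
    · by_cases h : a ∈ earRegion
      · rw [Set.indicator_of_mem h, Set.indicator_of_mem h]
        have h0 : |a.2| ≤ 2 / 3 := by linarith [h.2.2, h.1.2]
        have h1 : a.1 ^ 2 ≤ (1 / 3) ^ 2 := sq_le_sq' (abs_le.1 h.1.2).1 (abs_le.1 h.1.2).2
        have h2 : a.2 ^ 2 ≤ (2 / 3) ^ 2 := sq_le_sq' (abs_le.1 h0).1 (abs_le.1 h0).2
        -- The height squared is at least 1 - 1/9 - 4/9 = (2/3)².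
        have := hden a (2 / 3) ha (by norm_num) (by linarith)
        linarith
      · rw [Set.indicator_of_notMem h, Set.indicator_of_notMem h, zero_mul]
  calc _ ≤ ∫⁻ a in disc, ENNReal.ofReal (1 / (2 * Real.pi)) *
        ((smallSquare (1 / 3)).indicator (fun _ => ENNReal.ofReal 0.567) a +
          earRegion.indicator (fun _ => ENNReal.ofReal (3 / 2)) a) :=
        setLIntegral_mono' measurableSet_disc hpt
    _ ≤ ∫⁻ a, ENNReal.ofReal (1 / (2 * Real.pi)) *
        ((smallSquare (1 / 3)).indicator (fun _ => ENNReal.ofReal 0.567) a +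
          earRegion.indicator (fun _ => ENNReal.ofReal (3 / 2)) a) :=
        setLIntegral_le_lintegral _ _
    _ = ENNReal.ofReal (1 / (2 * Real.pi)) *
        (ENNReal.ofReal 0.567 * volume (smallSquare (1 / 3)) +
          ENNReal.ofReal (3 / 2) * volume earRegion) := by
        rw [lintegral_const_mul' _ _ ENNReal.ofReal_ne_top,
          lintegral_add_left (measurable_const.indicator (measurableSet_smallSquare _)),
          lintegral_indicator_const (measurableSet_smallSquare _),
          lintegral_indicator_const measurableSet_earRegion]
    _ ≤ ENNReal.ofReal (1 / (2 * Real.pi)) *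
        (ENNReal.ofReal 0.567 * ENNReal.ofReal ((2 * (1 / 3)) ^ 2) +
          ENNReal.ofReal (3 / 2) * ENNReal.ofReal (14 / 225)) := by
        gcongr
        · exact volume_smallSquare_le (by norm_num)
        · exact volume_earRegion_le
    _ ≤ _ := by
        rw [← ENNReal.ofReal_mul (by norm_num), ← ENNReal.ofReal_mul (by norm_num),
          ← ENNReal.ofReal_add (by norm_num) (by norm_num), ← ENNReal.ofReal_mul (by positivity)]
        refine ENNReal.ofReal_le_ofReal ?_
        have := Real.pi_gt_d2
        rw [one_div_mul_eq_div, div_le_div_iff₀ (by positivity) (by norm_num)]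
        norm_num
        linarith

theorem haarOrth_not_goodFrame_le_of_three {g : E 3} (hg : ‖g‖ = 1) :
    haarOrth 3 {U | ¬ GoodFrame (frameCoord U g)} ≤ ENNReal.ofReal (1 / 3) := by
  refine (haarOrth_le_of_offDiag (A := {a | ¬ GoodFrame a}) hg tripleWeight_nonneg
    measurable_tripleWeight (fun a ha ha1 => one_le_sum_tripleWeight ha1
      (signedSum_lt_one_of_not_goodFrame (by norm_num) ha)) (I := 1 / 18) fun i j hij => ?_).trans ?_
  · refine (lintegral_haarOrth_pair_le le_rfl hg hij
      measurable_tripleWeight.ennreal_ofReal).trans (le_trans (le_of_eq ?_)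
        lintegral_tripleWeight_le)
    refine setLIntegral_congr_fun measurableSet_disc fun a ha => ?_
    have := height_pos ha
    congr 2
    push_cast
    field_simp
    norm_num
  · refine ENNReal.ofReal_le_ofReal ?_
    norm_num

/-! ### The probability of a good frame and the conclusion -/

theorem measurable_signedSum {n : ℕ} : Measurable (signedSum (n := n)) := by
  refine Finset.measurable_sum _ fun i _ => ?_
  have h : Measurable fun a : Fin n → ℝ => |a i| := by fun_prop
  exact Measurable.ite (measurableSet_le h measurable_const) h.neg h

theorem measurableSet_goodFrame {n : ℕ} : MeasurableSet {a : Fin n → ℝ | GoodFrame a} :=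
  (MeasurableSet.const _).union ((measurableSet_le measurable_const measurable_signedSum).inter
    (measurableSet_le measurable_const measurable_signedSum))

/-- A Haar-distributed frame is good with probability at least `2/3`. -/
theorem le_haarOrth_goodFrame {n : ℕ} (hn : 2 ≤ n) {g : E n} (hg : ‖g‖ = 1) :
    (2 / 3 : ℝ≥0∞) ≤ haarOrth n {U | GoodFrame (frameCoord U g)} := by
  have hm : MeasurableSet {U : OrthGroup n | GoodFrame (frameCoord U g)} :=
    (measurable_frameCoord.comp (measurable_id.prodMk measurable_const)) measurableSet_goodFrame
  have hbad : haarOrth n {U | ¬ GoodFrame (frameCoord U g)} ≤ ENNReal.ofReal (1 / 3) := by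
    rcases (by omega : n = 2 ∨ n = 3 ∨ n = 4 ∨ 5 ≤ n) with rfl | rfl | rfl | h
    · have : {U : OrthGroup 2 | ¬ GoodFrame (frameCoord U g)} = ∅ :=
        Set.eq_empty_of_forall_notMem fun U hU => hU (Or.inl rfl)
      rw [this, measure_empty]
      exact zero_le
    · exact haarOrth_not_goodFrame_le_of_three hg
    · exact haarOrth_not_goodFrame_le_of_four hg
    · exact haarOrth_not_goodFrame_le_of_five_le h hg
  have hsum := measure_add_measure_compl (μ := haarOrth n) hm
  rw [measure_univ] at hsum
  have h23 : (2 / 3 : ℝ≥0∞) + ENNReal.ofReal (1 / 3) = 1 := by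
    have : (2 / 3 : ℝ≥0∞) = ENNReal.ofReal (2 / 3) := by
      rw [ENNReal.ofReal_div_of_pos (by norm_num), ENNReal.ofReal_ofNat, ENNReal.ofReal_ofNat]
    rw [this, ← ENNReal.ofReal_add (by norm_num) (by norm_num)]
    norm_num
  refine ENNReal.le_of_add_le_add_right ENNReal.ofReal_ne_top (a := ENNReal.ofReal (1 / 3)) ?_
  rw [h23, ← hsum]
  gcongr
  exact hbad

end GradComparison

theorem mainTheorem1 :
    ∃ C : ℝ, 0 < C ∧
      ∀ (n : ℕ) (_ : 2 ≤ n) (L γ ε : ℝ) (_ : 0 < L) (_ : 0 < γ)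
        (_ : 0 < ε) (_ : ε < 1 / √2)
        (f : GradComparison.E n → ℝ) (_ : GradComparison.IsLSmooth L f)
        (O : GradComparison.E n → GradComparison.E n → ℤˣ)
        (_ : GradComparison.IsComparisonOracle f O)
        (x : GradComparison.E n) (_ : γ ≤ ‖gradient f x‖)
        (frame : GradComparison.E n → OrthonormalBasis (Fin n) ℝ (GradComparison.E n))
        (_ : ∀ u : GradComparison.E n, ‖u‖ = 1 → ∀ i : Fin n, i.val = 0 → frame u i = u),
        ∃ S : Set (GradComparison.OrthGroup n),
          MeasurableSet S ∧ (2 / 3 : ℝ≥0∞) ≤ GradComparison.haarOrth n S ∧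
          ∀ U ∈ S, ∃ (v : GradComparison.E n) (q : ℕ),
            (v, q) ∈ GradComparison.classicalEstimation frame L γ ε x U O ∧
            (q : ℝ) ≤ C * (n * Real.log (1 / ε)) ∧
            ‖v‖ = 1 ∧
            ‖‖gradient f x‖⁻¹ • gradient f x - v‖ ≤ ε := by
  refine ⟨9000, by norm_num, fun n hn L γ ε hL hγ hε hε1 f hf O hO x hx frame hframe => ?_⟩
  have hg0 : gradient f x ≠ 0 := norm_pos_iff.1 (hγ.trans_le hx)
  set g : GradComparison.E n := ‖gradient f x‖⁻¹ • gradient f x with hg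
  have hg1 : ‖g‖ = 1 := by
    rw [hg, norm_smul, norm_inv, norm_norm, inv_mul_cancel₀ (norm_ne_zero_iff.2 hg0)]
  exact ⟨{U | GradComparison.GoodFrame (GradComparison.frameCoord U g)},
    (GradComparison.measurable_frameCoord.comp (measurable_id.prodMk measurable_const))
      GradComparison.measurableSet_goodFrame,
    GradComparison.le_haarOrth_goodFrame hn hg1, fun U hU =>
      GradComparison.exists_mem_classicalEstimation hn hL hf hO hγ hx hε hε1 hframe U hU⟩
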